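/- \textbf{Setting.} Let $D,d\ge 1$. Let $\mathcal O^{\rm full}=\bigcup_X\bigotimes_{x\in X}M_d(\mathbb C)$ ($X\subset\mathbb Z^D$ finite) be the $\star$-algebra of all local observables of the quantum spin lattice on $\mathbb Z^D$, with the operator norm, and let $\mathcal O\subset\mathcal O^{\rm full}$ be either the whole algebra or any unital $\star$-subalgebra invariant under the translations $\iota_x$, $x\in\mathbb Z^D$. Let $\mathcal A$ be the norm closure of $\mathcal O$. Write $\mathrm{supp}(A)$ for the support of $A\in\mathcal O$ ($\emptyset$ if $A\in\mathbb C\mathbf 1$), $|A|$ for its cardinality, $\mathrm{dist}(A,B)$ for the $\ell^1$-distance of the supports ($\infty$ if one is empty), and $B(r)=\{x\in\mathbb Z^D:\sum_i|x_i|\le r\}$. A state is a normalised positive linear functional on $\mathcal A$. \textbf{Clustering.} A translation-invariant state $\omega$ is \emph{clustering} if there are $p>D$, $\nu:\mathbb N\to(0,\infty)$ and $f:\mathbb N\to(0,\infty)$ with $f(n)\le n^{-p}$ for $n>0$, such that $$|\omega(AB)-\omega(A)\omega(B)|\le \nu(\ell)\,\|A\|\,\|B\|\,f(\mathrm{dist}(A,B))$$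 for all $\ell\in\mathbb N$ and $A,B\in\mathcal O$ with $|A|,|B|<\ell$ and $\mathrm{dist}(A,B)<\infty$. It is \emph{sizably $p$-clustering} with constants $\nu,a>0$ if this holds with $\nu(\ell)=\nu\ell^a$ and this $p$. A family of states is \emph{uniformly sizably $p$-clustering} if one pair $\nu,a$ serves all its members. For a clustering state put $$\langle A,B\rangle_\omega=\sum_{x\in\mathbb Z^D}\big(\omega(\iota_x(A)^\star B)-\omega(A^\star)\omega(B)\big),\quad \langle\langle A,B\rangle\rangle_\omega=\tfrac12\big(\langle A,B\rangle_\omega+\langle B^\star,A^\star\rangle_\omega\big),\quad \|A\|_\omega^2=\langle\langle A,A\rangle\rangle_\omega .$$ \textbf{Pseudolocal charges.} Let $\omega$ be a clustering state. A sequence $Q=(Q_n)_{n\in\mathbb N}$ in $\mathcal O$ with $\mathrm{supp}(Q_n)\subset B(n)$ is \emph{pseudolocal} with respect to $\omega$ if, with $\bar Q_n=Q_n-\omega(Q_n)\mathbf 1$: (I) there is $\gamma>0$ with $\omega(\bar Q_n^\star \bar Q_n)\le\gamma n^D$ for all $n>0$; (II) $Q_\omega(A):=\lim_{n}\omega(\bar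 Q_n^\star A)$ exists for all $A\in\mathcal O$; (III) there is $0<k<1$ such that $\lim_{n}\max_{x,y\in B(kn)}|\omega(\bar Q_n^\star\iota_x(A))-\omega(\bar Q_n^\star\iota_y(A))|=0$ for all $A\in\mathcal O$. If $Q$ and $Q^\star=(Q_n^\star)$ are both pseudolocal, the functional $\widehat Q_\omega(A)=\frac12\big(Q_\omega(A)+\overline{(Q^\star)_\omega(A^\star)}\big)$ on $\mathcal O$ is called a (two-sided) \emph{pseudolocal charge} with respect to $\omega$. \textbf{Pseudolocal states.} A \emph{pseudolocal flow} is a family $(\omega_s)_{s\in[0,1]}$ of clustering states together with pseudolocal charges $\widehat Q_s$ with respect to $\omega_s$ that are uniformly bounded (for some $K$, $|\widehat Q_s(A)|\le K\|A\|_{\omega_s}$ for all $s\in[0,1]$, $A\in\mathcal O$), such that for every $A\in\mathcal O$ the function $s\mapsto\widehat Q_s(A)$ is Borel measurable and integrable on $[0,1]$ and $$\omega_{s_+}(A)-\omega_{s_-}(A)=\int_{s_-}^{s_+}\widehat Q_s(A)\,ds\qquad(0\le s_-<s_+\le1).$$ A state $\omega$ is \emph{pseudolocal} if for some $p>D$ there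 is a uniformly sizably $p$-clustering pseudolocal flow whose initial state $\omega_0$ is the normalised trace state of $\mathcal A$ and whose final state $\omega_1$ is $\omega$. \textbf{Dynamics.} For $h=h^\star\in\mathcal O$ let $\mathfrak LH(B)=\sum_{x\in\mathbb Z^D}(\iota_x(h)B-B\iota_x(h))$, $B\in\mathcal O$ (a finite sum). The time evolution generated by $H=\sum_x\iota_x(h)$ is the strongly continuous one-parameter group $(\tau_t)_{t\in\mathbb R}$ of $\star$-automorphisms of $\mathcal A$ such that for every $A\in\mathcal O$ there is $r>0$ with $\tau_t(A)=\sum_{n\ge0}\frac{(it)^n}{n!}(\mathfrak LH)^n(A)$ for $|t|<r$. \textbf{Theorem (stability of pseudolocal states).} Let $\omega$ be a pseudolocal state and let $h=h^\star\in\mathcal O$. Then the time evolution $(\tau_t)_{t\in\mathbb R}$ generated by $H=\sum_x\iota_x(h)$ exists and is unique, and $\omega\circ\tau_t$ is a pseudolocal state for every $t\in\mathbb R$. -/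

import Mathlib

open Filter Topology MeasureTheory

noncomputable section

namespace QuantumLattice

/-! ## The lattice -/

/-- Sites of the hypercubic lattice `ℤ^D`. -/
abbrev Site (D : ℕ) : Type := Fin D → ℤ

/-- The graph distance `∑ i, |x i - y i|` on `ℤ^D`. -/
def latticeDist {D : ℕ} (x y : Site D) : ℕ := ∑ i, (x i - y i).natAbs

/-- The ball of radius `n` centred at the origin, as a finite set. -/
def ball (D n : ℕ) : Finset (Site D) :=
  (Fintype.piFinset fun _ : Fin D => Finset.Icc (-(n : ℤ)) n).filter
    fun x => latticeDist x 0 ≤ n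

theorem mem_ball {D n : ℕ} {x : Site D} : x ∈ ball D n ↔ latticeDist x 0 ≤ n := by
  simp only [ball, Finset.mem_filter, Fintype.mem_piFinset, Finset.mem_Icc, and_iff_right_iff_imp]
  intro h i
  have h1 : (x i - (0 : Site D) i).natAbs ≤ latticeDist x 0 :=
    Finset.single_le_sum (f := fun i => (x i - (0 : Site D) i).natAbs)
      (fun _ _ => Nat.zero_le _) (Finset.mem_univ i)
  simp only [Pi.zero_apply, sub_zero] at h1
  omega

/-! ## The algebra of local observables

The infinite tensor product of the matrix algebras `M_d(ℂ)` over `ℤ^D` is realised concretely on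
the (non-separable) Hilbert space with orthonormal basis labelled by *all* configurations
`σ : ℤ^D → {0, …, d-1}`. A matrix indexed by the configurations on a finite set `X` acts on the
coordinates in `X` only; this representation is a direct sum of copies of the defining
representation, so it is faithful and the operator norm is the norm of the matrix. -/

/-- Configurations: a basis label of `ℂ^d` at every site. -/
abbrev Conf (D d : ℕ) : Type := Site D → Fin d

/-- The Hilbert space `ℓ²` over all configurations. -/
abbrev Hil (D d : ℕ) : Type := lp (fun _ : Conf D d => ℂ) 2

/-- Bounded operators on `Hil D d`. -/
abbrev Op (D d : ℕ) : Type := Hil D d →L[ℂ] Hil D d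

/-- The operator `A` is the matrix `M` (on the tensor factors at the sites of `X`) tensored with
the identity at all other sites. -/
def HasKernel {D d : ℕ} (X : Finset (Site D)) (M : Matrix (X → Fin d) (X → Fin d) ℂ)
    (A : Op D d) : Prop :=
  ∀ (ψ : Hil D d) (σ : Conf D d),
    (A ψ : Conf D d → ℂ) σ =
      ∑ η : X → Fin d, M (X.restrict σ) η * (ψ : Conf D d → ℂ) (Function.updateFinset σ X η)

/-- `A` belongs to the local algebra `⨂_{x ∈ X} M_d(ℂ)` of the finite set `X`. -/
def SupportedIn {D d : ℕ} (X : Finset (Site D)) (A : Op D d) : Prop :=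
  ∃ M : Matrix (X → Fin d) (X → Fin d) ℂ, HasKernel X M A

theorem memlp_comp {D d : ℕ} (e : Conf D d ≃ Conf D d) (ψ : Hil D d) :
    Memℓp (fun σ => (ψ : Conf D d → ℂ) (e σ)) 2 := by
  have h := lp.memℓp ψ
  rw [memℓp_gen_iff (by norm_num)] at h ⊢
  exact (Equiv.summable_iff e).2 h

/-- The unitary operator on `ℓ²` of configurations induced by a permutation of configurations,
`ψ ↦ ψ ∘ e`. -/
def permute {D d : ℕ} (e : Conf D d ≃ Conf D d) : Hil D d ≃ₗᵢ[ℂ] Hil D d where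
  toFun ψ := ⟨fun σ => (ψ : Conf D d → ℂ) (e σ), memlp_comp e ψ⟩
  invFun ψ := ⟨fun σ => (ψ : Conf D d → ℂ) (e.symm σ), memlp_comp e.symm ψ⟩
  map_add' _ _ := rfl
  map_smul' _ _ := rfl
  left_inv ψ := by
    apply lp.ext
    funext σ
    exact congrArg (ψ : Conf D d → ℂ) (e.apply_symm_apply σ)
  right_inv ψ := by
    apply lp.ext
    funext σ
    exact congrArg (ψ : Conf D d → ℂ) (e.symm_apply_apply σ)
  norm_map' ψ := by
    rw [lp.norm_eq_tsum_rpow (by norm_num), lp.norm_eq_tsum_rpow (by norm_num)]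
    congr 1
    exact Equiv.tsum_eq e (fun σ => ‖(ψ : Conf D d → ℂ) σ‖ ^ (2 : ENNReal).toReal)

/-- Translation of configurations: `σ ↦ σ (· + x)`. -/
def shiftConf {D : ℕ} (d : ℕ) (x : Site D) : Conf D d ≃ Conf D d where
  toFun σ y := σ (y + x)
  invFun σ y := σ (y - x)
  left_inv σ := by ext y; simp
  right_inv σ := by ext y; simp

/-- The translation `ι_x(A) = U_x A U_x⁻¹`, where `(U_x ψ)(σ) = ψ (σ (· + x))`. It carries an
observable at the origin to the same observable at the site `x`. -/
def translate {D d : ℕ} (x : Site D) (A : Op D d) : Op D d :=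
  ((permute (shiftConf d x)).toContinuousLinearEquiv : Op D d) ∘L A ∘L
    ((permute (shiftConf d x)).symm.toContinuousLinearEquiv : Op D d)

/-- An algebra of local observables: a unital `⋆`-subalgebra of the algebra of all local
observables which is invariant under translations (hence also under the Lie actions
`∑ x, [ι_x(A), ·]` of its elements). -/
structure LocalAlgebra (D d : ℕ) where
  carrier : StarSubalgebra ℂ (Op D d)
  isLocal : ∀ A ∈ carrier, ∃ X : Finset (Site D), SupportedIn X A
  translate_mem : ∀ (x : Site D), ∀ A ∈ carrier, translate x A ∈ carrier

theorem HasKernel.one {D d : ℕ} (X : Finset (Site D)) : HasKernel X 1 (1 : Op D d) := by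
  intro ψ σ
  rw [Finset.sum_eq_single (X.restrict σ)]
  · simp
  · intro η _ hη
    rw [Matrix.one_apply_ne (Ne.symm hη), zero_mul]
  · simp

theorem HasKernel.add {D d : ℕ} {X : Finset (Site D)} {M N : Matrix (X → Fin d) (X → Fin d) ℂ}
    {A B : Op D d} (hA : HasKernel X M A) (hB : HasKernel X N B) : HasKernel X (M + N) (A + B) := by
  intro ψ σ
  have h : ((A + B) ψ : Conf D d → ℂ) σ = (A ψ : Conf D d → ℂ) σ + (B ψ : Conf D d → ℂ) σ := rfl
  rw [h, hA, hB, ← Finset.sum_add_distrib]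
  exact Finset.sum_congr rfl fun η _ => by rw [Matrix.add_apply, add_mul]

theorem HasKernel.smul {D d : ℕ} {X : Finset (Site D)} {M : Matrix (X → Fin d) (X → Fin d) ℂ}
    {A : Op D d} (c : ℂ) (hA : HasKernel X M A) : HasKernel X (c • M) (c • A) := by
  intro ψ σ
  have h : ((c • A) ψ : Conf D d → ℂ) σ = c * (A ψ : Conf D d → ℂ) σ := rfl
  rw [h, hA, Finset.mul_sum]
  exact Finset.sum_congr rfl fun η _ => by rw [Matrix.smul_apply, smul_eq_mul, mul_assoc]

theorem HasKernel.mul {D d : ℕ} {X : Finset (Site D)} {M N : Matrix (X → Fin d) (X → Fin d) ℂ}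
    {A B : Op D d} (hA : HasKernel X M A) (hB : HasKernel X N B) : HasKernel X (M * N) (A * B) := by
  intro ψ σ
  have h : ((A * B) ψ : Conf D d → ℂ) σ = (A (B ψ) : Conf D d → ℂ) σ := rfl
  rw [h, hA]
  simp_rw [hB ψ, Matrix.mul_apply, Finset.sum_mul, Finset.mul_sum]
  rw [Finset.sum_comm]
  refine Finset.sum_congr rfl fun ζ _ => Finset.sum_congr rfl fun η _ => ?_
  rw [Function.restrict_updateFinset, Function.updateFinset_updateFinset_of_subset subset_rfl,
    mul_assoc]

theorem HasKernel.star {D d : ℕ} {X : Finset (Site D)} {M : Matrix (X → Fin d) (X → Fin d) ℂ}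
    {A : Op D d} (hA : HasKernel X M A) : HasKernel X M.conjTranspose (star A) := by
  classical
  intro ψ σ
  have hs : ∀ (φ : Hil D d) (ρ : Conf D d),
      (φ : Conf D d → ℂ) ρ = inner ℂ (lp.single 2 ρ (1 : ℂ) : Hil D d) φ := by
    intro φ ρ
    rw [lp.inner_single_left]
    simp
  have hv : A (lp.single 2 σ (1 : ℂ)) = ∑ ζ : X → Fin d,
      M ζ (X.restrict σ) • (lp.single 2 (Function.updateFinset σ X ζ) (1 : ℂ) : Hil D d) := by
    apply lp.ext
    funext ρ
    rw [hA]
    have hsum : ((∑ ζ : X → Fin d, M ζ (X.restrict σ) •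
        (lp.single 2 (Function.updateFinset σ X ζ) (1 : ℂ) : Hil D d) : Hil D d) :
          Conf D d → ℂ) ρ = ∑ ζ : X → Fin d, M ζ (X.restrict σ) *
        ((lp.single 2 (Function.updateFinset σ X ζ) (1 : ℂ) : Hil D d) : Conf D d → ℂ) ρ := by
      rw [lp.coeFn_sum, Finset.sum_apply]
      rfl
    rw [hsum]
    by_cases h : ∀ x, x ∉ X → ρ x = σ x
    · have h1 : Function.updateFinset ρ X (X.restrict σ) = σ := by
        funext x
        by_cases hx : x ∈ X <;> simp [Function.updateFinset, hx, h]
      have h2 : Function.updateFinset σ X (X.restrict ρ) = ρ := by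
        funext x
        by_cases hx : x ∈ X <;> simp [Function.updateFinset, hx, h]
      rw [Finset.sum_eq_single (X.restrict σ), Finset.sum_eq_single (X.restrict ρ), h1, h2]
      · simp
      · intro ζ _ hζ
        rw [lp.single_apply_ne, mul_zero]
        intro hc
        exact hζ (by rw [hc, Function.restrict_updateFinset])
      · simp
      · intro ζ _ hζ
        rw [lp.single_apply_ne, mul_zero]
        intro hc
        exact hζ (by rw [← hc, Function.restrict_updateFinset])
      · simp
    · push Not at h
      obtain ⟨x, hx, hne⟩ := h
      rw [Finset.sum_eq_zero, Finset.sum_eq_zero]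
      · intro ζ _
        rw [lp.single_apply_ne, mul_zero]
        intro hc
        exact hne (by rw [hc]; simp [Function.updateFinset, hx])
      · intro ζ _
        rw [lp.single_apply_ne, mul_zero]
        intro hc
        exact hne (by rw [← hc]; simp [Function.updateFinset, hx])
  rw [hs, ContinuousLinearMap.star_eq_adjoint, ContinuousLinearMap.adjoint_inner_right, hv,
    sum_inner]
  refine Finset.sum_congr rfl fun ζ _ => ?_
  rw [inner_smul_left, ← hs, Matrix.conjTranspose_apply]
  rfl

theorem SupportedIn.mono {D d : ℕ} {X Y : Finset (Site D)} (hXY : X ⊆ Y) {A : Op D d}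
    (hA : SupportedIn X A) : SupportedIn Y A := by
  classical
  obtain ⟨M, hM⟩ := hA
  refine ⟨Matrix.of fun α β => if ∀ x : Y, (x : Site D) ∉ X → α x = β x then
    M (fun x => α ⟨x, hXY x.2⟩) (fun x => β ⟨x, hXY x.2⟩) else 0, ?_⟩
  intro ψ σ
  rw [hM]
  simp only [Matrix.of_apply]
  refine Finset.sum_of_injOn (fun η => Y.restrict (Function.updateFinset σ X η)) ?_ ?_ ?_ ?_
  · intro η _ η' _ h
    funext x
    have := congrFun h ⟨x, hXY x.2⟩
    simpa [Function.updateFinset] using this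
  · intro η _
    simp
  · intro β _ hβ
    rw [if_neg, zero_mul]
    intro h
    refine hβ ⟨fun x => β ⟨x, hXY x.2⟩, by simp, ?_⟩
    funext x
    by_cases hx : (x : Site D) ∈ X
    · simp [Function.updateFinset, hx]
    · simpa [Function.updateFinset, hx] using h x hx
  · intro η _
    have h1 : ∀ x : Y, (x : Site D) ∉ X →
        Y.restrict σ x = Y.restrict (Function.updateFinset σ X η) x := by
      intro x hx
      simp [Function.updateFinset, hx]
    have h2 : Function.updateFinset σ Y (Y.restrict (Function.updateFinset σ X η)) =
        Function.updateFinset σ X η := by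
      funext x
      by_cases hx : x ∈ Y
      · simp [Function.updateFinset, hx]
      · have hx' : x ∉ X := fun h => hx (hXY h)
        simp [Function.updateFinset, hx, hx']
    have h3 : (fun x : X => Y.restrict (Function.updateFinset σ X η) ⟨x, hXY x.2⟩) = η := by
      funext x
      simp [Function.updateFinset]
    beta_reduce
    rw [if_pos h1, h2, h3]
    rfl

theorem SupportedIn.translate {D d : ℕ} {X : Finset (Site D)} {A : Op D d} (x : Site D)
    (hA : SupportedIn X A) :
    SupportedIn (X.map (addRightEmbedding x)) (translate x A) := by
  classical
  obtain ⟨M, hM⟩ := hA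
  let j : X ≃ X.map (addRightEmbedding x) :=
    { toFun := fun y => ⟨y + x, Finset.mem_map_of_mem (addRightEmbedding x) y.2⟩
      invFun := fun z => ⟨z - x, by
        obtain ⟨y, hy, hyz⟩ := Finset.mem_map.1 z.2
        have : (z : Site D) - x = y := by
          rw [← hyz]
          simp
        rwa [this]⟩
      left_inv := fun y => by simp
      right_inv := fun z => by simp }
  refine ⟨fun α β => M (α ∘ j) (β ∘ j), ?_⟩
  intro ψ σ
  have h : (QuantumLattice.translate x A ψ : Conf D d → ℂ) σ =
      (A ((permute (shiftConf d x)).symm ψ) : Conf D d → ℂ) (shiftConf d x σ) := rfl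
  rw [h, hM]
  refine Fintype.sum_equiv (Equiv.arrowCongr j (Equiv.refl (Fin d))) _ _ fun η => ?_
  congr 1
  · congr 1
    funext y
    simp
  · have h2 : ∀ ρ, ((permute (shiftConf d x)).symm ψ : Conf D d → ℂ) ρ =
        (ψ : Conf D d → ℂ) ((shiftConf d x).symm ρ) := fun _ => rfl
    rw [h2]
    refine congrArg (ψ : Conf D d → ℂ) ?_
    funext z
    have hz : z - x ∈ X ↔ z ∈ X.map (addRightEmbedding x) := by
      rw [Finset.mem_map]
      constructor
      · intro hz
        exact ⟨z - x, hz, by simp⟩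
      · rintro ⟨y, hy, rfl⟩
        simpa using hy
    by_cases hx : z - x ∈ X
    · have hx' := hz.1 hx
      simp only [shiftConf, Equiv.coe_fn_mk, Equiv.coe_fn_symm_mk, Function.updateFinset, hx, hx',
        dif_pos]
      rfl
    · have hx' := fun h => hx (hz.2 h)
      simp only [shiftConf, Equiv.coe_fn_mk, Equiv.coe_fn_symm_mk, Function.updateFinset,
        dif_neg hx, dif_neg hx', sub_add_cancel]

/-- The algebra of all local observables, `⋃ X, ⨂_{x ∈ X} M_d(ℂ)`. -/
def LocalAlgebra.full (D d : ℕ) : LocalAlgebra D d where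
  carrier :=
    { carrier := {A | ∃ X : Finset (Site D), SupportedIn X A}
      mul_mem' := by
        classical
        rintro A B ⟨X, hA⟩ ⟨Y, hB⟩
        obtain ⟨M, hM⟩ := hA.mono (Finset.subset_union_left (s₂ := Y))
        obtain ⟨N, hN⟩ := hB.mono (Finset.subset_union_right (s₁ := X))
        exact ⟨_, _, hM.mul hN⟩
      add_mem' := by
        classical
        rintro A B ⟨X, hA⟩ ⟨Y, hB⟩
        obtain ⟨M, hM⟩ := hA.mono (Finset.subset_union_left (s₂ := Y))
        obtain ⟨N, hN⟩ := hB.mono (Finset.subset_union_right (s₁ := X))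
        exact ⟨_, _, hM.add hN⟩
      algebraMap_mem' := fun c => by
        rw [Algebra.algebraMap_eq_smul_one]
        exact ⟨∅, _, (HasKernel.one ∅).smul c⟩
      star_mem' := by
        rintro A ⟨X, M, hM⟩
        exact ⟨X, _, hM.star⟩ }
  isLocal _ hA := hA
  translate_mem := by
    rintro x A ⟨X, hA⟩
    exact ⟨_, hA.translate x⟩

/-- Restriction of a square-summable function to a set of configurations. -/
def cutoff {D d : ℕ} (S : Set (Conf D d)) : Op D d :=
  LinearMap.mkContinuous
    { toFun := fun ψ => ⟨S.indicator (ψ : Conf D d → ℂ), (lp.memℓp ψ).mono' fun σ =>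
        norm_indicator_le_norm_self _ σ⟩
      map_add' := fun ψ φ => by
        apply lp.ext
        exact Set.indicator_add S _ _
      map_smul' := fun c ψ => by
        apply lp.ext
        exact Set.indicator_const_smul S c _ } 1 fun ψ => by
    rw [one_mul]
    refine lp.norm_mono (by norm_num) fun σ => ?_
    exact norm_indicator_le_norm_self _ σ

/-- The permutation of configurations that exchanges `η` and `ζ` on the set `X`. -/
def swapConf {D d : ℕ} (X : Finset (Site D)) (η ζ : X → Fin d) : Conf D d ≃ Conf D d :=
  Function.Involutive.toPerm
    (fun σ => Function.updateFinset σ X (Equiv.swap η ζ (X.restrict σ))) fun σ => by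
      simp only
      rw [Function.restrict_updateFinset, Equiv.swap_apply_self,
        Function.updateFinset_updateFinset_of_subset subset_rfl, Function.updateFinset_restrict]

/-- Every matrix on a finite set of sites is realised by an operator, so that the local algebra of
`X` is the full matrix algebra on `(ℂ^d)^{⊗ X}`. -/
theorem exists_hasKernel {D d : ℕ} (X : Finset (Site D))
    (M : Matrix (X → Fin d) (X → Fin d) ℂ) : ∃ A : Op D d, HasKernel X M A := by
  classical
  refine ⟨∑ η, ∑ ζ, M η ζ • (cutoff {σ | X.restrict σ = η} ∘L
    ((permute (swapConf X η ζ)).toContinuousLinearEquiv : Op D d)), ?_⟩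
  intro ψ σ
  have h : ∀ η ζ, ((cutoff {σ | X.restrict σ = η} ∘L
      ((permute (swapConf X η ζ)).toContinuousLinearEquiv : Op D d)) ψ : Conf D d → ℂ) σ =
      if X.restrict σ = η then (ψ : Conf D d → ℂ) (Function.updateFinset σ X ζ) else 0 := by
    intro η ζ
    have h1 : ((cutoff {σ | X.restrict σ = η} ∘L
      ((permute (swapConf X η ζ)).toContinuousLinearEquiv : Op D d)) ψ : Conf D d → ℂ) σ =
      Set.indicator {σ | X.restrict σ = η}
        (fun σ => (ψ : Conf D d → ℂ) (swapConf X η ζ σ)) σ := rfl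
    rw [h1, Set.indicator_apply]
    by_cases hσ : X.restrict σ = η
    · rw [if_pos (by exact hσ), if_pos hσ]
      refine congrArg (ψ : Conf D d → ℂ) ?_
      change Function.updateFinset σ X (Equiv.swap η ζ (X.restrict σ)) = _
      rw [hσ, Equiv.swap_apply_left]
    · rw [if_neg (by exact hσ), if_neg hσ]
  simp only [sum_apply, smul_apply, lp.coeFn_sum,
    Finset.sum_apply, lp.coeFn_smul, Pi.smul_apply, smul_eq_mul]
  simp_rw [h]
  rw [Finset.sum_eq_single (X.restrict σ)]
  · simp
  · intro η _ hη
    simp [Ne.symm hη]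
  · simp

namespace LocalAlgebra

variable {D d : ℕ} (O : LocalAlgebra D d)

/-- The space `𝒪` of local observables. -/
abbrev Obs : Type := O.carrier

/-- The unital `C⋆`-algebra `𝒜` of quasi-local observables: the norm closure of `𝒪`. -/
abbrev Quasi : Type := O.carrier.topologicalClosure

end LocalAlgebra

variable {D d : ℕ} {O : LocalAlgebra D d}

/-- The inclusion `𝒪 → 𝒜`. -/
def incl (A : O.Obs) : O.Quasi := ⟨A, O.carrier.le_topologicalClosure A.2⟩

/-- The translations `ι_x` on local observables. -/
def shift (x : Site D) (A : O.Obs) : O.Obs := ⟨translate x A, O.translate_mem x A A.2⟩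

/-- The support of a local observable: the smallest `X` such that it belongs to the local algebra
of `X`. -/
def supp (A : O.Obs) : Set (Site D) := {x | ∀ X : Finset (Site D), SupportedIn X (A : Op D d) → x ∈ X}

/-- The size of a local observable: the number of sites in its support. -/
def size (A : O.Obs) : ℕ := (supp A).ncard

/-- The distance between the supports of two local observables; it is `⊤` if one of them is a
multiple of the identity. -/
def obsDist (A B : O.Obs) : ℕ∞ := ⨅ x ∈ supp A, ⨅ y ∈ supp B, (latticeDist x y : ℕ∞)

/-! ## States -/

open scoped ComplexOrder in
/-- A state on the `C⋆`-algebra `𝒜`: a normalised positive linear functional. -/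
structure State (O : LocalAlgebra D d) where
  toLinearMap : O.Quasi →ₗ[ℂ] ℂ
  nonneg : ∀ A : O.Quasi, 0 ≤ toLinearMap (star A * A)
  map_one : toLinearMap 1 = 1

/-- The value of a state on a local observable. -/
def State.ev (ω : State O) (A : O.Obs) : ℂ := ω.toLinearMap (incl A)

/-- The state `ω ∘ τ`, for a `⋆`-endomorphism `τ` of `𝒜`. -/
def State.comp (ω : State O) (τ : O.Quasi →⋆ₐ[ℂ] O.Quasi) : State O where
  toLinearMap := ω.toLinearMap ∘ₗ τ.toAlgHom.toLinearMap
  nonneg A := by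
    have h := ω.nonneg (τ A)
    rw [← map_star, ← map_mul] at h
    exact h
  map_one := by
    have h := ω.map_one
    rw [← _root_.map_one τ] at h
    exact h

/-- `ω` is the normalised trace state: on the local algebra of every finite set `X` it is the
normalised matrix trace. As states are continuous, this determines `ω` on `𝒜`. -/
def IsTraceState (ω : State O) : Prop :=
  ∀ (X : Finset (Site D)) (M : Matrix (X → Fin d) (X → Fin d) ℂ) (A : O.Obs),
    HasKernel X M (A : Op D d) → ω.ev A = M.trace / (d : ℂ) ^ X.card

/-- Translation invariance of a state (on the dense subspace of local observables, hence on
all of `𝒜`). -/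
def IsTranslationInvariant (ω : State O) : Prop :=
  ∀ (x : Site D) (A : O.Obs), ω.ev (shift x A) = ω.ev A

/-! ## Clustering -/

/-- The clustering inequality with size dependence `ν` and decay function `f`. Nothing is required
when the distance is infinite, since then both sides vanish. -/
def ClusteringBound (ω : State O) (ν f : ℕ → ℝ) : Prop :=
  ∀ (l : ℕ) (A B : O.Obs), size A < l → size B < l → ∀ n : ℕ, obsDist A B = n →
    ‖ω.ev (A * B) - ω.ev A * ω.ev B‖ ≤ ν l * ‖A‖ * ‖B‖ * f n

/-- `f` is a positive function with `f n ≤ n ^ (-p)` for all `n > 0`. -/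
def AlgebraicDecay (p : ℝ) (f : ℕ → ℝ) : Prop :=
  (∀ n, 0 < f n) ∧ ∀ n : ℕ, 0 < n → f n ≤ (n : ℝ) ^ (-p)

/-- Clustering states: algebraically `p`-clustering for some `p > D`. -/
def IsClustering (ω : State O) : Prop :=
  IsTranslationInvariant ω ∧ ∃ p : ℝ, (D : ℝ) < p ∧ ∃ ν f : ℕ → ℝ,
    (∀ l, 0 < ν l) ∧ AlgebraicDecay p f ∧ ClusteringBound ω ν f

/-- Sizably `p`-clustering states, with constants `ν` and `a`: the size dependence of the
clustering inequality is `ν * l ^ a`. -/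
def IsSizablyClusteringWith (p ν a : ℝ) (ω : State O) : Prop :=
  IsTranslationInvariant ω ∧ ∃ f : ℕ → ℝ,
    AlgebraicDecay p f ∧ ClusteringBound ω (fun l => ν * (l : ℝ) ^ a) f

/-- A family of states over `s ∈ [0,1]` is uniformly sizably `p`-clustering: the same constants
`ν`, `a` and the same power `p` work for all members. -/
def UniformlySizablyClustering (p : ℝ) (ω : ℝ → State O) : Prop :=
  ∃ ν a : ℝ, 0 < ν ∧ 0 < a ∧ ∀ s ∈ Set.Icc (0 : ℝ) 1, IsSizablyClusteringWith p ν a (ω s)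

/-! ## Susceptibilities -/

/-- The form `⟨A, B⟩_ω = ∑ x, (ω(ι_x(A)⋆ B) - ω(A⋆) ω(B))`, an absolutely convergent series for
clustering `ω`. -/
def susc (ω : State O) (A B : O.Obs) : ℂ :=
  ∑' x : Site D, (ω.ev (star (shift x A) * B) - ω.ev (star A) * ω.ev B)

/-- The symmetrised form `⟨⟨A, B⟩⟩_ω = (⟨A, B⟩_ω + ⟨B⋆, A⋆⟩_ω) / 2`. -/
def symSusc (ω : State O) (A B : O.Obs) : ℂ := (susc ω A B + susc ω (star B) (star A)) / 2

/-- The (semi)norm of the positive semidefinite form `⟨⟨·,·⟩⟩_ω`. -/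
def symNorm (ω : State O) (A : O.Obs) : ℝ := √(symSusc ω A A).re

/-! ## Pseudolocal sequences and charges -/

/-- The zero-average observable `A - ω(A) 1`. -/
def center (ω : State O) (A : O.Obs) : O.Obs := A - ω.ev A • (1 : O.Obs)

/-- The functional `L` is the limit action of `Q`: `L(A) = lim_n ω((Q_n - ω(Q_n) 1)⋆ A)`. -/
def HasLimitAction (ω : State O) (Q : ℕ → O.Obs) (L : O.Obs → ℂ) : Prop :=
  ∀ A : O.Obs, Tendsto (fun n => ω.ev (star (center ω (Q n)) * A)) atTop (𝓝 (L A))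

/-- Pseudolocal sequences with respect to `ω`. -/
structure IsPseudolocalSeq (ω : State O) (Q : ℕ → O.Obs) : Prop where
  supported : ∀ n, SupportedIn (ball D n) (Q n : Op D d)
  volume_growth : ∃ γ : ℝ, 0 < γ ∧ ∀ n : ℕ, 0 < n →
    (ω.ev (star (center ω (Q n)) * center ω (Q n))).re ≤ γ * (n : ℝ) ^ D
  limit_action : ∃ L : O.Obs → ℂ, HasLimitAction ω Q L
  homogeneity : ∃ k : ℝ, 0 < k ∧ k < 1 ∧ ∀ A : O.Obs, ∀ ε : ℝ, 0 < ε → ∀ᶠ n : ℕ in atTop,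
    ∀ x y : Site D, (latticeDist x 0 : ℝ) ≤ k * n → (latticeDist y 0 : ℝ) ≤ k * n →
      ‖ω.ev (star (center ω (Q n)) * shift x A) - ω.ev (star (center ω (Q n)) * shift y A)‖ ≤ ε

/-- Two-sided pseudolocal charges with respect to `ω`: functionals of the form
`A ↦ (Q_ω(A) + (Q⋆)_ω^⋆(A)) / 2`, where both `Q` and `Q⋆` are pseudolocal sequences, `Q_ω` is the
limit action (left charge) of `Q`, and `(Q⋆)_ω^⋆(A)` is the complex conjugate of `(Q⋆)_ω(A⋆)`. -/
def IsPseudolocalCharge (ω : State O) (q : O.Obs → ℂ) : Prop :=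
  ∃ Q : ℕ → O.Obs, IsPseudolocalSeq ω Q ∧ IsPseudolocalSeq ω (fun n => star (Q n)) ∧
    ∃ L L' : O.Obs → ℂ, HasLimitAction ω Q L ∧ HasLimitAction ω (fun n => star (Q n)) L' ∧
      ∀ A : O.Obs, q A = (L A + starRingEnd ℂ (L' (star A))) / 2

/-! ## Pseudolocal flows and pseudolocal states -/

/-- The family `ω_s`, `s ∈ [0,1]`, is a (two-sided) pseudolocal flow along the charges `q_s`.
Uniform boundedness of the charges refers to their norm as functionals on the Hilbert space
completion of `𝒪` for `⟨⟨·,·⟩⟩_{ω_s}`. Values of the families outside `[0,1]` are irrelevant. -/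
structure IsPseudolocalFlow (ω : ℝ → State O) (q : ℝ → O.Obs → ℂ) : Prop where
  clustering : ∀ s ∈ Set.Icc (0 : ℝ) 1, IsClustering (ω s)
  charge : ∀ s ∈ Set.Icc (0 : ℝ) 1, IsPseudolocalCharge (ω s) (q s)
  bounded : ∃ K : ℝ, ∀ s ∈ Set.Icc (0 : ℝ) 1, ∀ A : O.Obs, ‖q s A‖ ≤ K * symNorm (ω s) A
  measurable : ∀ A : O.Obs, Measurable fun s : Set.Icc (0 : ℝ) 1 => q s A
  integrable : ∀ A : O.Obs, IntegrableOn (fun s => q s A) (Set.Icc (0 : ℝ) 1)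
  flow : ∀ (A : O.Obs) (s₁ s₂ : ℝ), 0 ≤ s₁ → s₁ < s₂ → s₂ ≤ 1 →
    (ω s₂).ev A - (ω s₁).ev A = ∫ s in s₁..s₂, q s A

/-- Pseudolocal states: endpoints of uniformly sizably `p`-clustering pseudolocal flows, for some
`p > D`, that start at the trace state. -/
def IsPseudolocalState (ω : State O) : Prop :=
  ∃ p : ℝ, (D : ℝ) < p ∧ ∃ (Ω : ℝ → State O) (q : ℝ → O.Obs → ℂ),
    IsPseudolocalFlow Ω q ∧ UniformlySizablyClustering p Ω ∧ IsTraceState (Ω 0) ∧ Ω 1 = ω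

/-! ## Time evolution -/

/-- The Lie action `ℒH(B) = ∑ x, (ι_x(h) B - B ι_x(h))` of the local Hamiltonian
`H = ∑ x, ι_x(h)` on local observables; only finitely many terms are nonzero. -/
def lieAction (h B : O.Obs) : O.Obs := ∑ᶠ x : Site D, (shift x h * B - B * shift x h)

/-- The time evolution generated by `H = ∑ x, ι_x(h)`: the strongly continuous one-parameter group
of `⋆`-automorphisms of `𝒜` which on every local observable `A` is given, for small `|t|`, by the
convergent power series `∑ n, (i t)^n / n! • (ℒH)^n(A)`. -/
structure IsTimeEvolution (h : O.Obs) (τ : ℝ → (O.Quasi →⋆ₐ[ℂ] O.Quasi)) : Prop where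
  zero : τ 0 = StarAlgHom.id ℂ O.Quasi
  add : ∀ s t : ℝ, τ (s + t) = (τ s).comp (τ t)
  strongly_continuous : ∀ A : O.Quasi, Continuous fun t => τ t A
  series : ∀ A : O.Obs, ∃ r : ℝ, 0 < r ∧ ∀ t : ℝ, |t| < r →
    HasSum (fun n : ℕ => ((Complex.I * t) ^ n / (n.factorial : ℂ)) • incl ((lieAction h)^[n] A))
      (τ t (incl A))

end QuantumLattice

end

open QuantumLattice

/-!
No Lieb–Robinson bound is needed: everything rests on the convergence of the series
`evo h t A = ∑ (it)ⁿ/n! (ℒH)ⁿ(A)`. If `A` is supported on `l` sites, then `(ℒH)ⁿ(A)` is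
a sum of nested commutators whose number grows like `n!` times an exponential
(`norm_iterate_lie_le`), so the series converges geometrically for `|t| ≤ evoRadius h`, a radius that
does not depend on `A`; the price is a prefactor `2 ^ l`.

*Existence and uniqueness.* As `ℒH` is a `⋆`-derivation, `evo h t` is a `⋆`-homomorphism on local
observables. The prefactor in `‖evo h t A‖ ≤ 2 ^ l * 2 * ‖A‖` is the same for all powers of
`A`, and taking roots shows that `evo h t` is contractive (`SmallTime.norm_evo_le_norm`), hence
extends to the quasi-local algebra. The group law at small times yields a one-parameter group
(`exists_hom_of_local`, `exists_isTimeEvolution`). Every time evolution satisfies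
`d/dt τ_t(A) = i τ_t(ℒH(A))`, so the difference of two of them is bounded by Taylor remainders of
every order, which tend to zero at small times (`IsTimeEvolution.unique`).

*Stability.* Since `τ_t = (τ_{t/n})ⁿ`, small times suffice (`IsPseudolocalState.comp_of_small`). A
flow `ω_s` from the trace state to `ω` evolves into the flow `ω_s ∘ τ_t`. It starts at the trace
state, which vanishes on commutators.

The evolved states are uniformly sizably clustering for every `p'` with `D < p' < p`
(`exists_isSizablyClusteringWith_comp`): if the series for `A` and `B`, of size below `l` and at
distance `n`, are truncated at an order `l + O(log n)`, then the relative error is of order `n ^ (-p')`, while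
the supports of the truncated series have grown by a distance of order `l + log n` only. The growth of
the supports costs a power of `l` and an arbitrarily small power of `n`.

The evolved charges are `lim_N q_s(∑_{n < N} (it)ⁿ/n! (ℒH)ⁿ(A))`. The susceptibilities of the
truncated series converge to those of the evolved state (`IsEvolution.tendsto_susc`), because the
sizes of the supports of `(ℒH)ⁿ(A)` are polynomial in `n` while the norms of the terms are
geometrically small. Hence the limit functionals satisfy the same bound
`‖q A‖ ≤ K * symNorm ω A` with respect to the evolved states, and dominated convergence gives the flow
equation (`IsPseudolocalFlow.comp`). Finally, every functional with such a bound is a pseudolocal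
charge (`IsClustering.isPseudolocalCharge`): by the Riesz representation theorem it is a limit of
`⟨⟨B_j, A⟩⟩`, and the sums of the translates of `B_j` over growing cubes, with `j` increasing slowly
along the cubes, form a pseudolocal sequence.
-/

noncomputable section

namespace QuantumLattice

variable {D d : ℕ} {O : LocalAlgebra D d}

/-! ### Supports of local observables -/

/-- The matrix element `⟨σ| A |ρ⟩` of an operator in the basis of configurations. -/
def matElem (A : Op D d) (σ ρ : Conf D d) : ℂ :=
  by classical exact (A (lp.single 2 ρ (1 : ℂ)) : Conf D d → ℂ) σ

theorem HasKernel.matElem_eq {X : Finset (Site D)} {M : Matrix (X → Fin d) (X → Fin d) ℂ}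
    {A : Op D d} (hA : HasKernel X M A) {σ ρ : Conf D d} (h : ∀ x ∉ X, σ x = ρ x) :
    matElem A σ ρ = M (X.restrict σ) (X.restrict ρ) := by
  classical
  have hupd : Function.updateFinset σ X (X.restrict ρ) = ρ := by
    funext x
    by_cases hx : x ∈ X <;> simp [Function.updateFinset, hx, h]
  rw [matElem, hA, Finset.sum_eq_single (X.restrict ρ)]
  · rw [hupd]
    simp
  · intro η _ hη
    rw [lp.single_apply_ne, mul_zero]
    intro hc
    exact hη (by rw [← hc, Function.restrict_updateFinset])
  · simp

theorem HasKernel.matElem_eq_zero {X : Finset (Site D)} {M : Matrix (X → Fin d) (X → Fin d) ℂ}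
    {A : Op D d} (hA : HasKernel X M A) {σ ρ : Conf D d} {x : Site D} (hx : x ∉ X)
    (hne : σ x ≠ ρ x) : matElem A σ ρ = 0 := by
  classical
  rw [matElem, hA, Finset.sum_eq_zero]
  intro η _
  rw [lp.single_apply_ne, mul_zero]
  intro hc
  exact hne (by rw [← hc]; simp [Function.updateFinset, hx])

theorem HasKernel.apply_eq {X : Finset (Site D)} {M : Matrix (X → Fin d) (X → Fin d) ℂ}
    {A : Op D d} (hA : HasKernel X M A) (ψ : Hil D d) (σ : Conf D d) :
    (A ψ : Conf D d → ℂ) σ = ∑ η : X → Fin d, matElem A σ (Function.updateFinset σ X η) *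
      (ψ : Conf D d → ℂ) (Function.updateFinset σ X η) := by
  rw [hA]
  refine Finset.sum_congr rfl fun η _ => ?_
  rw [hA.matElem_eq, Function.restrict_updateFinset]
  intro x hx
  simp [Function.updateFinset, hx]

/-- The matrix elements depend on the spectator sites only through their being equal. -/
theorem HasKernel.matElem_congr {X : Finset (Site D)} {M : Matrix (X → Fin d) (X → Fin d) ℂ}
    {A : Op D d} (hA : HasKernel X M A) {σ ρ σ' ρ' : Conf D d} (h : ∀ x ∉ X, σ x = ρ x)
    (h' : ∀ x ∉ X, σ' x = ρ' x) (hσ : ∀ x ∈ X, σ x = σ' x) (hρ : ∀ x ∈ X, ρ x = ρ' x) :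
    matElem A σ ρ = matElem A σ' ρ' := by
  rw [hA.matElem_eq h, hA.matElem_eq h']
  congr 1
  · funext x
    exact hσ x x.2
  · funext x
    exact hρ x x.2

/-- An observable supported in two finite sets is supported in their intersection. -/
theorem SupportedIn.inter [NeZero d] {X Y : Finset (Site D)} {A : Op D d}
    (hX : SupportedIn X A) (hY : SupportedIn Y A) : SupportedIn (X ∩ Y) A := by
  obtain ⟨M, hM⟩ := hX
  obtain ⟨N, hN⟩ := hY
  let σ₀ : Conf D d := fun _ => 0
  refine ⟨Matrix.of fun α β => matElem A (Function.updateFinset σ₀ (X ∩ Y) α)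
    (Function.updateFinset σ₀ (X ∩ Y) β), ?_⟩
  intro ψ σ
  rw [hM.apply_eq]
  symm
  refine Finset.sum_of_injOn
    (fun ξ => X.restrict (Function.updateFinset σ (X ∩ Y) ξ)) ?_ ?_ ?_ ?_
  · intro ξ _ ξ' _ h
    funext x
    have := congrFun h ⟨x, (Finset.mem_inter.1 x.2).1⟩
    have hx := Finset.mem_inter.1 x.2
    simpa [Function.updateFinset, hx.1, hx.2] using this
  · intro _ _
    simp
  · intro η _ hη
    have : ∃ x ∉ Y, σ x ≠ Function.updateFinset σ X η x := by
      by_contra! hc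
      refine hη ⟨(X ∩ Y).restrict (Function.updateFinset σ X η), by simp, ?_⟩
      funext x
      by_cases hx : (x : Site D) ∈ Y
      · simp [Function.updateFinset, hx]
      · simpa [Function.updateFinset, hx] using hc x hx
    obtain ⟨x, hx, hne⟩ := this
    rw [hN.matElem_eq_zero hx hne, zero_mul]
  · intro ξ _
    have hupd : Function.updateFinset σ X (X.restrict (Function.updateFinset σ (X ∩ Y) ξ)) =
        Function.updateFinset σ (X ∩ Y) ξ := by
      funext x
      by_cases hx : x ∈ X <;> simp [Function.updateFinset, hx]
    beta_reduce
    rw [hupd]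
    congr 1
    rw [Matrix.of_apply]
    -- first change the spectator sites outside `X`, then those outside `Y`
    let τ : Conf D d := fun x => if x ∈ X then σ x else σ₀ x
    trans matElem A τ (Function.updateFinset τ (X ∩ Y) ξ)
    · refine hN.matElem_congr ?_ ?_ ?_ ?_
      · intro x hx
        simp [Function.updateFinset, hx]
      · intro x hx
        simp [Function.updateFinset, hx]
      · intro x hx
        by_cases hx' : x ∈ X <;> simp [Function.updateFinset, hx, hx', τ]
      · intro x hx
        by_cases hx' : x ∈ X <;> simp [Function.updateFinset, hx, hx', τ]
    · refine hM.matElem_congr ?_ ?_ ?_ ?_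
      · intro x hx
        simp [Function.updateFinset, hx]
      · intro x hx
        simp [Function.updateFinset, hx]
      · intro x hx
        simp [hx, τ]
      · intro x hx
        by_cases hx' : x ∈ Y <;> simp [Function.updateFinset, hx, hx', τ]

theorem supp_subset {X : Finset (Site D)} {A : O.Obs} (hA : SupportedIn X (A : Op D d)) :
    supp A ⊆ X := fun _ hx => hx X hA

theorem supp_finite (A : O.Obs) : (supp A).Finite := by
  obtain ⟨X, hX⟩ := O.isLocal A A.2
  exact X.finite_toSet.subset (supp_subset hX)

/-- The support of a local observable as a finite set. -/
def suppF (A : O.Obs) : Finset (Site D) := (supp_finite A).toFinset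

@[simp]
theorem mem_suppF {A : O.Obs} {x : Site D} : x ∈ suppF A ↔ x ∈ supp A := by simp [suppF]

theorem suppF_subset {X : Finset (Site D)} {A : O.Obs} (hA : SupportedIn X (A : Op D d)) :
    suppF A ⊆ X := fun _ hx => supp_subset hA (mem_suppF.1 hx)

theorem size_eq (A : O.Obs) : size A = (suppF A).card := by
  rw [size, suppF, Set.ncard_eq_toFinset_card _ (supp_finite A)]

theorem supportedIn_suppF [NeZero d] (A : O.Obs) : SupportedIn (suppF A) (A : Op D d) := by
  classical
  obtain ⟨X, hX⟩ := O.isLocal A A.2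
  -- a supporting set of minimal cardinality is the support
  have hex : ∃ n, ∃ X : Finset (Site D), SupportedIn X (A : Op D d) ∧ X.card = n :=
    ⟨_, X, hX, rfl⟩
  obtain ⟨Y, hY, hcard⟩ := Nat.find_spec hex
  have hmin : ∀ Z : Finset (Site D), SupportedIn Z (A : Op D d) → Y ⊆ Z := by
    intro Z hZ
    have h1 := Nat.find_min' hex ⟨_, hY.inter hZ, rfl⟩
    have h2 : Y ∩ Z = Y :=
      Finset.eq_of_subset_of_card_le Finset.inter_subset_left (by rw [hcard]; exact h1)
    exact Finset.inter_eq_left.1 h2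
  have : suppF A = Y := by
    refine (suppF_subset hY).antisymm fun x hx => ?_
    rw [mem_suppF]
    exact fun Z hZ => hmin Z hZ hx
  rwa [this]

theorem SupportedIn.one (X : Finset (Site D)) : SupportedIn X (1 : Op D d) := ⟨_, HasKernel.one X⟩

theorem SupportedIn.smul {X : Finset (Site D)} {A : Op D d} (c : ℂ) (hA : SupportedIn X A) :
    SupportedIn X (c • A) := by
  obtain ⟨M, hM⟩ := hA
  exact ⟨_, hM.smul c⟩

theorem SupportedIn.add {X : Finset (Site D)} {A B : Op D d} (hA : SupportedIn X A)
    (hB : SupportedIn X B) : SupportedIn X (A + B) := by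
  obtain ⟨M, hM⟩ := hA
  obtain ⟨N, hN⟩ := hB
  exact ⟨_, hM.add hN⟩

theorem SupportedIn.zero (X : Finset (Site D)) : SupportedIn X (0 : Op D d) := by
  simpa using (SupportedIn.one X).smul 0

theorem SupportedIn.sub {X : Finset (Site D)} {A B : Op D d} (hA : SupportedIn X A)
    (hB : SupportedIn X B) : SupportedIn X (A - B) := by
  have := hA.add (hB.smul (-1))
  rwa [neg_one_smul, ← sub_eq_add_neg] at this

theorem SupportedIn.mul {X : Finset (Site D)} {A B : Op D d} (hA : SupportedIn X A)
    (hB : SupportedIn X B) : SupportedIn X (A * B) := by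
  obtain ⟨M, hM⟩ := hA
  obtain ⟨N, hN⟩ := hB
  exact ⟨_, hM.mul hN⟩

theorem SupportedIn.star {X : Finset (Site D)} {A : Op D d} (hA : SupportedIn X A) :
    SupportedIn X (star A) := by
  obtain ⟨M, hM⟩ := hA
  exact ⟨_, hM.star⟩

theorem SupportedIn.sum {ι : Type*} {X : Finset (Site D)} {s : Finset ι} {A : ι → O.Obs}
    (hA : ∀ i ∈ s, SupportedIn X (A i : Op D d)) :
    SupportedIn X ((∑ i ∈ s, A i : O.Obs) : Op D d) := by
  classical
  induction s using Finset.induction_on with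
  | empty => exact SupportedIn.zero X
  | insert i s hi ih =>
    rw [Finset.sum_insert hi]
    exact (hA i (Finset.mem_insert_self i s)).add
      (ih fun j hj => hA j (Finset.mem_insert_of_mem hj))

/-- An observable without support is a multiple of the identity. -/
theorem SupportedIn.eq_smul_one {A : Op D d} (hA : SupportedIn ∅ A) : ∃ c : ℂ, A = c • 1 := by
  obtain ⟨M, hM⟩ := hA
  refine ⟨M default default, ?_⟩
  ext ψ σ
  rw [hM]
  simp [Function.updateFinset_empty, Subsingleton.elim (Finset.restrict ∅ σ) default]

theorem SupportedIn.commute {X Y : Finset (Site D)} (hXY : Disjoint X Y) {A B : Op D d}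
    (hA : SupportedIn X A) (hB : SupportedIn Y B) : A * B = B * A := by
  classical
  obtain ⟨M, hM⟩ := hA
  obtain ⟨N, hN⟩ := hB
  ext ψ σ
  have h1 : ((A * B) ψ : Conf D d → ℂ) σ = (A (B ψ) : Conf D d → ℂ) σ := rfl
  have h2 : ((B * A) ψ : Conf D d → ℂ) σ = (B (A ψ) : Conf D d → ℂ) σ := rfl
  have h3 : ∀ η : X → Fin d, Y.restrict (Function.updateFinset σ X η) = Y.restrict σ := by
    intro η
    funext x
    have : (x : Site D) ∉ X := fun hx => (Finset.disjoint_left.1 hXY hx) x.2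
    simp [Function.updateFinset, this]
  have h4 : ∀ η : Y → Fin d, X.restrict (Function.updateFinset σ Y η) = X.restrict σ := by
    intro η
    funext x
    have : (x : Site D) ∉ Y := (Finset.disjoint_left.1 hXY) x.2
    simp [Function.updateFinset, this]
  rw [h1, h2, hM, hN]
  simp_rw [hM ψ, hN ψ, Finset.mul_sum, h3, h4]
  rw [Finset.sum_comm]
  refine Finset.sum_congr rfl fun ζ _ => Finset.sum_congr rfl fun η _ => ?_
  have h5 : Function.updateFinset (Function.updateFinset σ X η) Y ζ =
      Function.updateFinset (Function.updateFinset σ Y ζ) X η := by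
    funext x
    by_cases hx : x ∈ X
    · have := (Finset.disjoint_left.1 hXY) hx
      simp [Function.updateFinset, hx, this]
    · by_cases hy : x ∈ Y <;> simp [Function.updateFinset, hx, hy]
  rw [h5]
  ring

/-! ### Translations -/

theorem translate_eq (x : Site D) (A : Op D d) :
    translate x A = (permute (shiftConf d x)).conjStarAlgEquiv A := rfl

theorem norm_translate (x : Site D) (A : Op D d) : ‖translate x A‖ = ‖A‖ := by
  rw [translate_eq]
  exact StarAlgEquiv.norm_map (permute (shiftConf d x)).conjStarAlgEquiv A

theorem translate_add_site (x y : Site D) (A : Op D d) :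
    translate (x + y) A = translate x (translate y A) := by
  ext ψ σ
  have hU : ∀ (z : Site D) (φ : Hil D d) (ρ : Conf D d),
      (permute (shiftConf d z) φ : Conf D d → ℂ) ρ = (φ : Conf D d → ℂ) (shiftConf d z ρ) :=
    fun _ _ _ => rfl
  have hsymm : ∀ (z : Site D) (φ : Hil D d) (ρ : Conf D d),
      ((permute (shiftConf d z)).symm φ : Conf D d → ℂ) ρ =
        (φ : Conf D d → ℂ) ((shiftConf d z).symm ρ) :=
    fun _ _ _ => rfl
  have h1 : (permute (shiftConf d (x + y))).symm ψ =
      (permute (shiftConf d y)).symm ((permute (shiftConf d x)).symm ψ) := by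
    apply lp.ext
    funext ρ
    rw [hsymm, hsymm, hsymm]
    refine congrArg _ ?_
    funext z
    simp only [shiftConf, Equiv.coe_fn_symm_mk]
    congr 1
    abel
  have h2 : shiftConf d (x + y) σ = shiftConf d y (shiftConf d x σ) := by
    funext z
    simp only [shiftConf, Equiv.coe_fn_mk]
    congr 1
    abel
  change (A ((permute (shiftConf d (x + y))).symm ψ) : Conf D d → ℂ) (shiftConf d (x + y) σ) =
    (A ((permute (shiftConf d y)).symm ((permute (shiftConf d x)).symm ψ)) : Conf D d → ℂ)
      (shiftConf d y (shiftConf d x σ))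
  rw [h1, h2]

theorem translate_zero_site (A : Op D d) : translate 0 A = A := by
  have h : shiftConf d (0 : Site D) = Equiv.refl _ := by
    ext σ z
    simp [shiftConf]
  rw [translate, h]
  rfl

theorem coe_shift (x : Site D) (A : O.Obs) : ((shift x A : O.Obs) : Op D d) = translate x A := rfl

theorem norm_obs (A : O.Obs) : ‖A‖ = ‖(A : Op D d)‖ := rfl

theorem norm_shift (x : Site D) (A : O.Obs) : ‖shift x A‖ = ‖A‖ := by
  rw [norm_obs, norm_obs]
  exact norm_translate x _

theorem shift_shift (x y : Site D) (A : O.Obs) : shift x (shift y A) = shift (x + y) A := by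
  apply Subtype.ext
  rw [coe_shift, coe_shift, coe_shift, translate_add_site]

theorem shift_zero_site (A : O.Obs) : shift 0 A = A := by
  apply Subtype.ext
  rw [coe_shift, translate_zero_site]

theorem shift_mul (x : Site D) (A B : O.Obs) : shift x (A * B) = shift x A * shift x B :=
  Subtype.ext (map_mul (permute (shiftConf d x)).conjStarAlgEquiv (A : Op D d) B)

theorem shift_add (x : Site D) (A B : O.Obs) : shift x (A + B) = shift x A + shift x B :=
  Subtype.ext (by
    change translate x ((A : Op D d) + (B : Op D d)) = translate x (A : Op D d) + translate x (B : Op D d)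
    simp only [translate_eq, map_add])

theorem shift_sub (x : Site D) (A B : O.Obs) : shift x (A - B) = shift x A - shift x B :=
  Subtype.ext (by
    change translate x ((A : Op D d) - (B : Op D d)) = translate x (A : Op D d) - translate x (B : Op D d)
    simp only [translate_eq, map_sub])

theorem shift_star (x : Site D) (A : O.Obs) : shift x (star A) = star (shift x A) :=
  Subtype.ext (map_star (permute (shiftConf d x)).conjStarAlgEquiv (A : Op D d))

theorem shift_smul (x : Site D) (c : ℂ) (A : O.Obs) : shift x (c • A) = c • shift x A :=
  Subtype.ext (by
    change translate x (c • (A : Op D d)) = c • translate x A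
    simp only [translate_eq, map_smul])

theorem shift_zero (x : Site D) : shift x (0 : O.Obs) = 0 := by
  have h := shift_smul x 0 (0 : O.Obs)
  rwa [zero_smul, zero_smul] at h

/-- The translation `ι_x` as a linear map. -/
def shiftₗ (x : Site D) : O.Obs →ₗ[ℂ] O.Obs where
  toFun := shift x
  map_add' := shift_add x
  map_smul' := shift_smul x

theorem shift_sum {ι : Type*} (x : Site D) (s : Finset ι) (A : ι → O.Obs) :
    shift x (∑ i ∈ s, A i) = ∑ i ∈ s, shift x (A i) :=
  map_sum (shiftₗ x) A s

theorem supportedIn_shift {X : Finset (Site D)} {A : O.Obs} (x : Site D)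
    (hA : SupportedIn X (A : Op D d)) :
    SupportedIn (X.map (addRightEmbedding x)) ((shift x A : O.Obs) : Op D d) :=
  hA.translate x

/-! ### Geometry of the lattice -/

theorem latticeDist_comm (x y : Site D) : latticeDist x y = latticeDist y x := by
  refine Finset.sum_congr rfl fun i _ => ?_
  rw [← Int.natAbs_neg, neg_sub]

theorem latticeDist_self (x : Site D) : latticeDist x x = 0 := by simp [latticeDist]

theorem latticeDist_triangle (x y z : Site D) :
    latticeDist x z ≤ latticeDist x y + latticeDist y z := by
  rw [latticeDist, latticeDist, latticeDist, ← Finset.sum_add_distrib]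
  refine Finset.sum_le_sum fun i _ => ?_
  omega

theorem latticeDist_eq_sub (x y : Site D) : latticeDist x y = latticeDist (x - y) 0 := by
  simp [latticeDist]

theorem natAbs_le_latticeDist (x : Site D) (i : Fin D) : (x i).natAbs ≤ latticeDist x 0 := by
  have := Finset.single_le_sum (f := fun i => (x i - (0 : Site D) i).natAbs)
    (fun _ _ => Nat.zero_le _) (Finset.mem_univ i)
  simpa [latticeDist] using this

theorem card_ball_le (D n : ℕ) : (ball D n).card ≤ (2 * n + 1) ^ D := by
  refine (Finset.card_filter_le _ _).trans ?_
  rw [Fintype.card_piFinset]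
  simp only [Int.card_Icc, Finset.prod_const, Finset.card_univ, Fintype.card_fin]
  refine Nat.pow_le_pow_left ?_ D
  omega

theorem exists_subset_ball (X : Finset (Site D)) : ∃ r, X ⊆ ball D r :=
  ⟨X.sup fun x => latticeDist x 0, fun _ hx =>
    mem_ball.2 (Finset.le_sup (f := fun x => latticeDist x 0) hx)⟩

/-- The sites at distance at most `r` from the finite set `X`. -/
def thicken (X : Finset (Site D)) (r : ℕ) : Finset (Site D) :=
  Finset.image₂ (· + ·) X (ball D r)

theorem mem_thicken {X : Finset (Site D)} {r : ℕ} {x : Site D} :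
    x ∈ thicken X r ↔ ∃ v ∈ X, latticeDist x v ≤ r := by
  rw [thicken, Finset.mem_image₂]
  constructor
  · rintro ⟨v, hv, w, hw, rfl⟩
    refine ⟨v, hv, ?_⟩
    rw [latticeDist_eq_sub, add_sub_cancel_left]
    exact mem_ball.1 hw
  · rintro ⟨v, hv, h⟩
    refine ⟨v, hv, x - v, ?_, by simp⟩
    rw [mem_ball, ← latticeDist_eq_sub]
    exact h

theorem subset_thicken (X : Finset (Site D)) (r : ℕ) : X ⊆ thicken X r := fun _ hx =>
  mem_thicken.2 ⟨_, hx, by simp [latticeDist_self]⟩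

theorem thicken_mono {X : Finset (Site D)} {r s : ℕ} (h : r ≤ s) : thicken X r ⊆ thicken X s := by
  intro x hx
  obtain ⟨v, hv, hxv⟩ := mem_thicken.1 hx
  exact mem_thicken.2 ⟨v, hv, hxv.trans h⟩

theorem thicken_thicken (X : Finset (Site D)) (r s : ℕ) :
    thicken (thicken X r) s ⊆ thicken X (r + s) := by
  intro x hx
  obtain ⟨v, hv, hxv⟩ := mem_thicken.1 hx
  obtain ⟨w, hw, hvw⟩ := mem_thicken.1 hv
  refine mem_thicken.2 ⟨w, hw, ?_⟩
  have := latticeDist_triangle x v w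
  omega

theorem card_thicken_le (X : Finset (Site D)) (r : ℕ) :
    (thicken X r).card ≤ X.card * (2 * r + 1) ^ D :=
  (Finset.card_image₂_le _ _ _).trans (Nat.mul_le_mul_left _ (card_ball_le D r))

/-! ### The Lie action of a local Hamiltonian -/

/-- The translates of `S` by sites outside this set do not meet `X`. -/
def touching (S X : Finset (Site D)) : Finset (Site D) :=
  Finset.image₂ (fun v u => v - u) X S

theorem card_touching_le (S X : Finset (Site D)) : (touching S X).card ≤ X.card * S.card :=
  Finset.card_image₂_le _ _ _

theorem lieTerm_eq_zero {S X : Finset (Site D)} {h B : O.Obs} (hS : SupportedIn S (h : Op D d))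
    (hX : SupportedIn X (B : Op D d)) {x : Site D} (hx : x ∉ touching S X) :
    shift x h * B - B * shift x h = 0 := by
  rw [sub_eq_zero]
  apply Subtype.ext
  refine SupportedIn.commute ?_ (supportedIn_shift x hS) hX
  rw [Finset.disjoint_left]
  intro z hz hzX
  obtain ⟨u, hu, rfl⟩ := Finset.mem_map.1 hz
  exact hx (Finset.mem_image₂.2 ⟨_, hzX, u, hu, by simp⟩)

theorem lieAction_eq_sum {S X T : Finset (Site D)} {h B : O.Obs}
    (hS : SupportedIn S (h : Op D d)) (hX : SupportedIn X (B : Op D d))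
    (hT : touching S X ⊆ T) :
    lieAction h B = ∑ x ∈ T, (shift x h * B - B * shift x h) := by
  refine finsum_eq_sum_of_support_subset _ fun x hx => ?_
  by_contra hxT
  exact hx (lieTerm_eq_zero hS hX fun h => hxT (hT h))

theorem lieTerm_add (h A B : O.Obs) (x : Site D) :
    shift x h * (A + B) - (A + B) * shift x h =
      (shift x h * A - A * shift x h) + (shift x h * B - B * shift x h) := by
  noncomm_ring

/-- Two local observables and the Hamiltonian density: common finite supports and a common finite
range of summation for the Lie actions. -/
theorem exists_common (h A B : O.Obs) : ∃ S X T : Finset (Site D), SupportedIn S (h : Op D d) ∧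
    SupportedIn X (A : Op D d) ∧ SupportedIn X (B : Op D d) ∧ touching S X ⊆ T := by
  classical
  obtain ⟨S, hS⟩ := O.isLocal h h.2
  obtain ⟨X, hX⟩ := O.isLocal A A.2
  obtain ⟨Y, hY⟩ := O.isLocal B B.2
  exact ⟨S, X ∪ Y, _, hS, hX.mono Finset.subset_union_left, hY.mono Finset.subset_union_right,
    subset_rfl⟩

theorem lieAction_add (h A B : O.Obs) : lieAction h (A + B) = lieAction h A + lieAction h B := by
  obtain ⟨S, X, T, hS, hA, hB, hT⟩ := exists_common h A B
  rw [lieAction_eq_sum hS hA hT, lieAction_eq_sum hS hB hT,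
    lieAction_eq_sum (B := A + B) hS (hA.add hB) hT, ← Finset.sum_add_distrib]
  exact Finset.sum_congr rfl fun x _ => lieTerm_add h A B x

theorem lieAction_smul (h : O.Obs) (c : ℂ) (A : O.Obs) :
    lieAction h (c • A) = c • lieAction h A := by
  obtain ⟨S, X, T, hS, hA, -, hT⟩ := exists_common h A A
  rw [lieAction_eq_sum hS hA hT, lieAction_eq_sum (B := c • A) hS (hA.smul c) hT,
    Finset.smul_sum]
  exact Finset.sum_congr rfl fun x _ => by rw [mul_smul_comm, smul_mul_assoc, smul_sub]

/-- The Lie action as a linear map. -/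
def lieₗ (h : O.Obs) : O.Obs →ₗ[ℂ] O.Obs where
  toFun := lieAction h
  map_add' := lieAction_add h
  map_smul' := lieAction_smul h

theorem lieAction_iterate (h : O.Obs) (n : ℕ) (A : O.Obs) :
    (lieAction h)^[n] A = (lieₗ h ^ n) A := by
  rw [Module.End.pow_apply]
  rfl

theorem lieAction_mul (h A B : O.Obs) :
    lieAction h (A * B) = lieAction h A * B + A * lieAction h B := by
  obtain ⟨S, X, T, hS, hA, hB, hT⟩ := exists_common h A B
  rw [lieAction_eq_sum hS hA hT, lieAction_eq_sum hS hB hT,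
    lieAction_eq_sum (B := A * B) hS (hA.mul hB) hT, Finset.sum_mul, Finset.mul_sum,
    ← Finset.sum_add_distrib]
  exact Finset.sum_congr rfl fun x _ => by noncomm_ring

theorem lieAction_one (h : O.Obs) : lieAction h 1 = 0 := by
  rw [lieAction, finsum_eq_zero_of_forall_eq_zero]
  intro x
  simp

theorem lieAction_star {h : O.Obs} (hh : star h = h) (A : O.Obs) :
    star (lieAction h A) = -lieAction h (star A) := by
  obtain ⟨S, X, T, hS, hA, -, hT⟩ := exists_common h A A
  rw [lieAction_eq_sum hS hA hT, lieAction_eq_sum (B := star A) hS hA.star hT, star_sum,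
    ← Finset.sum_neg_distrib]
  exact Finset.sum_congr rfl fun x _ => by
    rw [star_sub, star_mul, star_mul, ← shift_star, hh, neg_sub]

theorem lieAction_shift (h : O.Obs) (y : Site D) (A : O.Obs) :
    lieAction h (shift y A) = shift y (lieAction h A) := by
  classical
  obtain ⟨S, X, T, hS, hA, -, hT⟩ := exists_common h A A
  rw [lieAction_eq_sum hS hA hT, shift_sum]
  have h1 : ∀ x, shift y (shift x h * A - A * shift x h) =
      shift (x + y) h * shift y A - shift y A * shift (x + y) h := by
    intro x
    rw [shift_sub, shift_mul, shift_mul, shift_shift, add_comm]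
  rw [Finset.sum_congr rfl fun x _ => h1 x, lieAction,
    finsum_eq_sum_of_support_subset (s := T.map (addRightEmbedding y)), Finset.sum_map]
  · rfl
  · intro x hx
    by_contra hxT
    refine Function.mem_support.1 hx ?_
    have h2 : x - y ∉ T := fun h => hxT (by
      have h3 := Finset.mem_map_of_mem (addRightEmbedding y) h
      rwa [addRightEmbedding_apply, sub_add_cancel] at h3)
    have h3 := h1 (x - y)
    rw [lieTerm_eq_zero hS hA fun h => h2 (hT h), sub_add_cancel] at h3
    rw [← h3, shift_zero]

theorem iterate_lie_shift (h : O.Obs) (n : ℕ) (y : Site D) (A : O.Obs) :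
    (lieₗ h ^ n) (shift y A) = shift y ((lieₗ h ^ n) A) := by
  induction n with
  | zero => rfl
  | succ n ih =>
    rw [pow_succ', Module.End.mul_apply, Module.End.mul_apply, ih]
    exact lieAction_shift h y _

theorem iterate_lie_star {h : O.Obs} (hh : star h = h) (n : ℕ) (A : O.Obs) :
    star ((lieₗ h ^ n) A) = (-1 : ℂ) ^ n • (lieₗ h ^ n) (star A) := by
  induction n with
  | zero => simp
  | succ n ih =>
    rw [pow_succ', Module.End.mul_apply, Module.End.mul_apply]
    have h1 : star (lieₗ h ((lieₗ h ^ n) A)) = -lieₗ h (star ((lieₗ h ^ n) A)) :=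
      lieAction_star hh _
    rw [h1, ih, map_smul, pow_succ', neg_one_mul, neg_smul]

theorem iterate_lie_mul (h : O.Obs) (n : ℕ) (A B : O.Obs) :
    (lieₗ h ^ n) (A * B) = ∑ ij ∈ Finset.HasAntidiagonal.antidiagonal n,
      n.choose ij.1 • ((lieₗ h ^ ij.1) A * (lieₗ h ^ ij.2) B) := by
  induction n with
  | zero => simp
  | succ n ih =>
    rw [pow_succ', Module.End.mul_apply, ih, map_sum,
      Finset.sum_antidiagonal_choose_succ_nsmul (fun i j => (lieₗ h ^ i) A * (lieₗ h ^ j) B),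
      ← Finset.sum_add_distrib]
    refine Finset.sum_congr rfl fun ij hij => ?_
    have h1 : lieₗ h ((lieₗ h ^ ij.1) A * (lieₗ h ^ ij.2) B) =
        lieₗ h ((lieₗ h ^ ij.1) A) * (lieₗ h ^ ij.2) B +
          (lieₗ h ^ ij.1) A * lieₗ h ((lieₗ h ^ ij.2) B) := lieAction_mul h _ _
    have h2 : n.choose ij.1 = n.choose ij.2 := by
      rw [← Finset.HasAntidiagonal.mem_antidiagonal.1 hij, Nat.choose_symm_add]
    rw [map_nsmul, h1, nsmul_add, pow_succ', pow_succ', Module.End.mul_apply,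
      Module.End.mul_apply, add_comm, h2]

theorem iterate_lie_one (h : O.Obs) (n : ℕ) : (lieₗ h ^ (n + 1)) (1 : O.Obs) = 0 := by
  rw [pow_succ, Module.End.mul_apply]
  have : lieₗ h (1 : O.Obs) = 0 := lieAction_one h
  rw [this, map_zero]

theorem norm_lieTerm_le (h B : O.Obs) (x : Site D) :
    ‖shift x h * B - B * shift x h‖ ≤ 2 * ‖h‖ * ‖B‖ := by
  calc ‖shift x h * B - B * shift x h‖ ≤ ‖shift x h * B‖ + ‖B * shift x h‖ := norm_sub_le _ _
    _ ≤ ‖shift x h‖ * ‖B‖ + ‖B‖ * ‖shift x h‖ := add_le_add (norm_mul_le _ _) (norm_mul_le _ _)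
    _ = 2 * ‖h‖ * ‖B‖ := by rw [norm_shift]; ring

/-- Growth of iterated commutators. The induction peels off the *innermost* commutator, whose
summands have supports larger than `X` by at most `S.card` sites; the supports of the full iterates,
of cardinality `∼ n ^ D`, would give a bound that is too weak. -/
theorem norm_iterate_lie_le_prod {S : Finset (Site D)} {h : O.Obs}
    (hS : SupportedIn S (h : Op D d)) (n l : ℕ) :
    ∀ (X : Finset (Site D)) (A : O.Obs), X.card ≤ l → SupportedIn X (A : Op D d) →
      ‖(lieₗ h ^ n) A‖ ≤ (∏ j ∈ Finset.range n, (2 * ‖h‖ * S.card * (l + j * S.card))) * ‖A‖ := by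
  classical
  induction n generalizing l with
  | zero => intro X A _ _; simp
  | succ n ih =>
    intro X A hX hA
    rw [pow_succ, Module.End.mul_apply]
    have h1 : lieₗ h A = ∑ x ∈ touching S X, (shift x h * A - A * shift x h) :=
      lieAction_eq_sum hS hA subset_rfl
    rw [h1, map_sum, Finset.prod_range_succ']
    have h2 : ∀ x ∈ touching S X, ‖(lieₗ h ^ n) (shift x h * A - A * shift x h)‖ ≤
        (∏ j ∈ Finset.range n, (2 * ‖h‖ * S.card * ((l + S.card : ℕ) + j * S.card))) *
          (2 * ‖h‖ * ‖A‖) := by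
      intro x _
      have hs := supportedIn_shift x hS
      have h3 : SupportedIn (X ∪ S.map (addRightEmbedding x)) (shift x h : Op D d) :=
        hs.mono Finset.subset_union_right
      have h4 : SupportedIn (X ∪ S.map (addRightEmbedding x)) (A : Op D d) :=
        hA.mono Finset.subset_union_left
      refine (ih (l + S.card) _ _ ?_ ((h3.mul h4).sub (h4.mul h3))).trans ?_
      · refine (Finset.card_union_le _ _).trans ?_
        rw [Finset.card_map]
        omega
      · gcongr
        exact norm_lieTerm_le h A x
    refine (norm_sum_le_of_le _ h2).trans ?_
    rw [Finset.sum_const, nsmul_eq_mul]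
    have h5 : ((touching S X).card : ℝ) ≤ l * S.card := by
      calc ((touching S X).card : ℝ) ≤ (X.card * S.card : ℕ) := by
            exact_mod_cast card_touching_le S X
        _ ≤ l * S.card := by push_cast; gcongr
    calc _ ≤ (l * S.card : ℝ) * ((∏ j ∈ Finset.range n,
          (2 * ‖h‖ * S.card * ((l + S.card : ℕ) + j * S.card))) * (2 * ‖h‖ * ‖A‖)) := by gcongr
      _ = _ := by
        have h6 : ∀ j : ℕ, 2 * ‖h‖ * S.card * (((l + S.card : ℕ) : ℝ) + j * S.card) =
            2 * ‖h‖ * S.card * (l + (j + 1 : ℕ) * S.card) := by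
          intro j; push_cast; ring
        simp_rw [h6]
        push_cast
        ring

theorem prod_add_le (l n : ℕ) :
    (∏ j ∈ Finset.range n, ((l : ℝ) + j)) ≤ n.factorial * 2 ^ (l + n) := by
  have h1 : (∏ j ∈ Finset.range n, ((l : ℝ) + j)) = (l.ascFactorial n : ℕ) := by
    rw [Nat.ascFactorial_eq_prod_range]
    push_cast
    rfl
  rw [h1, ← Nat.cast_ofNat, ← Nat.cast_pow, ← Nat.cast_mul]
  norm_cast
  rcases l with _ | l
  · rcases n with _ | n
    · simp
    · simp [Nat.zero_ascFactorial]
  · rw [Nat.ascFactorial_eq_factorial_mul_choose]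
    refine Nat.mul_le_mul_left _ ((Nat.choose_le_two_pow _ _).trans ?_)
    exact Nat.pow_le_pow_right (by norm_num) (by omega)

/-- A rate at which iterated commutators with the density `h` grow. -/
def lieRate (h : O.Obs) : ℝ := 4 * ‖h‖ * ((suppF h).card + 1 : ℕ) ^ 2 + 1

theorem lieRate_pos (h : O.Obs) : 0 < lieRate h := by
  rw [lieRate]
  positivity

theorem norm_iterate_lie_le [NeZero d] (h : O.Obs) (n : ℕ) {X : Finset (Site D)} {A : O.Obs}
    (hA : SupportedIn X (A : Op D d)) :
    ‖(lieₗ h ^ n) A‖ ≤ 2 ^ X.card * (n.factorial * lieRate h ^ n) * ‖A‖ := by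
  refine (norm_iterate_lie_le_prod (supportedIn_suppF h) n X.card X A le_rfl hA).trans ?_
  gcongr
  set m := (suppF h).card
  calc (∏ j ∈ Finset.range n, (2 * ‖h‖ * m * ((X.card : ℝ) + j * m)))
      ≤ ∏ j ∈ Finset.range n, (2 * ‖h‖ * (m + 1 : ℕ) ^ 2 * ((X.card : ℝ) + j)) := by
        refine Finset.prod_le_prod (fun j _ => by positivity) fun j _ => ?_
        have h1 : (m : ℝ) * ((X.card : ℝ) + j * m) ≤ (m + 1 : ℕ) ^ 2 * ((X.card : ℝ) + j) := by
          push_cast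
          have h2 : (0 : ℝ) ≤ m := Nat.cast_nonneg m
          have h3 : (0 : ℝ) ≤ X.card := Nat.cast_nonneg _
          have h4 : (0 : ℝ) ≤ j := Nat.cast_nonneg _
          nlinarith [mul_nonneg h2 h3, mul_nonneg h2 h4, mul_nonneg (mul_nonneg h2 h2) h3]
        calc 2 * ‖h‖ * m * ((X.card : ℝ) + j * m) = 2 * ‖h‖ * (m * ((X.card : ℝ) + j * m)) := by ring
          _ ≤ 2 * ‖h‖ * ((m + 1 : ℕ) ^ 2 * ((X.card : ℝ) + j)) := by gcongr
          _ = _ := by ring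
    _ = (2 * ‖h‖ * (m + 1 : ℕ) ^ 2) ^ n * ∏ j ∈ Finset.range n, ((X.card : ℝ) + j) := by
        rw [Finset.prod_mul_distrib, Finset.prod_const, Finset.card_range]
    _ ≤ (2 * ‖h‖ * (m + 1 : ℕ) ^ 2) ^ n * (n.factorial * 2 ^ (X.card + n)) := by
        gcongr
        exact prod_add_le _ _
    _ = 2 ^ X.card * (n.factorial * (4 * ‖h‖ * (m + 1 : ℕ) ^ 2) ^ n) := by
        rw [show (4 : ℝ) * ‖h‖ * (m + 1 : ℕ) ^ 2 = 2 * (2 * ‖h‖ * (m + 1 : ℕ) ^ 2) by ring,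
          mul_pow 2, pow_add]
        ring
    _ ≤ 2 ^ X.card * (n.factorial * lieRate h ^ n) := by
        gcongr
        rw [lieRate]
        linarith

/-- Every commutator with the Hamiltonian enlarges supports by a fixed distance `R`. -/
theorem exists_range (h : O.Obs) : ∃ R : ℕ, ∀ (n : ℕ) (X : Finset (Site D)) (A : O.Obs),
    SupportedIn X (A : Op D d) → SupportedIn (thicken X (n * R)) ((lieₗ h ^ n) A : Op D d) := by
  obtain ⟨S, hS⟩ := O.isLocal h h.2
  obtain ⟨r, hr⟩ := exists_subset_ball S
  have hr' := fun u (hu : u ∈ S) => mem_ball.1 (hr hu)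
  have h1 : ∀ (X : Finset (Site D)) (A : O.Obs), SupportedIn X (A : Op D d) →
      SupportedIn (thicken X (2 * r)) (lieₗ h A : Op D d) := by
    intro X A hA
    have h2 : lieₗ h A = ∑ x ∈ touching S X, (shift x h * A - A * shift x h) :=
      lieAction_eq_sum hS hA subset_rfl
    rw [h2]
    refine SupportedIn.sum fun x hx => ?_
    have hA' : SupportedIn (thicken X (2 * r)) (A : Op D d) := hA.mono (subset_thicken X _)
    have hs : SupportedIn (thicken X (2 * r)) (shift x h : Op D d) := by
      refine (supportedIn_shift x hS).mono fun z hz => ?_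
      obtain ⟨u, hu, rfl⟩ := Finset.mem_map.1 hz
      obtain ⟨v, hv, u', hu', rfl⟩ := Finset.mem_image₂.1 hx
      refine mem_thicken.2 ⟨v, hv, ?_⟩
      have h3 := latticeDist_triangle u 0 u'
      have h4 := hr' u hu
      have h5 := hr' u' hu'
      rw [latticeDist_comm 0 u'] at h3
      have h6 : latticeDist (addRightEmbedding (v - u') u) v = latticeDist u u' := by
        rw [latticeDist_eq_sub, latticeDist_eq_sub u u', addRightEmbedding_apply]
        congr 1
        abel
      omega
    exact (hs.mul hA').sub (hA'.mul hs)
  refine ⟨2 * r, fun n X A hA => ?_⟩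
  induction n with
  | zero => simpa using hA.mono (subset_thicken X _)
  | succ n ih =>
    rw [pow_succ', Module.End.mul_apply]
    refine (h1 _ _ ih).mono ((thicken_thicken X _ _).trans (thicken_mono ?_))
    exact (Nat.succ_mul _ _).ge

/-! ### The evolution series at small times -/

instance isClosed_quasi : IsClosed (O.carrier.topologicalClosure : Set (Op D d)) :=
  O.carrier.isClosed_topologicalClosure

instance completeSpace_quasi : CompleteSpace O.Quasi :=
  IsClosed.completeSpace_coe

/-- The inclusion `𝒪 → 𝒜` as a morphism of `⋆`-algebras. -/
def inclₐ : O.Obs →⋆ₐ[ℂ] O.Quasi := StarSubalgebra.inclusion O.carrier.le_topologicalClosure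

theorem incl_eq (A : O.Obs) : incl A = inclₐ A := rfl

theorem norm_incl (A : O.Obs) : ‖incl A‖ = ‖A‖ := rfl

theorem norm_star_mul_obs (A : O.Obs) : ‖star A * A‖ = ‖A‖ * ‖A‖ :=
  CStarRing.norm_star_mul_self (x := (A : Op D d))

theorem norm_star_mul_quasi (A : O.Quasi) : ‖star A * A‖ = ‖A‖ * ‖A‖ :=
  CStarRing.norm_star_mul_self (x := (A : Op D d))

theorem denseRange_incl : DenseRange (incl : O.Obs → O.Quasi) := by
  intro x
  have hx : (x : Op D d) ∈ closure (O.carrier : Set (Op D d)) := x.2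
  rw [Metric.mem_closure_iff] at hx ⊢
  intro ε hε
  obtain ⟨b, hb, hlt⟩ := hx ε hε
  exact ⟨incl ⟨b, hb⟩, ⟨_, rfl⟩, hlt⟩

theorem continuous_starAlgHom (φ : O.Quasi →⋆ₐ[ℂ] O.Quasi) : Continuous φ :=
  AddMonoidHomClass.continuous_of_bound φ 1 fun a => by
    simpa only [one_mul] using NonUnitalStarAlgHom.norm_apply_le φ a

theorem starAlgHom_ext {φ ψ : O.Quasi →⋆ₐ[ℂ] O.Quasi} (h : ∀ A : O.Obs, φ (incl A) = ψ (incl A)) :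
    φ = ψ :=
  DFunLike.coe_injective <| denseRange_incl.equalizer (continuous_starAlgHom φ)
    (continuous_starAlgHom ψ) (funext h)

/-- The `n`-th term `(i t)^n / n! • (ℒH)^n(A)` of the evolution series. -/
def evoTerm (h : O.Obs) (t : ℝ) (n : ℕ) : O.Obs →ₗ[ℂ] O.Obs :=
  ((Complex.I * t) ^ n / (n.factorial : ℂ)) • lieₗ h ^ n

theorem evoTerm_apply (h : O.Obs) (t : ℝ) (n : ℕ) (A : O.Obs) :
    evoTerm h t n A = ((Complex.I * t) ^ n / (n.factorial : ℂ)) • (lieₗ h ^ n) A := rfl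

theorem incl_evoTerm (h : O.Obs) (t : ℝ) (n : ℕ) (A : O.Obs) :
    incl (evoTerm h t n A) =
      ((Complex.I * t) ^ n / (n.factorial : ℂ)) • incl ((lieAction h)^[n] A) := by
  rw [lieAction_iterate]
  rfl

theorem evoTerm_zero (h : O.Obs) (t : ℝ) (A : O.Obs) : evoTerm h t 0 A = A := by
  simp [evoTerm_apply]

theorem evoTerm_shift (h : O.Obs) (t : ℝ) (n : ℕ) (y : Site D) (A : O.Obs) :
    evoTerm h t n (shift y A) = shift y (evoTerm h t n A) := by
  rw [evoTerm_apply, evoTerm_apply, iterate_lie_shift, shift_smul]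

theorem evoTerm_star {h : O.Obs} (hh : star h = h) (t : ℝ) (n : ℕ) (A : O.Obs) :
    star (evoTerm h t n A) = evoTerm h t n (star A) := by
  rw [evoTerm_apply, evoTerm_apply, star_smul, iterate_lie_star hh, smul_smul]
  congr 1
  simp only [star_div₀, star_pow, star_mul', RCLike.star_def, Complex.conj_I, Complex.conj_ofReal,
    Complex.conj_natCast]
  rw [div_mul_eq_mul_div, ← mul_pow]
  congr 2
  ring

theorem evoTerm_one_succ (h : O.Obs) (t : ℝ) (n : ℕ) : evoTerm h t (n + 1) (1 : O.Obs) = 0 := by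
  rw [evoTerm_apply, iterate_lie_one, smul_zero]

theorem evoTerm_mul (h : O.Obs) (t : ℝ) (n : ℕ) (A B : O.Obs) :
    evoTerm h t n (A * B) = ∑ ij ∈ Finset.HasAntidiagonal.antidiagonal n,
      evoTerm h t ij.1 A * evoTerm h t ij.2 B := by
  rw [evoTerm_apply, iterate_lie_mul, Finset.smul_sum]
  refine Finset.sum_congr rfl fun ij hij => ?_
  rw [evoTerm_apply, evoTerm_apply, smul_mul_smul_comm, ← Nat.cast_smul_eq_nsmul ℂ, smul_smul]
  congr 1
  have hn := Finset.HasAntidiagonal.mem_antidiagonal.1 hij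
  have h1 : (n.choose ij.1 : ℂ) * (ij.1.factorial * ij.2.factorial) = n.factorial := by
    rw [← hn, ← mul_assoc, Nat.choose_symm_add]
    exact_mod_cast Nat.add_choose_mul_factorial_mul_factorial ij.1 ij.2
  have h2 : (ij.1.factorial : ℂ) ≠ 0 := by exact_mod_cast ij.1.factorial_ne_zero
  have h3 : (ij.2.factorial : ℂ) ≠ 0 := by exact_mod_cast ij.2.factorial_ne_zero
  have h4 : (n.factorial : ℂ) ≠ 0 := by exact_mod_cast n.factorial_ne_zero
  rw [div_mul_div_comm, div_mul_eq_mul_div, div_eq_div_iff h4 (mul_ne_zero h2 h3), ← h1, ← hn,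
    pow_add]
  ring

/-- The binomial identity behind the group law. -/
theorem evoTerm_add (h : O.Obs) (s t : ℝ) (n : ℕ) (A : O.Obs) :
    evoTerm h (s + t) n A = ∑ ij ∈ Finset.HasAntidiagonal.antidiagonal n,
      evoTerm h s ij.1 (evoTerm h t ij.2 A) := by
  have h1 : ∀ ij ∈ Finset.HasAntidiagonal.antidiagonal n,
      evoTerm h s ij.1 (evoTerm h t ij.2 A) =
        ((Complex.I * s) ^ ij.1 / (ij.1.factorial : ℂ) *
          ((Complex.I * t) ^ ij.2 / (ij.2.factorial : ℂ))) • (lieₗ h ^ n) A := by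
    intro ij hij
    rw [evoTerm_apply, evoTerm_apply, map_smul, smul_smul, ← Module.End.mul_apply, ← pow_add,
      Finset.HasAntidiagonal.mem_antidiagonal.1 hij]
  rw [Finset.sum_congr rfl h1, ← Finset.sum_smul, evoTerm_apply]
  congr 1
  push_cast
  rw [mul_add, (Commute.all _ _).add_pow', Finset.sum_div]
  refine Finset.sum_congr rfl fun ij hij => ?_
  have hn := Finset.HasAntidiagonal.mem_antidiagonal.1 hij
  have h1 : (n.choose ij.1 : ℂ) * (ij.1.factorial * ij.2.factorial) = n.factorial := by
    rw [← hn, ← mul_assoc, Nat.choose_symm_add]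
    exact_mod_cast Nat.add_choose_mul_factorial_mul_factorial ij.1 ij.2
  have h2 : (ij.1.factorial : ℂ) ≠ 0 := by exact_mod_cast ij.1.factorial_ne_zero
  have h3 : (ij.2.factorial : ℂ) ≠ 0 := by exact_mod_cast ij.2.factorial_ne_zero
  have h4 : (n.factorial : ℂ) ≠ 0 := by exact_mod_cast n.factorial_ne_zero
  rw [div_mul_div_comm, div_eq_div_iff h4 (mul_ne_zero h2 h3), ← h1, nsmul_eq_mul]
  ring

theorem norm_evoTerm_le [NeZero d] (h : O.Obs) (t : ℝ) (n : ℕ) {X : Finset (Site D)} {A : O.Obs}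
    (hA : SupportedIn X (A : Op D d)) :
    ‖evoTerm h t n A‖ ≤ 2 ^ X.card * ‖A‖ * (|t| * lieRate h) ^ n := by
  rw [evoTerm_apply, norm_smul]
  have h1 : ‖(Complex.I * t) ^ n / (n.factorial : ℂ)‖ = |t| ^ n / n.factorial := by
    simp
  have h2 : (0 : ℝ) < n.factorial := by exact_mod_cast n.factorial_pos
  calc _ ≤ |t| ^ n / n.factorial * (2 ^ X.card * (n.factorial * lieRate h ^ n) * ‖A‖) := by
        rw [h1]
        gcongr
        exact norm_iterate_lie_le h n hA
    _ = _ := by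
        rw [mul_pow]
        field_simp

/-- Times at which the evolution series converges geometrically with ratio `1/4`. -/
def SmallTime (h : O.Obs) (t : ℝ) : Prop := |t| * lieRate h ≤ 1 / 4

theorem SmallTime.norm_evoTerm_le [NeZero d] {h : O.Obs} {t : ℝ} (ht : SmallTime h t) (n : ℕ)
    {X : Finset (Site D)} {A : O.Obs} (hA : SupportedIn X (A : Op D d)) :
    ‖evoTerm h t n A‖ ≤ 2 ^ X.card * ‖A‖ * (1 / 4) ^ n := by
  refine (QuantumLattice.norm_evoTerm_le h t n hA).trans ?_
  have := lieRate_pos h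
  gcongr
  exact ht

theorem SmallTime.summable_norm [NeZero d] {h : O.Obs} {t : ℝ} (ht : SmallTime h t) (A : O.Obs) :
    Summable fun n => ‖evoTerm h t n A‖ := by
  obtain ⟨X, hX⟩ := O.isLocal A A.2
  exact Summable.of_nonneg_of_le (fun _ => norm_nonneg _) (fun n => ht.norm_evoTerm_le n hX)
    ((summable_geometric_of_lt_one (by norm_num) (by norm_num)).mul_left _)

/-- The sum of the evolution series. -/
def evo (h : O.Obs) (t : ℝ) (A : O.Obs) : O.Quasi := ∑' n, incl (evoTerm h t n A)

theorem SmallTime.hasSum [NeZero d] {h : O.Obs} {t : ℝ} (ht : SmallTime h t) (A : O.Obs) :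
    HasSum (fun n => incl (evoTerm h t n A)) (evo h t A) :=
  (Summable.of_norm (f := fun n => incl (evoTerm h t n A)) (ht.summable_norm A)).hasSum

theorem SmallTime.norm_evo_le [NeZero d] {h : O.Obs} {t : ℝ} (ht : SmallTime h t)
    {X : Finset (Site D)} {A : O.Obs} (hA : SupportedIn X (A : Op D d)) :
    ‖evo h t A‖ ≤ 2 ^ X.card * 2 * ‖A‖ := by
  have h1 := tsum_of_norm_bounded (f := fun n => incl (evoTerm h t n A))
    ((hasSum_geometric_of_lt_one (by norm_num) (by norm_num : (1 / 4 : ℝ) < 1)).mul_left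
      (2 ^ X.card * ‖A‖)) (fun n => ht.norm_evoTerm_le n hA)
  refine h1.trans ?_
  have : 0 ≤ 2 ^ X.card * ‖A‖ := by positivity
  rw [show (1 - 1 / 4 : ℝ)⁻¹ = 4 / 3 by norm_num]
  linarith

theorem SmallTime.evo_mul [NeZero d] {h : O.Obs} {t : ℝ} (ht : SmallTime h t) (A B : O.Obs) :
    evo h t (A * B) = evo h t A * evo h t B := by
  have hA : Summable fun n => ‖incl (evoTerm h t n A)‖ := ht.summable_norm A
  have hB : Summable fun n => ‖incl (evoTerm h t n B)‖ := ht.summable_norm B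
  have h1 := tsum_mul_tsum_eq_tsum_sum_antidiagonal_of_summable_norm hA hB
  rw [evo, evo, evo, h1]
  refine tsum_congr fun n => ?_
  rw [evoTerm_mul, incl_eq, map_sum]
  exact Finset.sum_congr rfl fun ij _ => map_mul inclₐ _ _

theorem SmallTime.evo_add [NeZero d] {h : O.Obs} {t : ℝ} (ht : SmallTime h t) (A B : O.Obs) :
    evo h t (A + B) = evo h t A + evo h t B := by
  refine HasSum.tsum_eq ?_
  have h1 : ∀ n, incl (evoTerm h t n (A + B)) =
      incl (evoTerm h t n A) + incl (evoTerm h t n B) := fun n => by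
    rw [map_add, incl_eq, map_add, incl_eq, incl_eq]
  simp_rw [h1]
  exact (ht.hasSum A).add (ht.hasSum B)

theorem SmallTime.evo_smul [NeZero d] {h : O.Obs} {t : ℝ} (ht : SmallTime h t) (c : ℂ)
    (A : O.Obs) : evo h t (c • A) = c • evo h t A := by
  refine HasSum.tsum_eq ?_
  have h1 : ∀ n, incl (evoTerm h t n (c • A)) = c • incl (evoTerm h t n A) := fun n => by
    rw [map_smul, incl_eq, map_smul, incl_eq]
  simp_rw [h1]
  exact (ht.hasSum A).const_smul c

theorem SmallTime.evo_star [NeZero d] {h : O.Obs} (hh : star h = h) {t : ℝ} (ht : SmallTime h t)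
    (A : O.Obs) : evo h t (star A) = star (evo h t A) := by
  refine HasSum.tsum_eq ?_
  have h1 : ∀ n, incl (evoTerm h t n (star A)) = star (incl (evoTerm h t n A)) := fun n => by
    rw [← evoTerm_star hh, incl_eq, map_star, incl_eq]
  simp_rw [h1]
  exact (ht.hasSum A).star

theorem evo_one (h : O.Obs) (t : ℝ) : evo h t (1 : O.Obs) = 1 := by
  rw [evo, tsum_eq_single 0]
  · rw [evoTerm_zero]
    rfl
  · intro n hn
    obtain ⟨k, rfl⟩ := Nat.exists_eq_succ_of_ne_zero hn
    rw [evoTerm_one_succ, incl_eq, map_zero]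

/-- A number whose powers are bounded by a constant times the powers of `b` is at most `b`. -/
theorem le_of_forall_pow_le {a b C : ℝ} (hb : 0 ≤ b)
    (h : ∀ n : ℕ, a ^ 2 ^ n ≤ C * b ^ 2 ^ n) : a ≤ b := by
  by_contra! hlt
  rcases hb.eq_or_lt with rfl | hb
  · have h1 := h 0
    simp only [pow_zero, pow_one, mul_zero] at h1
    linarith
  have h1 : 1 < a / b := (one_lt_div hb).2 hlt
  obtain ⟨n, hn⟩ := ((tendsto_pow_atTop_atTop_of_one_lt h1).eventually_gt_atTop C).exists
  have h2 : (a / b) ^ n ≤ (a / b) ^ 2 ^ n := pow_le_pow_right₀ h1.le Nat.lt_two_pow_self.le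
  have h3 := h n
  rw [div_pow (n := 2 ^ n)] at h2
  have h4 : a ^ 2 ^ n / b ^ 2 ^ n ≤ C := by
    rw [div_le_iff₀ (by positivity)]
    exact h3
  linarith

theorem SupportedIn.pow {X : Finset (Site D)} {B : O.Obs} (hB : SupportedIn X (B : Op D d))
    (n : ℕ) : SupportedIn X ((B ^ n : O.Obs) : Op D d) := by
  induction n with
  | zero => exact SupportedIn.one X
  | succ n ih =>
    rw [pow_succ]
    exact ih.mul hB

theorem SmallTime.evo_pow [NeZero d] {h : O.Obs} {t : ℝ} (ht : SmallTime h t) (B : O.Obs) (n : ℕ) :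
    evo h t (B ^ n) = evo h t B ^ n := by
  induction n with
  | zero => rw [pow_zero, pow_zero, evo_one]
  | succ n ih => rw [pow_succ, pow_succ, ht.evo_mul, ih]

/-- The evolution is a contraction on self-adjoint local observables. The crude bound
`SmallTime.norm_evo_le`, whose constant depends only on the support, is applied to the powers
`B ^ 2 ^ n`, all of which have the same support. -/
theorem SmallTime.norm_evo_le_of_isSelfAdjoint [NeZero d] {h : O.Obs} (hh : star h = h) {t : ℝ}
    (ht : SmallTime h t) {B : O.Obs} (hB : star B = B) : ‖evo h t B‖ ≤ ‖B‖ := by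
  obtain ⟨X, hX⟩ := O.isLocal B B.2
  have hE : IsSelfAdjoint (evo h t B) := by
    rw [IsSelfAdjoint, ← ht.evo_star hh, hB]
  have hBs : IsSelfAdjoint B := hB
  have key : ∀ n : ℕ, ‖evo h t B‖ ^ 2 ^ n ≤ 2 ^ X.card * 2 * ‖B‖ ^ 2 ^ n := by
    intro n
    have h2 : ‖evo h t B ^ 2 ^ n‖ = ‖evo h t B‖ ^ 2 ^ n := hE.norm_pow_two_pow n
    have h3 : ‖B ^ 2 ^ n‖ = ‖B‖ ^ 2 ^ n := hBs.norm_pow_two_pow n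
    have h6 := ht.norm_evo_le (hX.pow (2 ^ n))
    rw [ht.evo_pow, h2, h3] at h6
    exact h6
  exact le_of_forall_pow_le (norm_nonneg B) key

/-- The evolution is a contraction, by the `C⋆`-identity. -/
theorem SmallTime.norm_evo_le_norm [NeZero d] {h : O.Obs} (hh : star h = h) {t : ℝ}
    (ht : SmallTime h t) (A : O.Obs) : ‖evo h t A‖ ≤ ‖A‖ := by
  have h1 := ht.norm_evo_le_of_isSelfAdjoint hh (B := star A * A) (by rw [star_mul, star_star])
  rw [ht.evo_mul, ht.evo_star hh, norm_star_mul_obs, norm_star_mul_quasi] at h1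
  exact (mul_self_le_mul_self_iff (norm_nonneg _) (norm_nonneg _)).2 h1

/-- The evolution on local observables as a linear map. -/
def SmallTime.evoₗ [NeZero d] {h : O.Obs} {t : ℝ} (ht : SmallTime h t) : O.Obs →ₗ[ℂ] O.Quasi where
  toFun := evo h t
  map_add' := ht.evo_add
  map_smul' := ht.evo_smul

/-- At small times the evolution series extends to a `⋆`-endomorphism of the quasi-local algebra. -/
theorem SmallTime.exists_starAlgHom [NeZero d] {h : O.Obs} (hh : star h = h) {t : ℝ}
    (ht : SmallTime h t) :
    ∃ σ : O.Quasi →⋆ₐ[ℂ] O.Quasi, ∀ A : O.Obs, σ (incl A) = evo h t A := by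
  let e : O.Obs →ₗ[ℂ] O.Quasi := inclₐ.toAlgHom.toLinearMap
  have he : DenseRange e := denseRange_incl
  let F : O.Quasi →L[ℂ] O.Quasi := ht.evoₗ.extendOfNorm e
  have hF : ∀ A : O.Obs, F (incl A) = evo h t A := fun A =>
    LinearMap.extendOfNorm_eq he ⟨1, fun A => by
      rw [one_mul]
      exact ht.norm_evo_le_norm hh A⟩ A
  have hone : F 1 = 1 := by
    rw [show (1 : O.Quasi) = incl 1 from rfl, hF, evo_one]
    rfl
  refine ⟨{ toFun := F, map_one' := hone, map_mul' := ?_, map_zero' := map_zero F,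
            map_add' := map_add F, commutes' := ?_, map_star' := ?_ }, hF⟩
  · intro a b
    refine denseRange_incl.induction_on₂ (p := fun a b => F (a * b) = F a * F b) ?_ ?_ a b
    · exact isClosed_eq (by fun_prop) (by fun_prop)
    · intro A B
      rw [show incl A * incl B = incl (A * B) from rfl, hF, hF, hF, ht.evo_mul]
  · intro c
    rw [Algebra.algebraMap_eq_smul_one]
    change F (c • 1) = c • 1
    rw [map_smul, hone]
  · intro a
    refine denseRange_incl.induction_on (p := fun a => F (star a) = star (F a)) a ?_ ?_
    · exact isClosed_eq (by fun_prop) (by fun_prop)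
    · intro A
      rw [show star (incl A) = incl (star A) from rfl, hF, hF, ht.evo_star hh]

/-! ### The one-parameter group -/

/-- The partial sums of the evolution series, as local observables. -/
def evoPartial (h : O.Obs) (t : ℝ) (N : ℕ) : O.Obs →ₗ[ℂ] O.Obs :=
  ∑ n ∈ Finset.range N, evoTerm h t n

theorem evoPartial_apply (h : O.Obs) (t : ℝ) (N : ℕ) (A : O.Obs) :
    evoPartial h t N A = ∑ n ∈ Finset.range N, evoTerm h t n A := by
  rw [evoPartial, LinearMap.sum_apply]

theorem SmallTime.norm_evo_sub_evoPartial_le [NeZero d] {h : O.Obs} {t : ℝ} (ht : SmallTime h t)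
    (N : ℕ) {X : Finset (Site D)} {A : O.Obs} (hA : SupportedIn X (A : Op D d)) :
    ‖evo h t A - incl (evoPartial h t N A)‖ ≤ 2 ^ X.card * 2 * ‖A‖ * (|t| * lieRate h) ^ N := by
  have hb := lieRate_pos h
  have h1 : HasSum (fun n => incl (evoTerm h t (n + N) A))
      (evo h t A - incl (evoPartial h t N A)) := by
    have h2 : incl (evoPartial h t N A) = ∑ n ∈ Finset.range N, incl (evoTerm h t n A) := by
      rw [evoPartial_apply, incl_eq, map_sum]
      rfl
    rw [h2]
    exact (hasSum_nat_add_iff' N).2 (ht.hasSum A)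
  have h3 : ∀ n, ‖incl (evoTerm h t (n + N) A)‖ ≤
      2 ^ X.card * ‖A‖ * (|t| * lieRate h) ^ N * (1 / 4) ^ n := by
    intro n
    rw [norm_incl]
    refine (QuantumLattice.norm_evoTerm_le h t (n + N) hA).trans ?_
    rw [pow_add, mul_comm (_ ^ n), ← mul_assoc]
    gcongr
    exact ht
  rw [← h1.tsum_eq]
  refine (tsum_of_norm_bounded ((hasSum_geometric_of_lt_one (by norm_num)
    (by norm_num : (1 / 4 : ℝ) < 1)).mul_left _) h3).trans ?_
  have h4 : 0 ≤ 2 ^ X.card * ‖A‖ * (|t| * lieRate h) ^ N := by positivity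
  rw [show (1 - 1 / 4 : ℝ)⁻¹ = 4 / 3 by norm_num]
  linarith

theorem SmallTime.tendsto_evoPartial [NeZero d] {h : O.Obs} {t : ℝ} (ht : SmallTime h t)
    (A : O.Obs) : Tendsto (fun N => incl (evoPartial h t N A)) atTop (𝓝 (evo h t A)) := by
  have h1 := (ht.hasSum A).tendsto_sum_nat
  refine h1.congr fun N => ?_
  rw [evoPartial_apply, incl_eq, map_sum]
  rfl

theorem smallTime_zero (h : O.Obs) : SmallTime h 0 := by
  rw [SmallTime, abs_zero, zero_mul]
  norm_num

/-- A radius around the origin on which the small-time evolutions satisfy the group law. -/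
def evoRadius (h : O.Obs) : ℝ := 1 / (8 * lieRate h)

theorem evoRadius_pos (h : O.Obs) : 0 < evoRadius h := by
  have := lieRate_pos h
  rw [evoRadius]
  positivity

theorem mul_lieRate_le {h : O.Obs} {t : ℝ} (ht : |t| ≤ evoRadius h) :
    |t| * lieRate h ≤ 1 / 8 := by
  have hb := lieRate_pos h
  calc |t| * lieRate h ≤ evoRadius h * lieRate h := by gcongr
    _ = 1 / 8 := by rw [evoRadius]; field_simp

theorem smallTime_of_le {h : O.Obs} {t : ℝ} (ht : |t| ≤ evoRadius h) : SmallTime h t :=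
  (mul_lieRate_le ht).trans (by norm_num)

theorem smallTime_add {h : O.Obs} {s t : ℝ} (hs : |s| ≤ evoRadius h) (ht : |t| ≤ evoRadius h) :
    SmallTime h (s + t) := by
  have hb := lieRate_pos h
  have h1 := mul_lieRate_le hs
  have h2 := mul_lieRate_le ht
  calc |s + t| * lieRate h ≤ (|s| + |t|) * lieRate h := by gcongr; exact abs_add_le s t
    _ ≤ 1 / 4 := by linarith

/-- The evolution applied to the terms of the evolution series: the double series converges
absolutely, with sum the evolution at the added times. -/
theorem hasSum_evo_evoTerm [NeZero d] {h : O.Obs} {s t : ℝ} (hs : |s| ≤ evoRadius h)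
    (ht : |t| ≤ evoRadius h) (A : O.Obs) :
    HasSum (fun n => evo h s (evoTerm h t n A)) (evo h (s + t) A) := by
  have hb := lieRate_pos h
  obtain ⟨X, hX⟩ := O.isLocal A A.2
  let F : ℕ × ℕ → O.Quasi := fun p => incl (evoTerm h s p.2 (evoTerm h t p.1 A))
  have hbound : ∀ p, ‖F p‖ ≤ 2 ^ X.card * ‖A‖ * ((1 / 4) ^ p.1 * (1 / 4) ^ p.2) := by
    rintro ⟨n, m⟩
    change ‖evoTerm h s m (evoTerm h t n A)‖ ≤ _
    rw [evoTerm_apply h s, evoTerm_apply h t, map_smul, ← Module.End.mul_apply, ← pow_add,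
      norm_smul, norm_smul]
    have h1 : ‖(Complex.I * s) ^ m / (m.factorial : ℂ)‖ = |s| ^ m / m.factorial := by simp
    have h2 : ‖(Complex.I * t) ^ n / (n.factorial : ℂ)‖ = |t| ^ n / n.factorial := by simp
    have h3 : ((m + n).factorial : ℝ) ≤ 2 ^ (m + n) * (m.factorial * n.factorial) := by
      rw [← Nat.add_choose_mul_factorial_mul_factorial]
      push_cast
      rw [mul_assoc]
      gcongr
      exact_mod_cast Nat.choose_le_two_pow _ _
    have h4 : (0 : ℝ) < m.factorial := by exact_mod_cast m.factorial_pos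
    have h5 : (0 : ℝ) < n.factorial := by exact_mod_cast n.factorial_pos
    have h6 := mul_lieRate_le hs
    have h7 := mul_lieRate_le ht
    rw [h1, h2]
    calc _ ≤ |s| ^ m / m.factorial * (|t| ^ n / n.factorial *
          (2 ^ X.card * (2 ^ (m + n) * (m.factorial * n.factorial) * lieRate h ^ (m + n)) *
            ‖A‖)) := by
          gcongr
          refine (norm_iterate_lie_le h (m + n) hX).trans ?_
          gcongr
      _ = 2 ^ X.card * ‖A‖ * ((2 * (|t| * lieRate h)) ^ n * (2 * (|s| * lieRate h)) ^ m) := by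
          field_simp
          ring
      _ ≤ _ := by
          gcongr <;> linarith
  have hF : Summable F := by
    refine Summable.of_norm_bounded ?_ hbound
    have hg : Summable fun n : ℕ => (1 / 4 : ℝ) ^ n :=
      summable_geometric_of_lt_one (by norm_num) (by norm_num)
    exact (hg.mul_of_nonneg hg (fun _ => by positivity) fun _ => by positivity).mul_left _
  have h1 : HasSum (fun n => evo h s (evoTerm h t n A)) (∑' p, F p) :=
    hF.hasSum.prod_fiberwise fun n => (smallTime_of_le hs).hasSum (evoTerm h t n A)
  have h2 : ∑' p, F p = evo h (s + t) A := by
    rw [← (Equiv.prodComm ℕ ℕ).tsum_eq,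
      ← Finset.HasAntidiagonal.sigmaAntidiagonalEquivProd.tsum_eq]
    have h3 : Summable fun p : (Σ n : ℕ, Finset.HasAntidiagonal.antidiagonal n) =>
        F (Equiv.prodComm ℕ ℕ (Finset.HasAntidiagonal.sigmaAntidiagonalEquivProd p)) :=
      (Finset.HasAntidiagonal.sigmaAntidiagonalEquivProd.summable_iff
        (f := fun p => F (Equiv.prodComm ℕ ℕ p))).2 ((Equiv.prodComm ℕ ℕ).summable_iff.2 hF)
    rw [h3.tsum_sigma]
    refine tsum_congr fun n => ?_
    rw [tsum_fintype, evoTerm_add, incl_eq, map_sum,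
      ← Finset.sum_coe_sort (Finset.HasAntidiagonal.antidiagonal n)]
    rfl
  rwa [h2] at h1

/-- A map from the real line to a monoid that is additive near the origin extends to a
homomorphism. -/
theorem exists_hom_of_local {G : Type*} [Monoid G] {σ : ℝ → G} {r : ℝ} (hr : 0 < r)
    (h0 : σ 0 = 1) (hadd : ∀ s t, |s| ≤ r → |t| ≤ r → σ (s + t) = σ s * σ t) :
    ∃ τ : ℝ → G, τ 0 = 1 ∧ (∀ s t, τ (s + t) = τ s * τ t) ∧ ∀ t, |t| ≤ r → τ t = σ t := by
  have hpow : ∀ (n : ℕ) (u : ℝ), |n * u| ≤ r → σ (n * u) = σ u ^ n := by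
    intro n u
    induction n with
    | zero => intro _; simp [h0]
    | succ n ih =>
      intro h
      push_cast at h ⊢
      have h1 : |(n : ℝ) * u| ≤ |(n + 1 : ℝ) * u| := by
        rw [abs_mul, abs_mul]
        gcongr
        linarith
      have h2 : |u| ≤ |(n + 1 : ℝ) * u| := by
        rw [abs_mul, abs_of_nonneg (by positivity : (0 : ℝ) ≤ n + 1)]
        have := abs_nonneg u
        nlinarith [mul_nonneg (Nat.cast_nonneg (α := ℝ) n) this]
      rw [add_mul, one_mul, hadd _ _ (h1.trans h) (h2.trans h), ih (h1.trans h), pow_succ]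
  have hpow' : ∀ (n : ℕ) (t : ℝ), 0 < n → |t| ≤ r → σ t = σ (t / n) ^ n := by
    intro n t hn ht
    have h1 : (n : ℝ) * (t / n) = t := by
      have : (n : ℝ) ≠ 0 := by exact_mod_cast hn.ne'
      field_simp
    rw [← hpow n (t / n) (by rwa [h1]), h1]
  have hindep : ∀ (m n : ℕ) (t : ℝ), 0 < m → 0 < n → |t / m| ≤ r → |t / n| ≤ r →
      σ (t / m) ^ m = σ (t / n) ^ n := by
    intro m n t hm hn h1 h2
    rw [hpow' n (t / m) hn h1, hpow' m (t / n) hm h2, ← pow_mul, ← pow_mul, div_div, div_div,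
      mul_comm (m : ℝ), mul_comm m]
  have hN : ∀ t : ℝ, ∃ N : ℕ, 0 < N ∧ ∀ n : ℕ, N ≤ n → |t / n| ≤ r := by
    intro t
    refine ⟨⌈|t| / r⌉₊ + 1, Nat.succ_pos _, fun n hn => ?_⟩
    have h1 : |t| / r ≤ n := (Nat.le_ceil _).trans (by exact_mod_cast (Nat.le_succ _).trans hn)
    have h2 : (0 : ℝ) < n := by exact_mod_cast (Nat.succ_pos _).trans_le hn
    rw [abs_div, abs_of_pos h2, div_le_iff₀ h2]
    rw [div_le_iff₀ hr] at h1
    linarith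
  choose N hNpos hN using hN
  have key : ∀ (t : ℝ) (n : ℕ), 0 < n → |t / n| ≤ r → σ (t / N t) ^ N t = σ (t / n) ^ n :=
    fun t n hn h => hindep _ _ t (hNpos t) hn (hN t _ le_rfl) h
  refine ⟨fun t => σ (t / N t) ^ N t, ?_, ?_, ?_⟩
  · simp [h0]
  · intro s t
    let M := N s + N t + N (s + t)
    have hM : 0 < M := by have := hNpos s; omega
    have h1 := hN s M (by omega)
    have h2 := hN t M (by omega)
    have h3 := hN (s + t) M (by omega)
    beta_reduce
    rw [key s M hM h1, key t M hM h2, key (s + t) M hM h3, add_div, hadd _ _ h1 h2]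
    have hc : Commute (σ (s / M)) (σ (t / M)) := by
      rw [Commute, SemiconjBy, ← hadd _ _ h1 h2, ← hadd _ _ h2 h1, add_comm]
    exact hc.mul_pow M
  · intro t ht
    have := key t 1 one_pos (by simpa using ht)
    simpa using this

theorem SmallTime.norm_evo_sub_le [NeZero d] {h : O.Obs} {t : ℝ} (ht : SmallTime h t)
    {X : Finset (Site D)} {A : O.Obs} (hA : SupportedIn X (A : Op D d)) :
    ‖evo h t A - incl A‖ ≤ 2 ^ X.card * 2 * ‖A‖ * (|t| * lieRate h) := by
  have := ht.norm_evo_sub_evoPartial_le 1 hA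
  rwa [evoPartial_apply, Finset.sum_range_one, evoTerm_zero, pow_one] at this

theorem eventually_smallTime (h : O.Obs) : ∀ᶠ t in 𝓝 (0 : ℝ), |t| ≤ evoRadius h := by
  filter_upwards [Metric.closedBall_mem_nhds (0 : ℝ) (evoRadius_pos h)] with t ht
  simpa using ht

theorem tendsto_evo_zero [NeZero d] (h A : O.Obs) :
    Tendsto (fun t => evo h t A) (𝓝 0) (𝓝 (incl A)) := by
  obtain ⟨X, hX⟩ := O.isLocal A A.2
  rw [tendsto_iff_norm_sub_tendsto_zero]
  have h1 : Tendsto (fun t : ℝ => 2 ^ X.card * 2 * ‖A‖ * (|t| * lieRate h)) (𝓝 0) (𝓝 0) := by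
    have : Continuous fun t : ℝ => 2 ^ X.card * 2 * ‖A‖ * (|t| * lieRate h) := by fun_prop
    simpa using this.tendsto 0
  refine squeeze_zero' (Eventually.of_forall fun _ => norm_nonneg _) ?_ h1
  filter_upwards [eventually_smallTime h] with t ht
  exact (smallTime_of_le ht).norm_evo_sub_le hX

theorem norm_starAlgHom_sub_le (φ : O.Quasi →⋆ₐ[ℂ] O.Quasi) (a b : O.Quasi) :
    ‖φ a - φ b‖ ≤ ‖a - b‖ := by
  rw [← map_sub]
  exact NonUnitalStarAlgHom.norm_apply_le φ _

/-- Existence of the time evolution, together with a radius of convergence of the evolution series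
common to all local observables. -/
theorem exists_isTimeEvolution [NeZero d] {h : O.Obs} (hh : star h = h) :
    ∃ τ : ℝ → (O.Quasi →⋆ₐ[ℂ] O.Quasi), IsTimeEvolution h τ ∧
      ∀ t, |t| ≤ evoRadius h → ∀ A : O.Obs, τ t (incl A) = evo h t A := by
  classical
  let σ : ℝ → (O.Quasi →⋆ₐ[ℂ] O.Quasi) := fun t =>
    if ht : SmallTime h t then (ht.exists_starAlgHom hh).choose else 1
  have hσ : ∀ t, SmallTime h t → ∀ A : O.Obs, σ t (incl A) = evo h t A := by
    intro t ht A
    have h1 : σ t = (ht.exists_starAlgHom hh).choose := dif_pos ht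
    rw [h1]
    exact (ht.exists_starAlgHom hh).choose_spec A
  have h0 : σ 0 = 1 := by
    refine starAlgHom_ext fun A => ?_
    rw [hσ 0 (smallTime_zero h)]
    obtain ⟨X, hX⟩ := O.isLocal A A.2
    have h1 := (smallTime_zero h).norm_evo_sub_le hX
    rw [abs_zero, zero_mul, mul_zero] at h1
    exact sub_eq_zero.1 (norm_le_zero_iff.1 h1)
  have hadd : ∀ s t, |s| ≤ evoRadius h → |t| ≤ evoRadius h → σ (s + t) = σ s * σ t := by
    intro s t hs ht
    refine starAlgHom_ext fun A => ?_
    have h1 : (σ s * σ t) (incl A) = σ s (evo h t A) := by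
      rw [← hσ t (smallTime_of_le ht)]
      rfl
    rw [hσ _ (smallTime_add hs ht), h1]
    have h2 : HasSum (fun n => σ s (incl (evoTerm h t n A))) (σ s (evo h t A)) :=
      ((smallTime_of_le ht).hasSum A).map (σ s) (continuous_starAlgHom _)
    simp_rw [hσ s (smallTime_of_le hs)] at h2
    exact (hasSum_evo_evoTerm hs ht A).unique h2
  obtain ⟨τ, τ0, τadd, hτ⟩ := exists_hom_of_local (evoRadius_pos h) h0 hadd
  have hτ' : ∀ t, |t| ≤ evoRadius h → ∀ A : O.Obs, τ t (incl A) = evo h t A := by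
    intro t ht A
    rw [hτ t ht, hσ t (smallTime_of_le ht)]
  have hlim : ∀ a : O.Quasi, Tendsto (fun t => τ t a) (𝓝 0) (𝓝 a) := by
    intro a
    rw [Metric.tendsto_nhds]
    intro ε hε
    obtain ⟨A, hA⟩ := denseRange_incl.exists_dist_lt a (by positivity : 0 < ε / 3)
    filter_upwards [eventually_smallTime h,
      Metric.tendsto_nhds.1 (tendsto_evo_zero h A) (ε / 3) (by positivity)] with t ht hlt
    rw [← hτ' t ht] at hlt
    have h1 : dist (τ t a) (τ t (incl A)) ≤ dist a (incl A) := by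
      rw [dist_eq_norm, dist_eq_norm]
      exact norm_starAlgHom_sub_le (τ t) a (incl A)
    have h2 := dist_triangle4 (τ t a) (τ t (incl A)) (incl A) a
    rw [dist_comm (incl A) a] at h2
    linarith
  refine ⟨τ, ⟨τ0, τadd, fun a => ?_, fun A => ?_⟩, hτ'⟩
  · rw [continuous_iff_continuousAt]
    intro t₀
    have h1 : (fun t => τ t a) = fun t => τ t₀ (τ (t - t₀) a) := by
      funext t
      have h2 := τadd t₀ (t - t₀)
      rw [add_sub_cancel] at h2
      rw [h2]
      rfl
    have h3 : Tendsto (fun t : ℝ => t - t₀) (𝓝 t₀) (𝓝 0) := by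
      have : Continuous fun t : ℝ => t - t₀ := by fun_prop
      simpa using this.tendsto t₀
    have h4 : Tendsto (fun t => τ t a) (𝓝 t₀) (𝓝 (τ t₀ a)) := by
      rw [h1]
      exact ((continuous_starAlgHom (τ t₀)).tendsto a).comp ((hlim a).comp h3)
    exact h4
  · refine ⟨evoRadius h, evoRadius_pos h, fun t ht => ?_⟩
    rw [hτ' t ht.le]
    simp_rw [← incl_evoTerm]
    exact (smallTime_of_le ht.le).hasSum A

/-! ### Uniqueness of the time evolution -/

section Unique

variable {h : O.Obs} {τ τ' : ℝ → (O.Quasi →⋆ₐ[ℂ] O.Quasi)}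

theorem IsTimeEvolution.eventually_eq_evo [NeZero d] (hτ : IsTimeEvolution h τ) (A : O.Obs) :
    ∀ᶠ t in 𝓝 (0 : ℝ), τ t (incl A) = evo h t A := by
  obtain ⟨r, hr, hsum⟩ := hτ.series A
  filter_upwards [eventually_smallTime h, Metric.ball_mem_nhds (0 : ℝ) hr] with t ht ht'
  have h1 := hsum t (by simpa using ht')
  simp_rw [← incl_evoTerm] at h1
  exact h1.unique ((smallTime_of_le ht).hasSum A)

theorem IsTimeEvolution.hasDerivAt_zero [NeZero d] (hτ : IsTimeEvolution h τ) (A : O.Obs) :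
    HasDerivAt (fun t => τ t (incl A)) (Complex.I • incl (lieₗ h A)) 0 := by
  obtain ⟨X, hX⟩ := O.isLocal A A.2
  rw [hasDerivAt_iff_isLittleO_nhds_zero]
  have hbig : (fun t : ℝ => τ (0 + t) (incl A) - τ 0 (incl A) - t • Complex.I • incl (lieₗ h A))
      =O[𝓝 0] fun t : ℝ => t ^ 2 := by
    refine Asymptotics.IsBigO.of_bound (2 ^ X.card * 2 * ‖A‖ * lieRate h ^ 2) ?_
    filter_upwards [hτ.eventually_eq_evo A, eventually_smallTime h] with t ht hs
    have h1 := (smallTime_of_le hs).norm_evo_sub_evoPartial_le 2 hX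
    have h2 : incl (evoPartial h t 2 A) = incl A + t • Complex.I • incl (lieₗ h A) := by
      have h3 : evoPartial h t 2 A = A + ((t : ℂ) * Complex.I) • lieₗ h A := by
        rw [evoPartial_apply, Finset.sum_range_succ, Finset.sum_range_one, evoTerm_zero,
          evoTerm_apply]
        simp [mul_comm]
      rw [h3, incl_eq, map_add, map_smul, ← Complex.coe_smul t, smul_smul]
      rfl
    rw [zero_add, ht, hτ.zero, StarAlgHom.coe_id, id_eq, sub_sub, ← h2]
    refine h1.trans (le_of_eq ?_)
    rw [Real.norm_eq_abs, abs_pow]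
    ring
  refine hbig.trans_isLittleO ?_
  simpa using Asymptotics.isLittleO_pow_id (𝕜 := ℝ) (n := 2) (by norm_num)

theorem IsTimeEvolution.hasDerivAt [NeZero d] (hτ : IsTimeEvolution h τ) (A : O.Obs) (t : ℝ) :
    HasDerivAt (fun t => τ t (incl A)) (Complex.I • τ t (incl (lieₗ h A))) t := by
  have h1 := hτ.hasDerivAt_zero A
  let T : O.Quasi →L[ℂ] O.Quasi := ⟨(τ t).toAlgHom.toLinearMap, continuous_starAlgHom (τ t)⟩
  have h2 : HasDerivAt (fun s => T (τ s (incl A))) (T (Complex.I • incl (lieₗ h A))) 0 :=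
    (T.restrictScalars ℝ).hasFDerivAt.comp_hasDerivAt (0 : ℝ) h1
  have h3 : T (Complex.I • incl (lieₗ h A)) = Complex.I • τ t (incl (lieₗ h A)) :=
    map_smul T _ _
  rw [h3] at h2
  have h4 : (fun s => τ s (incl A)) = fun s => T (τ (s - t) (incl A)) := by
    funext s
    have h5 := hτ.add t (s - t)
    rw [add_sub_cancel] at h5
    rw [h5]
    rfl
  rw [h4]
  have h6 : HasDerivAt (fun s => T (τ s (incl A))) (Complex.I • τ t (incl (lieₗ h A)))
      (t - t) := by rwa [sub_self]
  exact h6.comp_sub_const t t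

/-- Two time evolutions differ at time `t` by at most the `n`-th order Taylor remainder. -/
theorem IsTimeEvolution.norm_sub_le [NeZero d] (hτ : IsTimeEvolution h τ)
    (hτ' : IsTimeEvolution h τ') (n : ℕ) :
    ∀ (A : O.Obs) (t : ℝ), 0 ≤ t →
      ‖τ t (incl A) - τ' t (incl A)‖ ≤ 2 * ‖(lieₗ h ^ n) A‖ * (t ^ n / n.factorial) := by
  induction n with
  | zero =>
    intro A t _
    have h1 : ‖τ t (incl A)‖ ≤ ‖A‖ := NonUnitalStarAlgHom.norm_apply_le (τ t) (incl A)
    have h2 : ‖τ' t (incl A)‖ ≤ ‖A‖ := NonUnitalStarAlgHom.norm_apply_le (τ' t) (incl A)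
    refine (_root_.norm_sub_le _ _).trans ?_
    simp only [pow_zero, Module.End.one_apply, Nat.factorial_zero, Nat.cast_one, div_one, mul_one]
    linarith
  | succ n ih =>
    intro A t ht
    have hder : ∀ s, HasDerivAt (fun t => τ t (incl A) - τ' t (incl A))
        (Complex.I • τ s (incl (lieₗ h A)) - Complex.I • τ' s (incl (lieₗ h A))) s :=
      fun s => (hτ.hasDerivAt A s).sub (hτ'.hasDerivAt A s)
    have hB : ∀ s : ℝ, HasDerivAt
        (fun s => 2 * ‖(lieₗ h ^ (n + 1)) A‖ * (s ^ (n + 1) / (n + 1).factorial))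
        (2 * ‖(lieₗ h ^ n) (lieₗ h A)‖ * (s ^ n / n.factorial)) s := by
      intro s
      have h1 := ((hasDerivAt_pow (n + 1) s).div_const ((n + 1).factorial : ℝ)).const_mul
        (2 * ‖(lieₗ h ^ (n + 1)) A‖)
      refine h1.congr_deriv ?_
      rw [pow_succ (lieₗ h), Module.End.mul_apply, Nat.factorial_succ]
      push_cast
      have h2 : (n.factorial : ℝ) ≠ 0 := by exact_mod_cast n.factorial_ne_zero
      have h3 : (n : ℝ) + 1 ≠ 0 := by positivity
      field_simp
    have h0 : ‖τ 0 (incl A) - τ' 0 (incl A)‖ ≤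
        2 * ‖(lieₗ h ^ (n + 1)) A‖ * ((0 : ℝ) ^ (n + 1) / (n + 1).factorial) := by
      rw [hτ.zero, hτ'.zero, sub_self, norm_zero]
      positivity
    refine image_norm_le_of_norm_deriv_right_le_deriv_boundary (a := 0) (b := t)
      (f := fun t => τ t (incl A) - τ' t (incl A))
      (f' := fun s => Complex.I • τ s (incl (lieₗ h A)) - Complex.I • τ' s (incl (lieₗ h A)))
      (fun s _ => (hder s).continuousAt.continuousWithinAt)
      (fun s _ => (hder s).hasDerivWithinAt) h0 hB ?_ ⟨ht, le_rfl⟩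
    intro s hs
    rw [← smul_sub, norm_smul, Complex.norm_I, one_mul]
    exact ih (lieₗ h A) s hs.1

theorem IsTimeEvolution.eq_of_small [NeZero d] (hτ : IsTimeEvolution h τ)
    (hτ' : IsTimeEvolution h τ') {t : ℝ} (h0 : 0 ≤ t) (ht : SmallTime h t) : τ t = τ' t := by
  refine starAlgHom_ext fun A => ?_
  obtain ⟨X, hX⟩ := O.isLocal A A.2
  have hb := lieRate_pos h
  have h1 : ∀ n : ℕ, ‖τ t (incl A) - τ' t (incl A)‖ ≤ 2 * (2 ^ X.card * ‖A‖) * (1 / 4) ^ n := by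
    intro n
    refine (hτ.norm_sub_le hτ' n A t h0).trans ?_
    have h2 : (0 : ℝ) < n.factorial := by exact_mod_cast n.factorial_pos
    calc _ ≤ 2 * (2 ^ X.card * (n.factorial * lieRate h ^ n) * ‖A‖) * (t ^ n / n.factorial) := by
          gcongr
          exact norm_iterate_lie_le h n hX
      _ = 2 * (2 ^ X.card * ‖A‖) * (|t| * lieRate h) ^ n := by
          rw [abs_of_nonneg h0, mul_pow]
          field_simp
      _ ≤ _ := by
          gcongr
          exact ht
  have h2 : Tendsto (fun n : ℕ => 2 * (2 ^ X.card * ‖A‖) * (1 / 4 : ℝ) ^ n) atTop (𝓝 0) := by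
    simpa using (tendsto_pow_atTop_nhds_zero_of_lt_one (by norm_num : (0 : ℝ) ≤ 1 / 4)
      (by norm_num)).const_mul (2 * (2 ^ X.card * ‖A‖))
  have h3 := ge_of_tendsto' h2 h1
  exact sub_eq_zero.1 (norm_le_zero_iff.1 h3)

theorem IsTimeEvolution.mul_eq_pow (hτ : IsTimeEvolution h τ) (n : ℕ) (u : ℝ) :
    τ (n * u) = τ u ^ n := by
  induction n with
  | zero =>
    rw [Nat.cast_zero, zero_mul, hτ.zero, pow_zero]
    rfl
  | succ n ih =>
    rw [Nat.cast_succ, add_mul, one_mul, hτ.add, ih, pow_succ]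
    rfl

/-- Every time is a multiple of an arbitrarily small one. -/
theorem exists_eq_nat_mul {r : ℝ} (hr : 0 < r) (t : ℝ) : ∃ (n : ℕ) (u : ℝ), |u| ≤ r ∧ t = n * u := by
  have h2 : (0 : ℝ) < (⌈|t| / r⌉₊ + 1 : ℕ) := by positivity
  refine ⟨⌈|t| / r⌉₊ + 1, t / (⌈|t| / r⌉₊ + 1 : ℕ), ?_, by field_simp⟩
  have h1 : |t| / r ≤ (⌈|t| / r⌉₊ + 1 : ℕ) :=
    (Nat.le_ceil _).trans (by exact_mod_cast Nat.le_succ _)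
  rw [abs_div, abs_of_pos h2, div_le_iff₀ h2]
  rw [div_le_iff₀ hr] at h1
  linarith

theorem IsTimeEvolution.unique [NeZero d] (hτ : IsTimeEvolution h τ)
    (hτ' : IsTimeEvolution h τ') : τ = τ' := by
  have hsmall : ∀ u : ℝ, |u| ≤ evoRadius h → τ u = τ' u := by
    intro u hu
    rcases le_total 0 u with h0 | h0
    · exact hτ.eq_of_small hτ' h0 (smallTime_of_le hu)
    · -- the inverses `τ (-u)` and `τ' (-u)` agree
      have h1 : τ (-u) = τ' (-u) :=
        hτ.eq_of_small hτ' (by linarith) (smallTime_of_le (by rwa [abs_neg]))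
      have h2 : τ u * τ (-u) = 1 := by
        have := hτ.add u (-u)
        rw [add_neg_cancel, hτ.zero] at this
        exact this.symm
      have h3 : τ' (-u) * τ' u = 1 := by
        have := hτ'.add (-u) u
        rw [neg_add_cancel, hτ'.zero] at this
        exact this.symm
      rw [h1] at h2
      exact left_inv_eq_right_inv h2 h3
  funext t
  obtain ⟨n, u, hu, rfl⟩ := exists_eq_nat_mul (evoRadius_pos h) t
  rw [hτ.mul_eq_pow, hτ'.mul_eq_pow, hsmall u hu]

theorem IsTimeEvolution.apply_incl [NeZero d] (hh : star h = h) (hτ : IsTimeEvolution h τ) {t : ℝ}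
    (ht : |t| ≤ evoRadius h) (A : O.Obs) : τ t (incl A) = evo h t A := by
  obtain ⟨τ', hτ', hevo⟩ := exists_isTimeEvolution (O := O) hh
  rw [hτ.unique hτ', hevo t ht]

end Unique

/-! ### States -/

/-- In a `C⋆`-algebra, `‖a‖² - a⋆ a` is a positive element. -/
theorem exists_star_mul_self_eq {A : Type*} [CStarAlgebra A] (a : A) :
    ∃ b : A, star b * b = ((‖a‖ ^ 2 : ℝ) : ℂ) • (1 : A) - star a * a := by
  let _ : PartialOrder A := CStarAlgebra.spectralOrder A
  have : StarOrderedRing A := CStarAlgebra.spectralOrderedRing A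
  have h1 : star a * a ≤ algebraMap ℝ A ‖star a * a‖ :=
    IsSelfAdjoint.le_algebraMap_norm_self (IsSelfAdjoint.star_mul_self a)
  obtain ⟨b, hb⟩ := CStarAlgebra.nonneg_iff_eq_star_mul_self.1 (sub_nonneg.2 h1)
  refine ⟨b, hb.symm.trans ?_⟩
  rw [CStarRing.norm_star_mul_self, Algebra.algebraMap_eq_smul_one, Complex.coe_smul, sq]

namespace State

variable (ω : State O)

theorem re_nonneg (a : O.Quasi) : 0 ≤ (ω.toLinearMap (star a * a)).re := by
  have h := ω.nonneg a
  rw [Complex.le_def] at h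
  simpa using h.1

theorem im_eq_zero (a : O.Quasi) : (ω.toLinearMap (star a * a)).im = 0 := by
  have h := ω.nonneg a
  rw [Complex.le_def] at h
  simpa using h.2.symm

theorem expand (a : O.Quasi) (c : ℂ) :
    ω.toLinearMap (star (a + c • 1) * (a + c • 1)) =
      ω.toLinearMap (star a * a) + c * ω.toLinearMap (star a) +
        starRingEnd ℂ c * ω.toLinearMap a + starRingEnd ℂ c * c := by
  have h1 : star (a + c • 1) * (a + c • 1) =
      star a * a + c • star a + starRingEnd ℂ c • a + (starRingEnd ℂ c * c) • (1 : O.Quasi) := by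
    rw [star_add, star_smul, star_one, add_mul, mul_add, mul_add, mul_smul_comm, mul_one,
      smul_mul_assoc, one_mul, smul_mul_smul_comm, one_mul, ← add_assoc]
    rfl
  rw [h1, map_add, map_add, map_add, map_smul, map_smul, map_smul, ω.map_one, smul_eq_mul,
    smul_eq_mul, smul_eq_mul, mul_one]

theorem apply_star (a : O.Quasi) : ω.toLinearMap (star a) = starRingEnd ℂ (ω.toLinearMap a) := by
  have h0 := ω.im_eq_zero a
  have h1 := ω.im_eq_zero (a + (1 : ℂ) • 1)
  have h2 := ω.im_eq_zero (a + Complex.I • 1)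
  rw [ω.expand] at h1 h2
  simp only [Complex.add_im, Complex.mul_im, Complex.conj_re, Complex.conj_im, Complex.one_re,
    Complex.one_im, Complex.I_re, Complex.I_im, h0] at h1 h2
  apply Complex.ext
  · rw [Complex.conj_re]; linarith
  · rw [Complex.conj_im]; linarith

theorem norm_sq_apply_le (a : O.Quasi) :
    ‖ω.toLinearMap a‖ ^ 2 ≤ (ω.toLinearMap (star a * a)).re := by
  have h1 := ω.re_nonneg (a + (-ω.toLinearMap a) • 1)
  rw [ω.expand, ω.apply_star] at h1
  simp only [Complex.add_re, Complex.mul_re, Complex.conj_re, Complex.conj_im, Complex.neg_re,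
    Complex.neg_im, map_neg] at h1
  rw [Complex.sq_norm, Complex.normSq_apply]
  linarith

theorem apply_star_mul_self_le (a : O.Quasi) : (ω.toLinearMap (star a * a)).re ≤ ‖a‖ ^ 2 := by
  obtain ⟨b, hb⟩ := exists_star_mul_self_eq a
  have h1 := ω.re_nonneg b
  have h2 : ω.toLinearMap (star b * b) =
      ((‖a‖ ^ 2 : ℝ) : ℂ) - ω.toLinearMap (star a * a) := by
    have h3 := congrArg ω.toLinearMap hb
    rw [map_sub, map_smul, ω.map_one, smul_eq_mul, mul_one] at h3
    exact h3
  rw [h2, Complex.sub_re, Complex.ofReal_re] at h1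
  linarith

theorem norm_apply_le (a : O.Quasi) : ‖ω.toLinearMap a‖ ≤ ‖a‖ :=
  le_of_sq_le_sq ((ω.norm_sq_apply_le a).trans (ω.apply_star_mul_self_le a)) (norm_nonneg a)

theorem continuous : Continuous ω.toLinearMap :=
  AddMonoidHomClass.continuous_of_bound ω.toLinearMap 1 fun a => by
    simpa only [one_mul] using ω.norm_apply_le a

/-- A state on local observables, as a linear functional. -/
def evₗ : O.Obs →ₗ[ℂ] ℂ := ω.toLinearMap ∘ₗ inclₐ.toAlgHom.toLinearMap

theorem ev_eq (A : O.Obs) : ω.ev A = ω.evₗ A := rfl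

theorem ev_one : ω.ev (1 : O.Obs) = 1 := ω.map_one

theorem ev_add (A B : O.Obs) : ω.ev (A + B) = ω.ev A + ω.ev B := map_add ω.evₗ A B

theorem ev_sub (A B : O.Obs) : ω.ev (A - B) = ω.ev A - ω.ev B := map_sub ω.evₗ A B

theorem ev_smul (c : ℂ) (A : O.Obs) : ω.ev (c • A) = c * ω.ev A := map_smul ω.evₗ c A

theorem ev_sum {ι : Type*} (s : Finset ι) (A : ι → O.Obs) :
    ω.ev (∑ i ∈ s, A i) = ∑ i ∈ s, ω.ev (A i) := map_sum ω.evₗ A s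

theorem ev_star (A : O.Obs) : ω.ev (star A) = starRingEnd ℂ (ω.ev A) := ω.apply_star (incl A)

theorem norm_ev_le (A : O.Obs) : ‖ω.ev A‖ ≤ ‖A‖ := ω.norm_apply_le (incl A)

theorem ev_star_mul_self_nonneg (A : O.Obs) : 0 ≤ (ω.ev (star A * A)).re := ω.re_nonneg (incl A)

end State

/-! ### Clustering and susceptibilities -/

/-- The decay `n ↦ max(1, n)^(-p)`. -/
def decay (p : ℝ) (n : ℕ) : ℝ := (max 1 (n : ℝ)) ^ (-p)

theorem decay_pos (p : ℝ) (n : ℕ) : 0 < decay p n :=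
  Real.rpow_pos_of_pos (lt_max_of_lt_left one_pos) _

theorem decay_zero (p : ℝ) : decay p 0 = 1 := by simp [decay]

theorem decay_of_pos (p : ℝ) {n : ℕ} (hn : 0 < n) : decay p n = (n : ℝ) ^ (-p) := by
  rw [decay, max_eq_right]
  exact_mod_cast hn

theorem summable_decay {p : ℝ} (hp : (D : ℝ) < p) :
    Summable fun z : Site D => decay p (latticeDist z 0) := by
  let L : Submodule ℤ (Fin D → ℝ) := Submodule.span ℤ (Set.range (Pi.basisFun ℝ (Fin D)))
  have hmem : ∀ z : Site D, (fun i => (z i : ℝ)) ∈ L := by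
    intro z
    have h1 : (fun i => (z i : ℝ)) = ∑ i, z i • Pi.basisFun ℝ (Fin D) i := by
      funext j
      simp [Finset.sum_apply, Pi.single_apply]
    rw [h1]
    exact Submodule.sum_mem _ fun i _ =>
      Submodule.smul_mem _ _ (Submodule.subset_span (Set.mem_range_self i))
  have hfin : Module.finrank ℤ L = D := by
    rw [ZLattice.rank ℝ L]
    simp
  have hsum : Summable fun z : L => ‖z‖ ^ (-p) :=
    ZLattice.summable_norm_rpow L (-p) (by rw [hfin]; linarith)
  let j : Site D → L := fun z => ⟨fun i => (z i : ℝ), hmem z⟩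
  have hj : Function.Injective j := by
    intro z w h
    funext i
    have h1 : (z i : ℝ) = (w i : ℝ) := congrFun (congrArg Subtype.val h) i
    exact_mod_cast h1
  have h2 : Summable fun z : Site D => ‖j z‖ ^ (-p) := hsum.comp_injective hj
  have h3 : Summable fun z : Site D => if z = 0 then (1 : ℝ) else 0 :=
    summable_of_hasFiniteSupport ((Set.finite_singleton (0 : Site D)).subset fun z hz => by
      by_contra h
      exact hz (if_neg h))
  refine Summable.of_nonneg_of_le (fun z => (decay_pos _ _).le) (fun z => ?_) (h2.add h3)
  by_cases hz : z = 0
  · rw [hz, latticeDist_self, decay_zero, if_pos rfl]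
    have : 0 ≤ ‖j 0‖ ^ (-p) := Real.rpow_nonneg (norm_nonneg _) _
    linarith
  · rw [if_neg hz, add_zero]
    have h4 : 0 < ‖j z‖ := by
      rw [norm_pos_iff]
      intro h
      refine hz (hj (h.trans ?_))
      apply Subtype.ext
      funext i
      simp [j]
    have h5 : ‖j z‖ ≤ latticeDist z 0 := by
      change ‖(fun i => (z i : ℝ))‖ ≤ _
      rw [pi_norm_le_iff_of_nonneg (by positivity)]
      intro i
      have h6 := natAbs_le_latticeDist z i
      rw [Real.norm_eq_abs, ← Int.cast_abs, Int.abs_eq_natAbs]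
      exact_mod_cast h6
    have hp0 : 0 ≤ p := (Nat.cast_nonneg D).trans hp.le
    exact Real.rpow_le_rpow_of_nonpos h4 (h5.trans (le_max_right _ _)) (by linarith)

/-- The connected correlation `ω(A B) - ω(A) ω(B)`. -/
def cov (ω : State O) (A B : O.Obs) : ℂ := ω.ev (A * B) - ω.ev A * ω.ev B

theorem norm_cov_le (ω : State O) (A B : O.Obs) : ‖cov ω A B‖ ≤ 2 * ‖A‖ * ‖B‖ := by
  have h1 : ‖ω.ev (A * B)‖ ≤ ‖A‖ * ‖B‖ := (ω.norm_ev_le _).trans (norm_mul_le _ _)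
  have h2 : ‖ω.ev A * ω.ev B‖ ≤ ‖A‖ * ‖B‖ := by
    rw [norm_mul]
    exact mul_le_mul (ω.norm_ev_le _) (ω.norm_ev_le _) (norm_nonneg _) (norm_nonneg _)
  refine (norm_sub_le _ _).trans ?_
  linarith

theorem cov_smul_left (ω : State O) (c : ℂ) (A B : O.Obs) :
    cov ω (c • A) B = c * cov ω A B := by
  rw [cov, cov, smul_mul_assoc, ω.ev_smul, ω.ev_smul]
  ring

theorem cov_smul_right (ω : State O) (c : ℂ) (A B : O.Obs) :
    cov ω A (c • B) = c * cov ω A B := by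
  rw [cov, cov, mul_smul_comm, ω.ev_smul, ω.ev_smul]
  ring

theorem cov_star (ω : State O) (A B : O.Obs) :
    starRingEnd ℂ (cov ω A B) = cov ω (star B) (star A) := by
  rw [cov, cov, ← star_mul, ω.ev_star, ω.ev_star, ω.ev_star, map_sub, map_mul]
  ring

theorem cov_one_left (ω : State O) (c : ℂ) (B : O.Obs) : cov ω (c • 1) B = 0 := by
  rw [cov_smul_left, cov, one_mul, ω.ev_one, one_mul, sub_self, mul_zero]

theorem cov_one_right (ω : State O) (c : ℂ) (A : O.Obs) : cov ω A (c • 1) = 0 := by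
  rw [cov_smul_right, cov, mul_one, ω.ev_one, mul_one, sub_self, mul_zero]

theorem eq_smul_one_of_supp_eq_empty [NeZero d] {A : O.Obs} (hA : supp A = ∅) :
    ∃ c : ℂ, A = c • 1 := by
  have h1 := supportedIn_suppF A
  have h2 : suppF A = ∅ := by
    ext x
    simp [hA]
  rw [h2] at h1
  obtain ⟨c, hc⟩ := h1.eq_smul_one
  exact ⟨c, Subtype.ext hc⟩

/-- The distance of the supports is attained, unless one of the observables is a multiple of the
identity. -/
theorem obsDist_cases [NeZero d] (A B : O.Obs) :
    (∃ c : ℂ, A = c • 1) ∨ (∃ c : ℂ, B = c • 1) ∨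
      ∃ u ∈ suppF A, ∃ v ∈ suppF B, obsDist A B = latticeDist u v ∧
        ∀ u' ∈ suppF A, ∀ v' ∈ suppF B, latticeDist u v ≤ latticeDist u' v' := by
  rcases (suppF A).eq_empty_or_nonempty with hA | hA
  · left
    refine eq_smul_one_of_supp_eq_empty (Set.eq_empty_iff_forall_notMem.2 fun x hx => ?_)
    have := mem_suppF.2 hx
    simp [hA] at this
  rcases (suppF B).eq_empty_or_nonempty with hB | hB
  · right; left
    refine eq_smul_one_of_supp_eq_empty (Set.eq_empty_iff_forall_notMem.2 fun x hx => ?_)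
    have := mem_suppF.2 hx
    simp [hB] at this
  right; right
  obtain ⟨⟨u, v⟩, huv, hmin⟩ := Finset.exists_min_image (suppF A ×ˢ suppF B)
    (fun q => latticeDist q.1 q.2) (hA.product hB)
  rw [Finset.mem_product] at huv
  have hmin' : ∀ u' ∈ suppF A, ∀ v' ∈ suppF B, latticeDist u v ≤ latticeDist u' v' :=
    fun u' hu' v' hv' => hmin (u', v') (Finset.mem_product.2 ⟨hu', hv'⟩)
  refine ⟨u, huv.1, v, huv.2, le_antisymm ?_ ?_, hmin'⟩
  · exact (iInf₂_le u (mem_suppF.1 huv.1)).trans (iInf₂_le v (mem_suppF.1 huv.2))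
  · refine le_iInf₂ fun u' hu' => le_iInf₂ fun v' hv' => ?_
    exact_mod_cast hmin' u' (mem_suppF.2 hu') v' (mem_suppF.2 hv')

/-- A form of the clustering bound that refers to arbitrary finite sets containing the supports and
to sums over pairs of sites instead of minimal distances. -/
def CovBound (ω : State O) (p : ℝ) (C : ℕ → ℝ) : Prop :=
  ∀ (l : ℕ) (X Y : Finset (Site D)) (A B : O.Obs), X.card ≤ l → Y.card ≤ l →
    SupportedIn X (A : Op D d) → SupportedIn Y (B : Op D d) →
    ‖cov ω A B‖ ≤ C l * ‖A‖ * ‖B‖ * ∑ u ∈ X, ∑ v ∈ Y, decay p (latticeDist u v)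

theorem ClusteringBound.covBound [NeZero d] {ω : State O} {ν f : ℕ → ℝ} {p : ℝ}
    (h : ClusteringBound ω ν f) (hf : AlgebraicDecay p f) (hν : ∀ l, 0 ≤ ν l) :
    CovBound ω p fun l => ν (l + 1) + 2 := by
  intro l X Y A B hX hY hA hB
  have hnn : 0 ≤ ∑ u ∈ X, ∑ v ∈ Y, decay p (latticeDist u v) :=
    Finset.sum_nonneg fun u _ => Finset.sum_nonneg fun v _ => (decay_pos _ _).le
  have hrhs : 0 ≤ (ν (l + 1) + 2) * ‖A‖ * ‖B‖ * ∑ u ∈ X, ∑ v ∈ Y, decay p (latticeDist u v) := by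
    have := hν (l + 1)
    positivity
  rcases obsDist_cases A B with ⟨c, rfl⟩ | ⟨c, rfl⟩ | ⟨u, hu, v, hv, huv, -⟩
  · rwa [cov_one_left, norm_zero]
  · rwa [cov_one_right, norm_zero]
  have hle : decay p (latticeDist u v) ≤ ∑ u ∈ X, ∑ v ∈ Y, decay p (latticeDist u v) := by
    calc decay p (latticeDist u v) ≤ ∑ v ∈ Y, decay p (latticeDist u v) :=
          Finset.single_le_sum (f := fun v => decay p (latticeDist u v))
            (fun _ _ => (decay_pos _ _).le) (suppF_subset hB hv)
      _ ≤ _ := Finset.single_le_sum (f := fun u => ∑ v ∈ Y, decay p (latticeDist u v))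
            (fun _ _ => Finset.sum_nonneg fun _ _ => (decay_pos _ _).le) (suppF_subset hA hu)
  refine le_trans ?_ (mul_le_mul_of_nonneg_left hle (by
    have := hν (l + 1)
    positivity))
  have hν' := hν (l + 1)
  rcases Nat.eq_zero_or_pos (latticeDist u v) with h0 | h0
  · rw [h0, decay_zero, mul_one]
    refine (norm_cov_le ω A B).trans ?_
    gcongr
    linarith
  · have hsA : size A < l + 1 := by
      rw [size_eq]
      have := Finset.card_le_card (suppF_subset hA)
      omega
    have hsB : size B < l + 1 := by
      rw [size_eq]
      have := Finset.card_le_card (suppF_subset hB)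
      omega
    have h1 := h (l + 1) A B hsA hsB _ huv
    have h2 := hf.2 _ h0
    rw [← decay_of_pos p h0] at h2
    calc ‖cov ω A B‖ ≤ ν (l + 1) * ‖A‖ * ‖B‖ * f (latticeDist u v) := h1
      _ ≤ (ν (l + 1) + 2) * ‖A‖ * ‖B‖ * decay p (latticeDist u v) := by
        have := (hf.1 (latticeDist u v)).le
        gcongr
        linarith

theorem IsClustering.exists_covBound [NeZero d] {ω : State O} (h : IsClustering ω) :
    ∃ p : ℝ, (D : ℝ) < p ∧ ∃ C : ℕ → ℝ, (∀ l, 0 ≤ C l) ∧ CovBound ω p C := by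
  obtain ⟨-, p, hp, ν, f, hν, hf, hb⟩ := h
  refine ⟨p, hp, _, fun l => ?_, hb.covBound hf fun l => (hν l).le⟩
  have := hν (l + 1)
  linarith

/-- The weights that dominate the terms of the susceptibility of observables supported in `X` and
`Y`. -/
def pairWeight (p : ℝ) (X Y : Finset (Site D)) (x : Site D) : ℝ :=
  ∑ u ∈ X, ∑ v ∈ Y, decay p (latticeDist (u + x) v)

theorem pairWeight_nonneg (p : ℝ) (X Y : Finset (Site D)) (x : Site D) : 0 ≤ pairWeight p X Y x :=
  Finset.sum_nonneg fun _ _ => Finset.sum_nonneg fun _ _ => (decay_pos _ _).le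

theorem hasSum_pairWeight {p : ℝ} (hp : (D : ℝ) < p) (X Y : Finset (Site D)) :
    HasSum (pairWeight p X Y)
      (X.card * (Y.card * ∑' z : Site D, decay p (latticeDist z 0))) := by
  have h1 : ∀ u v : Site D, HasSum (fun x => decay p (latticeDist (u + x) v))
      (∑' z : Site D, decay p (latticeDist z 0)) := by
    intro u v
    have h2 : (fun x => decay p (latticeDist (u + x) v)) =
        (fun z => decay p (latticeDist z 0)) ∘ Equiv.addRight (u - v) := by
      funext x
      rw [Function.comp_apply, latticeDist_eq_sub (u + x), Equiv.coe_addRight,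
        show u + x - v = x + (u - v) by abel]
    rw [h2]
    exact (Equiv.addRight (u - v)).hasSum_iff.2 (summable_decay hp).hasSum
  have h3 := hasSum_sum (s := X) fun u _ => hasSum_sum (s := Y) fun v _ => h1 u v
  simp only [Finset.sum_const, nsmul_eq_mul] at h3
  exact h3

/-- The terms of the series that defines the susceptibility. -/
def suscTerm (ω : State O) (A B : O.Obs) (x : Site D) : ℂ :=
  ω.ev (star (shift x A) * B) - ω.ev (star A) * ω.ev B

theorem susc_eq (ω : State O) (A B : O.Obs) : susc ω A B = ∑' x, suscTerm ω A B x := rfl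

section TranslationInvariant

variable {ω : State O} (hinv : IsTranslationInvariant ω)

include hinv

theorem suscTerm_eq_cov (A B : O.Obs) (x : Site D) :
    suscTerm ω A B x = cov ω (star (shift x A)) B := by
  rw [suscTerm, cov, ω.ev_star, ω.ev_star, hinv]

theorem norm_suscTerm_le {p : ℝ} {C : ℕ → ℝ} (hC : CovBound ω p C) {l : ℕ}
    {X Y : Finset (Site D)} {A B : O.Obs} (hX : X.card ≤ l) (hY : Y.card ≤ l)
    (hA : SupportedIn X (A : Op D d)) (hB : SupportedIn Y (B : Op D d)) (x : Site D) :
    ‖suscTerm ω A B x‖ ≤ C l * ‖A‖ * ‖B‖ * pairWeight p X Y x := by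
  rw [suscTerm_eq_cov hinv]
  have h1 := hC l (X.map (addRightEmbedding x)) Y (star (shift x A)) B
    (by rwa [Finset.card_map]) hY (supportedIn_shift x hA).star hB
  have h2 : ‖star (shift x A)‖ = ‖A‖ := by
    have h3 : ‖star (shift x A)‖ = ‖shift x A‖ := norm_star (shift x A : Op D d)
    rw [h3, norm_shift]
  rw [h2, Finset.sum_map] at h1
  exact h1

theorem summable_suscTerm {p : ℝ} {C : ℕ → ℝ} (hp : (D : ℝ) < p) (hC : CovBound ω p C)
    (A B : O.Obs) : Summable fun x => ‖suscTerm ω A B x‖ := by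
  obtain ⟨X, hX⟩ := O.isLocal A A.2
  obtain ⟨Y, hY⟩ := O.isLocal B B.2
  exact Summable.of_nonneg_of_le (fun _ => norm_nonneg _)
    (norm_suscTerm_le hinv hC (le_max_left _ _) (le_max_right _ _) hX hY)
    ((hasSum_pairWeight hp X Y).summable.mul_left _)

theorem norm_susc_le {p : ℝ} {C : ℕ → ℝ} (hp : (D : ℝ) < p) (hC : CovBound ω p C) {l : ℕ}
    {X Y : Finset (Site D)} {A B : O.Obs} (hX : X.card ≤ l) (hY : Y.card ≤ l)
    (hA : SupportedIn X (A : Op D d)) (hB : SupportedIn Y (B : Op D d)) :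
    ‖susc ω A B‖ ≤ C l * ‖A‖ * ‖B‖ *
      (X.card * (Y.card * ∑' z : Site D, decay p (latticeDist z 0))) :=
  tsum_of_norm_bounded ((hasSum_pairWeight hp X Y).mul_left _)
    (norm_suscTerm_le hinv hC hX hY hA hB)

theorem ev_star_shift_mul_shift (x y : Site D) (A B : O.Obs) :
    ω.ev (star (shift x A) * shift y B) = ω.ev (star (shift (x - y) A) * B) := by
  have h1 : star (shift x A) * shift y B = shift y (star (shift (x - y) A) * B) := by
    rw [shift_mul, shift_star, shift_shift, add_sub_cancel]
  rw [h1, hinv]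

theorem suscTerm_shift_right (A B : O.Obs) (x y : Site D) :
    suscTerm ω A (shift y B) x = suscTerm ω A B (x - y) := by
  rw [suscTerm, suscTerm, ev_star_shift_mul_shift hinv, hinv]

theorem suscTerm_conj (A B : O.Obs) (x : Site D) :
    starRingEnd ℂ (suscTerm ω B A x) = suscTerm ω A B (-x) := by
  rw [suscTerm_eq_cov hinv, cov_star, star_star, cov, suscTerm, hinv x B]
  have h1 : star A * shift x B = star (shift 0 A) * shift x B := by rw [shift_zero_site]
  rw [h1, ev_star_shift_mul_shift hinv, zero_sub]

theorem susc_conj (A B : O.Obs) : starRingEnd ℂ (susc ω B A) = susc ω A B := by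
  rw [susc_eq, susc_eq, Complex.conj_tsum, ← (Equiv.neg (Site D)).tsum_eq]
  refine tsum_congr fun x => ?_
  rw [suscTerm_conj hinv, Equiv.neg_apply, neg_neg]

end TranslationInvariant

theorem suscTerm_add_left (ω : State O) (A A' B : O.Obs) (x : Site D) :
    suscTerm ω (A + A') B x = suscTerm ω A B x + suscTerm ω A' B x := by
  simp only [suscTerm, shift_add, star_add, add_mul, ω.ev_add]
  ring

theorem suscTerm_add_right (ω : State O) (A B B' : O.Obs) (x : Site D) :
    suscTerm ω A (B + B') x = suscTerm ω A B x + suscTerm ω A B' x := by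
  simp only [suscTerm, mul_add, ω.ev_add]
  ring

theorem suscTerm_smul_left (ω : State O) (c : ℂ) (A B : O.Obs) (x : Site D) :
    suscTerm ω (c • A) B x = starRingEnd ℂ c * suscTerm ω A B x := by
  simp only [suscTerm, shift_smul, star_smul, smul_mul_assoc, ω.ev_smul, RCLike.star_def]
  ring

theorem suscTerm_smul_right (ω : State O) (c : ℂ) (A B : O.Obs) (x : Site D) :
    suscTerm ω A (c • B) x = c * suscTerm ω A B x := by
  simp only [suscTerm, mul_smul_comm, ω.ev_smul]
  ring

section Clustering

variable [NeZero d] {ω : State O} (hω : IsClustering ω)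

include hω

theorem IsClustering.summable_norm (A B : O.Obs) : Summable fun x => ‖suscTerm ω A B x‖ := by
  obtain ⟨p, hp, C, -, hb⟩ := hω.exists_covBound
  exact summable_suscTerm hω.1 hp hb A B

theorem IsClustering.summable (A B : O.Obs) : Summable fun x => suscTerm ω A B x :=
  (hω.summable_norm A B).of_norm

theorem IsClustering.susc_add_left (A A' B : O.Obs) :
    susc ω (A + A') B = susc ω A B + susc ω A' B := by
  simp only [susc_eq, suscTerm_add_left]
  exact (hω.summable A B).tsum_add (hω.summable A' B)

theorem IsClustering.susc_add_right (A B B' : O.Obs) :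
    susc ω A (B + B') = susc ω A B + susc ω A B' := by
  simp only [susc_eq, suscTerm_add_right]
  exact (hω.summable A B).tsum_add (hω.summable A B')

end Clustering

theorem susc_smul_left (ω : State O) (c : ℂ) (A B : O.Obs) :
    susc ω (c • A) B = starRingEnd ℂ c * susc ω A B := by
  simp only [susc_eq, suscTerm_smul_left, tsum_mul_left]

theorem susc_smul_right (ω : State O) (c : ℂ) (A B : O.Obs) :
    susc ω A (c • B) = c * susc ω A B := by
  simp only [susc_eq, suscTerm_smul_right, tsum_mul_left]

/-! ### Averages over cubes and positivity of the susceptibility -/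

/-- The cube `{-m, …, m}^D`. -/
def cube (D m : ℕ) : Finset (Site D) := Fintype.piFinset fun _ : Fin D => Finset.Icc (-(m : ℤ)) m

theorem mem_cube {m : ℕ} {x : Site D} : x ∈ cube D m ↔ ∀ i, (x i).natAbs ≤ m := by
  rw [cube, Fintype.mem_piFinset]
  refine forall_congr' fun i => ?_
  rw [Finset.mem_Icc]
  omega

theorem card_cube (D m : ℕ) : (cube D m).card = (2 * m + 1) ^ D := by
  rw [cube, Fintype.card_piFinset]
  simp only [Int.card_Icc, Finset.prod_const, Finset.card_univ, Fintype.card_fin]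
  congr 1
  omega

/-- The number of points of a cube that the translation by `z` keeps in the cube. -/
def overlap (D m : ℕ) (z : Site D) : ℕ := ((cube D m).filter fun x => x + z ∈ cube D m).card

theorem overlap_le (m : ℕ) (z : Site D) : overlap D m z ≤ (2 * m + 1) ^ D :=
  (Finset.card_filter_le _ _).trans (card_cube D m).le

theorem overlap_eq_prod (m : ℕ) (z : Site D) : overlap D m z = ∏ i,
    ((Finset.Icc (-(m : ℤ)) m).filter fun a => a + z i ∈ Finset.Icc (-(m : ℤ)) m).card := by
  rw [overlap, ← Fintype.card_piFinset]
  congr 1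
  ext x
  simp only [Finset.mem_filter, cube, Fintype.mem_piFinset, Pi.add_apply, forall_and]

theorem tendsto_overlap (z : Site D) :
    Tendsto (fun m : ℕ => (overlap D m z : ℝ) / (2 * m + 1 : ℝ) ^ D) atTop (𝓝 1) := by
  have h1 : ∀ m : ℕ, (overlap D m z : ℝ) / (2 * m + 1 : ℝ) ^ D = ∏ i,
      (((Finset.Icc (-(m : ℤ)) m).filter fun a => a + z i ∈ Finset.Icc (-(m : ℤ)) m).card : ℝ) /
        (2 * m + 1) := by
    intro m
    rw [overlap_eq_prod, Finset.prod_div_distrib]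
    push_cast
    simp
  simp_rw [h1]
  suffices h2 : ∀ i, Tendsto (fun m : ℕ =>
      (((Finset.Icc (-(m : ℤ)) m).filter fun a => a + z i ∈ Finset.Icc (-(m : ℤ)) m).card : ℝ) /
        (2 * m + 1)) atTop (𝓝 1) by
    simpa using tendsto_finsetProd Finset.univ fun i _ => h2 i
  intro i
  have hlow : ∀ m : ℕ, 1 - ((z i).natAbs : ℝ) / (2 * m + 1) ≤
      (((Finset.Icc (-(m : ℤ)) m).filter fun a => a + z i ∈ Finset.Icc (-(m : ℤ)) m).card : ℝ) /
        (2 * m + 1) := by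
    intro m
    have hpos : (0 : ℝ) < 2 * m + 1 := by positivity
    have hdiv : 1 - ((z i).natAbs : ℝ) / (2 * m + 1) =
        (2 * m + 1 - ((z i).natAbs : ℝ)) / (2 * m + 1) := by field_simp
    rw [hdiv, div_le_div_iff_of_pos_right hpos]
    have hcard : 2 * (m : ℤ) + 1 - (z i).natAbs ≤
        ((Finset.Icc (-(m : ℤ)) m).filter fun a => a + z i ∈ Finset.Icc (-(m : ℤ)) m).card := by
      rcases le_total 0 (z i) with hz | hz
      · have h3 : Finset.Icc (-(m : ℤ)) (m - z i) ⊆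
            (Finset.Icc (-(m : ℤ)) m).filter fun a => a + z i ∈ Finset.Icc (-(m : ℤ)) m := by
          intro a ha
          simp only [Finset.mem_filter, Finset.mem_Icc] at ha ⊢
          omega
        have h4 := Finset.card_le_card h3
        rw [Int.card_Icc] at h4
        omega
      · have h3 : Finset.Icc (-(m : ℤ) - z i) m ⊆
            (Finset.Icc (-(m : ℤ)) m).filter fun a => a + z i ∈ Finset.Icc (-(m : ℤ)) m := by
          intro a ha
          simp only [Finset.mem_filter, Finset.mem_Icc] at ha ⊢
          omega
        have h4 := Finset.card_le_card h3
        rw [Int.card_Icc] at h4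
        omega
    have := (Int.cast_le (R := ℝ)).2 hcard
    push_cast at this
    simpa using this
  have hup : ∀ m : ℕ,
      (((Finset.Icc (-(m : ℤ)) m).filter fun a => a + z i ∈ Finset.Icc (-(m : ℤ)) m).card : ℝ) /
        (2 * m + 1) ≤ 1 := by
    intro m
    have hpos : (0 : ℝ) < 2 * m + 1 := by positivity
    rw [div_le_one hpos]
    have h3 := Finset.card_filter_le (Finset.Icc (-(m : ℤ)) m)
      fun a => a + z i ∈ Finset.Icc (-(m : ℤ)) m
    rw [Int.card_Icc] at h3
    have h4 : ((Finset.Icc (-(m : ℤ)) m).filter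
        fun a => a + z i ∈ Finset.Icc (-(m : ℤ)) m).card ≤ 2 * m + 1 := by omega
    exact_mod_cast h4
  refine tendsto_of_tendsto_of_tendsto_of_le_of_le ?_ tendsto_const_nhds hlow hup
  have h5 : Tendsto (fun m : ℕ => (2 * (m : ℝ) + 1)) atTop atTop :=
    tendsto_atTop_add_const_right _ _
      (tendsto_natCast_atTop_atTop.const_mul_atTop (by norm_num : (0 : ℝ) < 2))
  simpa using (h5.const_div_atTop ((z i).natAbs : ℝ)).const_sub 1

/-- A double sum over a cube of a function of the difference counts differences by overlaps. -/
theorem sum_cube_sub (m : ℕ) (c : Site D → ℂ) :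
    ∑ x ∈ cube D m, ∑ y ∈ cube D m, c (y - x) = ∑' z, c z * overlap D m z := by
  have h1 : ∀ x, HasSum (fun z => if x + z ∈ cube D m then c z else 0)
      (∑ y ∈ cube D m, c (y - x)) := by
    intro x
    have h2 : HasSum (fun y => if y ∈ cube D m then c (y - x) else 0)
        (∑ y ∈ cube D m, c (y - x)) := by
      have h3 : HasSum (fun y => if y ∈ cube D m then c (y - x) else 0)
          (∑ y ∈ cube D m, if y ∈ cube D m then c (y - x) else 0) :=
        hasSum_sum_of_ne_finset_zero fun y hy => if_neg hy
      rwa [Finset.sum_congr rfl fun y hy => if_pos hy] at h3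
    rw [← (Equiv.addLeft x).hasSum_iff] at h2
    convert h2 using 2 with z
    simp
  have h4 := hasSum_sum (s := cube D m) fun x _ => h1 x
  rw [← h4.tsum_eq]
  refine tsum_congr fun z => ?_
  rw [← Finset.sum_filter, Finset.sum_const, nsmul_eq_mul, mul_comm]
  rfl

theorem tendsto_cube_average {c : Site D → ℂ} (hc : Summable fun z => ‖c z‖) :
    Tendsto (fun m : ℕ => (∑ x ∈ cube D m, ∑ y ∈ cube D m, c (y - x)) / (2 * m + 1 : ℂ) ^ D)
      atTop (𝓝 (∑' z, c z)) := by
  have h1 : ∀ m : ℕ, (∑ x ∈ cube D m, ∑ y ∈ cube D m, c (y - x)) / (2 * m + 1 : ℂ) ^ D =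
      ∑' z, c z * (((overlap D m z : ℝ) / (2 * m + 1 : ℝ) ^ D : ℝ) : ℂ) := by
    intro m
    rw [sum_cube_sub, ← tsum_div_const]
    refine tsum_congr fun z => ?_
    push_cast
    ring
  simp_rw [h1]
  refine tendsto_tsum_of_dominated_convergence hc (fun z => ?_) (Eventually.of_forall fun m z => ?_)
  · have h2 := ((Complex.continuous_ofReal.tendsto 1).comp (tendsto_overlap z)).const_mul (c z)
    simpa using h2
  · rw [norm_mul, Complex.norm_real, Real.norm_eq_abs, abs_of_nonneg (by positivity)]
    refine mul_le_of_le_one_right (norm_nonneg _) ?_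
    rw [div_le_one (by positivity)]
    exact_mod_cast overlap_le m z

/-- The extensive observable `∑_{x ∈ cube} ι_x(A)`. -/
def cubeSum (m : ℕ) (A : O.Obs) : O.Obs := ∑ x ∈ cube D m, shift x A

theorem center_cubeSum {ω : State O} (hinv : IsTranslationInvariant ω) (m : ℕ) (A : O.Obs) :
    center ω (cubeSum m A) = ∑ x ∈ cube D m, (shift x A - ω.ev A • (1 : O.Obs)) := by
  rw [center, cubeSum, Finset.sum_sub_distrib, ω.ev_sum, ← Finset.sum_smul]
  congr 2
  exact Finset.sum_congr rfl fun x _ => hinv x A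

theorem ev_star_center_cubeSum_mul {ω : State O} (hinv : IsTranslationInvariant ω) (m : ℕ)
    (A B : O.Obs) : ω.ev (star (center ω (cubeSum m A)) * B) =
      ∑ x ∈ cube D m, suscTerm ω A B x := by
  rw [center_cubeSum hinv, star_sum, Finset.sum_mul, ω.ev_sum]
  refine Finset.sum_congr rfl fun x _ => ?_
  rw [suscTerm, star_sub, star_smul, star_one, sub_mul, ω.ev_sub, smul_mul_assoc, one_mul,
    ω.ev_smul, ω.ev_star, RCLike.star_def]

theorem ev_star_center {ω : State O} (A : O.Obs) :
    ω.ev (star (center ω A)) = 0 := by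
  rw [center, star_sub, star_smul, star_one, ω.ev_sub, ω.ev_smul, ω.ev_one, ω.ev_star,
    RCLike.star_def, mul_one, sub_self]

theorem ev_star_center_cubeSum_mul_self {ω : State O} (hinv : IsTranslationInvariant ω) (m : ℕ)
    (A : O.Obs) : ω.ev (star (center ω (cubeSum m A)) * center ω (cubeSum m A)) =
      ∑ x ∈ cube D m, ∑ y ∈ cube D m, suscTerm ω A A (y - x) := by
  have h1 : star (center ω (cubeSum m A)) * center ω (cubeSum m A) =
      star (center ω (cubeSum m A)) * cubeSum m A -
        ω.ev (cubeSum m A) • star (center ω (cubeSum m A)) := by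
    conv_lhs => rw [center.eq_1 ω (cubeSum m A)]
    rw [mul_sub, mul_smul_comm, mul_one]
    rfl
  rw [h1, ω.ev_sub, ω.ev_smul, ev_star_center, mul_zero, sub_zero, cubeSum,
    Finset.mul_sum, ω.ev_sum]
  refine Finset.sum_congr rfl fun y _ => ?_
  have h2 := ev_star_center_cubeSum_mul hinv m A (shift y A)
  rw [cubeSum] at h2
  rw [h2]
  exact Finset.sum_congr rfl fun x _ => suscTerm_shift_right hinv A A x y

theorem symSusc_self_re (ω : State O) (A : O.Obs) :
    (symSusc ω A A).re = ((susc ω A A).re + (susc ω (star A) (star A)).re) / 2 := by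
  rw [symSusc]
  simp

section Clustering

variable [NeZero d] {ω : State O} (hω : IsClustering ω)

include hω

/-- The variance of an extensive observable per unit volume tends to the susceptibility. -/
theorem IsClustering.tendsto_variance (A : O.Obs) :
    Tendsto (fun m : ℕ =>
      (ω.ev (star (center ω (cubeSum m A)) * center ω (cubeSum m A))).re / (2 * m + 1 : ℝ) ^ D)
      atTop (𝓝 (susc ω A A).re) := by
  have h1 := (Complex.continuous_re.tendsto _).comp (tendsto_cube_average (hω.summable_norm A A))
  refine h1.congr fun m => ?_
  rw [Function.comp_apply, ← ev_star_center_cubeSum_mul_self hω.1]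
  have h2 : (2 * (m : ℂ) + 1) ^ D = (((2 * m + 1 : ℝ) ^ D : ℝ) : ℂ) := by push_cast; rfl
  rw [h2, Complex.div_ofReal_re]

theorem IsClustering.susc_self_nonneg (A : O.Obs) : 0 ≤ (susc ω A A).re :=
  ge_of_tendsto' (hω.tendsto_variance A) fun m =>
    div_nonneg (ω.ev_star_mul_self_nonneg _) (by positivity)

/-- The susceptibility as a positive semidefinite form. -/
abbrev IsClustering.core : PreInnerProductSpace.Core ℂ O.Obs where
  inner := susc ω
  conj_inner_symm A B := susc_conj hω.1 A B
  re_inner_nonneg := hω.susc_self_nonneg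
  add_left := hω.susc_add_left
  smul_left A B c := susc_smul_left ω c A B

theorem IsClustering.norm_susc_sq_le (A B : O.Obs) :
    ‖susc ω A B‖ ^ 2 ≤ (susc ω A A).re * (susc ω B B).re := by
  have h1 := @InnerProductSpace.Core.inner_mul_inner_self_le ℂ O.Obs _ _ _ hω.core A B
  have h2 : ‖susc ω B A‖ = ‖susc ω A B‖ := by
    rw [← susc_conj hω.1 B A, RCLike.norm_conj]
  change ‖susc ω A B‖ * ‖susc ω B A‖ ≤ _ at h1
  rw [h2, ← sq] at h1
  exact h1

theorem IsClustering.symSusc_self_nonneg (A : O.Obs) : 0 ≤ (symSusc ω A A).re := by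
  rw [symSusc_self_re]
  have h1 := hω.susc_self_nonneg A
  have h2 := hω.susc_self_nonneg (star A)
  linarith

/-- The symmetrised susceptibility as a positive semidefinite form. -/
abbrev IsClustering.symCore : PreInnerProductSpace.Core ℂ O.Obs where
  inner := symSusc ω
  conj_inner_symm A B := by
    rw [symSusc, symSusc, map_div₀, map_add, susc_conj hω.1, susc_conj hω.1, map_ofNat]
  re_inner_nonneg := hω.symSusc_self_nonneg
  add_left A B C := by
    rw [symSusc, symSusc, symSusc, hω.susc_add_left, star_add, hω.susc_add_right]
    ring
  smul_left A B c := by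
    rw [symSusc, symSusc, susc_smul_left, star_smul, susc_smul_right, RCLike.star_def]
    ring

end Clustering

/-! ### Bounded functionals are pseudolocal charges -/

/-- Riesz representation for a positive semidefinite form: a bounded functional is the limit of the
functionals given by a Cauchy sequence of vectors. -/
theorem exists_seq_tendsto_inner {E : Type*} [AddCommGroup E] [Module ℂ E]
    (c : PreInnerProductSpace.Core ℂ E) (q : E →ₗ[ℂ] ℂ) (K : ℝ)
    (hq : ∀ x, ‖q x‖ ≤ K * √(c.inner x x).re) :
    ∃ a : ℕ → E, (∀ y, Tendsto (fun k => c.inner (a k) y) atTop (𝓝 (q y))) ∧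
      (∃ G : ℝ, ∀ k, (c.inner (a k) (a k)).re ≤ G) ∧
      ∀ ε > 0, ∃ N, ∀ j ≥ N, ∀ k ≥ N, (c.inner (a j - a k) (a j - a k)).re ≤ ε := by
  let _ : SeminormedAddCommGroup E :=
    @InnerProductSpace.Core.toSeminormedAddCommGroup ℂ E _ _ _ c
  let _ : InnerProductSpace ℂ E := InnerProductSpace.ofCore c
  have hinner : ∀ x y : E, c.inner x y = inner ℂ x y := fun _ _ => rfl
  have hself : ∀ x : E, (inner ℂ x x).re = ‖x‖ ^ 2 := fun x => inner_self_eq_norm_sq (𝕜 := ℂ) x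
  have hq' : ∀ x, ‖q x‖ ≤ K * ‖x‖ := by
    intro x
    have h1 := hq x
    rwa [hinner, hself, Real.sqrt_sq (norm_nonneg x)] at h1
  let f : E →L[ℂ] ℂ := q.mkContinuous K hq'
  let e : E →L[ℂ] UniformSpace.Completion E := UniformSpace.Completion.toComplL
  have he : DenseRange e := UniformSpace.Completion.denseRange_coe
  have he' : IsUniformInducing e := UniformSpace.Completion.isUniformInducing_coe E
  let F : UniformSpace.Completion E →L[ℂ] ℂ := f.extend e
  have hF : ∀ x : E, F (e x) = q x := fun x => ContinuousLinearMap.extend_eq f he he' x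
  let v := (InnerProductSpace.toDual ℂ (UniformSpace.Completion E)).symm F
  have hv : ∀ x : E, inner ℂ v (e x) = q x := by
    intro x
    rw [InnerProductSpace.toDual_symm_apply, hF]
  have ha : ∀ k : ℕ, ∃ x : E, dist v (e x) < 1 / ((k : ℝ) + 1) :=
    fun k => he.exists_dist_lt v (by positivity)
  choose a ha using ha
  have hlim : Tendsto (fun k => e (a k)) atTop (𝓝 v) := by
    rw [tendsto_iff_dist_tendsto_zero]
    refine squeeze_zero (fun _ => dist_nonneg) (fun k => ?_) tendsto_one_div_add_atTop_nhds_zero_nat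
    rw [dist_comm]
    exact (ha k).le
  have hnorm : ∀ x : E, ‖e x‖ = ‖x‖ := fun x => UniformSpace.Completion.norm_coe x
  refine ⟨a, fun y => ?_, ⟨(‖v‖ + 1) ^ 2, fun k => ?_⟩, fun ε hε => ?_⟩
  · have h1 : Tendsto (fun k => inner ℂ (e (a k)) (e y)) atTop (𝓝 (inner ℂ v (e y))) :=
      hlim.inner tendsto_const_nhds
    rw [hv] at h1
    refine h1.congr fun k => ?_
    exact UniformSpace.Completion.inner_coe (a k) y
  · rw [hinner, hself]
    refine pow_le_pow_left₀ (norm_nonneg _) ?_ 2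
    have h1 : ‖e (a k)‖ ≤ ‖v‖ + dist v (e (a k)) := by
      rw [dist_comm, dist_eq_norm]
      exact norm_le_insert' _ _
    have h2 : 1 / ((k : ℝ) + 1) ≤ 1 := by
      rw [div_le_one (by positivity)]
      linarith [Nat.cast_nonneg (α := ℝ) k]
    rw [hnorm] at h1
    linarith [ha k]
  · have hc := hlim.cauchySeq
    rw [Metric.cauchySeq_iff] at hc
    obtain ⟨N, hN⟩ := hc (√ε) (Real.sqrt_pos.2 hε)
    refine ⟨N, fun j hj k hk => ?_⟩
    rw [hinner, hself, ← hnorm, map_sub, ← dist_eq_norm]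
    have h1 := (hN j hj k hk).le
    calc _ ≤ √ε ^ 2 := pow_le_pow_left₀ dist_nonneg h1 2
      _ = ε := Real.sq_sqrt hε.le

/-- The finite partial sums of the susceptibilities `⟨A, B⟩`, with `B` supported in the ball of
radius `j`, have converged up to the error `‖B‖ / (j + 1)` as soon as they include the cube of size
`r`. -/
def TailBound (ω : State O) (A : O.Obs) (j r : ℕ) : Prop :=
  ∀ B : O.Obs, SupportedIn (ball D j) (B : Op D d) → ∀ Λ : Finset (Site D), cube D r ⊆ Λ →
    ‖∑ x ∈ Λ, suscTerm ω A B x - susc ω A B‖ ≤ ‖B‖ / (j + 1)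

theorem eventually_subset_cube (s : Finset (Site D)) : ∀ᶠ r in atTop, s ⊆ cube D r := by
  obtain ⟨r₀, hr₀⟩ := exists_subset_ball s
  filter_upwards [eventually_ge_atTop r₀] with r hr x hx
  rw [mem_cube]
  intro i
  have h1 := mem_ball.1 (hr₀ hx)
  have h2 := natAbs_le_latticeDist x i
  omega

theorem IsClustering.eventually_tailBound [NeZero d] {ω : State O} (hω : IsClustering ω)
    (A : O.Obs) (j : ℕ) : ∀ᶠ r in atTop, TailBound ω A j r := by
  classical
  obtain ⟨p, hp, C, hC0, hC⟩ := hω.exists_covBound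
  obtain ⟨X, hX⟩ := O.isLocal A A.2
  set l := max X.card (ball D j).card
  let w : Site D → ℝ := fun x => C l * ‖A‖ * pairWeight p X (ball D j) x
  have hw0 : ∀ x, 0 ≤ w x := fun x =>
    mul_nonneg (mul_nonneg (hC0 l) (norm_nonneg _)) (pairWeight_nonneg _ _ _ _)
  have hw : Summable w := (hasSum_pairWeight hp X (ball D j)).summable.mul_left _
  obtain ⟨s, hs⟩ := summable_iff_vanishing_norm.1 hw (1 / ((j : ℝ) + 1)) (by positivity)
  filter_upwards [eventually_subset_cube s] with r hr B hB Λ hΛ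
  have hterm : ∀ x, ‖suscTerm ω A B x‖ ≤ ‖B‖ * w x := by
    intro x
    refine (norm_suscTerm_le hω.1 hC (le_max_left _ _) (le_max_right _ _) hX hB x).trans
      (le_of_eq ?_)
    simp only [w, l]
    ring
  have hlim : Tendsto (fun Λ' : Finset (Site D) =>
      ‖∑ x ∈ Λ, suscTerm ω A B x - ∑ x ∈ Λ', suscTerm ω A B x‖) atTop
      (𝓝 ‖∑ x ∈ Λ, suscTerm ω A B x - susc ω A B‖) :=
    ((hω.summable A B).hasSum.const_sub _).norm
  refine le_of_tendsto hlim ?_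
  filter_upwards [eventually_ge_atTop Λ] with Λ' hΛ'
  have h1 : ∑ x ∈ Λ, suscTerm ω A B x - ∑ x ∈ Λ', suscTerm ω A B x =
      -∑ x ∈ Λ' \ Λ, suscTerm ω A B x := by
    rw [← Finset.sum_sdiff hΛ']
    ring
  have h2 : Disjoint (Λ' \ Λ) s :=
    Finset.disjoint_of_subset_right (hr.trans hΛ) Finset.sdiff_disjoint
  have h3 := hs _ h2
  rw [Real.norm_eq_abs, abs_of_nonneg (Finset.sum_nonneg fun x _ => hw0 x)] at h3
  rw [h1, norm_neg]
  calc ‖∑ x ∈ Λ' \ Λ, suscTerm ω A B x‖ ≤ ∑ x ∈ Λ' \ Λ, ‖B‖ * w x :=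
        norm_sum_le_of_le _ fun x _ => hterm x
    _ = ‖B‖ * ∑ x ∈ Λ' \ Λ, w x := by rw [Finset.mul_sum]
    _ ≤ ‖B‖ * (1 / ((j : ℝ) + 1)) := by gcongr
    _ = ‖B‖ / (j + 1) := by ring

theorem latticeDist_le_of_mem_cube {m : ℕ} {x : Site D} (hx : x ∈ cube D m) :
    latticeDist x 0 ≤ D * m := by
  rw [mem_cube] at hx
  calc latticeDist x 0 ≤ ∑ _i : Fin D, m := Finset.sum_le_sum fun i _ => by simpa using hx i
    _ = D * m := by simp

theorem supportedIn_cubeSum {r m n : ℕ} (hn : r + D * m ≤ n) {A : O.Obs}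
    (hA : SupportedIn (ball D r) (A : Op D d)) :
    SupportedIn (ball D n) (cubeSum m A : Op D d) := by
  refine SupportedIn.sum fun x hx => (supportedIn_shift x hA).mono fun y hy => ?_
  obtain ⟨u, hu, rfl⟩ := Finset.mem_map.1 hy
  rw [mem_ball] at hu ⊢
  have h1 := latticeDist_triangle (u + x) x 0
  have h2 : latticeDist (u + x) x = latticeDist u 0 := by
    rw [latticeDist_eq_sub, add_sub_cancel_right]
  have h3 := latticeDist_le_of_mem_cube hx
  rw [addRightEmbedding_apply]
  omega

theorem star_cubeSum (m : ℕ) (A : O.Obs) : star (cubeSum m A) = cubeSum m (star A) := by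
  rw [cubeSum, cubeSum, star_sum]
  exact Finset.sum_congr rfl fun x _ => (shift_star x A).symm

/-- Size of the cube over which the translates of an observable are summed to form the `n`-th member
of a pseudolocal sequence; it is about half of what fits into the ball of radius `n`, which leaves
room for the support of the observable. -/
def cubeSize (D n : ℕ) : ℕ := n / (2 * D)

/-- The conditions on an observable `A` under which `∑_{x ∈ cube} ι_x(A)` may serve as the `n`-th
member of a pseudolocal sequence, with precision `1 / (j + 1)`. -/
structure IsGoodDensity (ω : State O) (G : ℝ) (A : O.Obs) (j n : ℕ) : Prop where
  supported : SupportedIn (ball D n) (cubeSum (cubeSize D n) A : Op D d)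
  variance : (ω.ev (star (center ω (cubeSum (cubeSize D n) A)) *
    center ω (cubeSum (cubeSize D n) A))).re ≤ (G + 1) * (2 * (cubeSize D n : ℝ) + 1) ^ D
  tail : TailBound ω A j (cubeSize D n / 2)

theorem tendsto_cubeSize (hD : 1 ≤ D) : Tendsto (cubeSize D) atTop atTop :=
  Nat.tendsto_div_const_atTop (by omega)

theorem IsClustering.eventually_isGoodDensity [NeZero d] (hD : 1 ≤ D) {ω : State O}
    (hω : IsClustering ω) {G : ℝ} {A : O.Obs} (hG : (susc ω A A).re ≤ G) (j : ℕ) :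
    ∀ᶠ n in atTop, IsGoodDensity ω G A j n := by
  have h1 : ∀ᶠ m : ℕ in atTop, (ω.ev (star (center ω (cubeSum m A)) * center ω (cubeSum m A))).re /
      (2 * m + 1 : ℝ) ^ D < G + 1 :=
    (hω.tendsto_variance A).eventually (gt_mem_nhds (by linarith))
  have h2 : ∀ᶠ m : ℕ in atTop, TailBound ω A j (m / 2) :=
    (Nat.tendsto_div_const_atTop (by norm_num)).eventually (hω.eventually_tailBound A j)
  obtain ⟨X, hX⟩ := O.isLocal A A.2
  obtain ⟨r, hr⟩ := exists_subset_ball X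
  filter_upwards [(tendsto_cubeSize hD).eventually h1, (tendsto_cubeSize hD).eventually h2,
    eventually_ge_atTop (2 * r)] with n hn1 hn2 hn3
  refine ⟨supportedIn_cubeSum ?_ (hX.mono hr), ?_, hn2⟩
  · have h3 : 2 * (D * cubeSize D n) ≤ n := by
      rw [← mul_assoc]
      exact Nat.mul_div_le n (2 * D)
    omega
  · rw [div_lt_iff₀ (by positivity)] at hn1
    exact hn1.le

/-- Diagonal choice: `k n` may tend to infinity slowly enough for `P (k n) n` to hold eventually. -/
theorem exists_diagonal {P : ℕ → ℕ → Prop} (h : ∀ j, ∀ᶠ n in atTop, P j n) :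
    ∃ k : ℕ → ℕ, Tendsto k atTop atTop ∧ ∀ᶠ n in atTop, P (k n) n := by
  classical
  choose N hN using fun j => eventually_atTop.1 (h j)
  refine ⟨fun n => Nat.findGreatest (fun j => N j ≤ n) n, ?_, ?_⟩
  · rw [tendsto_atTop]
    intro J
    filter_upwards [eventually_ge_atTop (max J (N J))] with n hn
    exact Nat.le_findGreatest ((le_max_left _ _).trans hn) ((le_max_right _ _).trans hn)
  · filter_upwards [eventually_ge_atTop (N 0)] with n hn
    exact hN _ n (Nat.findGreatest_spec (P := fun j => N j ≤ n) (Nat.zero_le n) hn)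

section Sequence

variable {ω : State O} {A : ℕ → O.Obs} {k : ℕ → ℕ} {G : ℝ} {Q : ℕ → O.Obs}

/-- The expectation values of an extensive sequence approximate the susceptibility of its density,
uniformly in translations of the test observable inside the bulk. -/
theorem norm_ev_cubeSum_sub_susc_le (hinv : IsTranslationInvariant ω) {A B : O.Obs} {j n : ℕ}
    (hg : IsGoodDensity ω G A j n) (hB : SupportedIn (ball D j) (B : Op D d)) {x : Site D}
    (hx : ∀ i, (x i).natAbs + cubeSize D n / 2 ≤ cubeSize D n) :
    ‖ω.ev (star (center ω (cubeSum (cubeSize D n) A)) * shift x B) - susc ω A B‖ ≤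
      ‖B‖ / (j + 1) := by
  have h1 : ω.ev (star (center ω (cubeSum (cubeSize D n) A)) * shift x B) =
      ∑ y ∈ (cube D (cubeSize D n)).map (addRightEmbedding (-x)), suscTerm ω A B y := by
    rw [ev_star_center_cubeSum_mul hinv, Finset.sum_map]
    refine Finset.sum_congr rfl fun y _ => ?_
    rw [suscTerm_shift_right hinv, addRightEmbedding_apply, sub_eq_add_neg]
  rw [h1]
  refine hg.tail B hB _ fun y hy => ?_
  rw [Finset.mem_map]
  refine ⟨y + x, ?_, by simp⟩
  rw [mem_cube] at hy ⊢
  intro i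
  have h2 := hy i
  have h3 := hx i
  rw [Pi.add_apply]
  omega

theorem eventually_ball_subset_bulk (hD : 1 ≤ D) : ∀ᶠ n : ℕ in atTop, ∀ x : Site D,
    (latticeDist x 0 : ℝ) ≤ 1 / (8 * D) * n →
      ∀ i, (x i).natAbs + cubeSize D n / 2 ≤ cubeSize D n := by
  filter_upwards [eventually_ge_atTop (2 * D)] with n hn x hx i
  have hD' : (0 : ℝ) < D := by exact_mod_cast hD
  have h1 : latticeDist x 0 * (8 * D) ≤ n := by
    have h2 : (latticeDist x 0 : ℝ) * (8 * D) ≤ n := by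
      rw [one_div_mul_eq_div, le_div_iff₀ (by positivity)] at hx
      exact hx
    exact_mod_cast h2
  have h3 := natAbs_le_latticeDist x i
  -- `n < 4 * D * cubeSize D n`, as `2 * D ≤ n`
  have h4 : n < 2 * D * (cubeSize D n + 1) := by
    have := Nat.lt_mul_div_succ n (by omega : 0 < 2 * D)
    exact this
  have h5 : 1 ≤ cubeSize D n := (Nat.one_le_div_iff (by omega)).2 hn
  have h6 : latticeDist x 0 * (8 * D) < 2 * D * (2 * cubeSize D n) :=
    h1.trans_lt (h4.trans_le (Nat.mul_le_mul_left _ (by omega)))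
  have h7 : (2 * D) * (latticeDist x 0 * 4) < (2 * D) * (2 * cubeSize D n) := by
    calc (2 * D) * (latticeDist x 0 * 4) = latticeDist x 0 * (8 * D) := by ring
      _ < _ := h6
  have h8 := Nat.lt_of_mul_lt_mul_left h7
  omega

theorem hasLimitAction_of_isGoodDensity (hinv : IsTranslationInvariant ω)
    (hk : Tendsto k atTop atTop)
    (hQ : ∀ᶠ n in atTop, IsGoodDensity ω G (A n) (k n) n ∧ Q n = cubeSum (cubeSize D n) (A n))
    {L : O.Obs → ℂ} (hL : ∀ B, Tendsto (fun n => susc ω (A n) B) atTop (𝓝 (L B))) :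
    HasLimitAction ω Q L := by
  intro B
  obtain ⟨Y, hY⟩ := O.isLocal B B.2
  obtain ⟨j, hj⟩ := exists_subset_ball Y
  have h1 : Tendsto (fun n => ω.ev (star (center ω (Q n)) * B) - susc ω (A n) B) atTop (𝓝 0) := by
    have h2 : Tendsto (fun n => ‖B‖ / ((k n : ℝ) + 1)) atTop (𝓝 0) := by
      refine Tendsto.const_div_atTop ?_ _
      exact tendsto_atTop_add_const_right _ _ (tendsto_natCast_atTop_atTop.comp hk)
    refine squeeze_zero_norm' ?_ h2
    filter_upwards [hQ, hk.eventually_ge_atTop j] with n ⟨hg, hn⟩ hkn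
    have hB : SupportedIn (ball D (k n)) (B : Op D d) := hY.mono (hj.trans fun x hx => by
      rw [mem_ball] at hx ⊢
      omega)
    have h3 := norm_ev_cubeSum_sub_susc_le hinv hg hB (x := 0) (fun i => by
      simp only [Pi.zero_apply, Int.natAbs_zero]
      omega)
    rwa [shift_zero_site, ← hn] at h3
  simpa using h1.add (hL B)

theorem isPseudolocalSeq_of_isGoodDensity (hD : 1 ≤ D) (hinv : IsTranslationInvariant ω)
    (hG : 0 ≤ G) (hk : Tendsto k atTop atTop)
    (hQ : ∀ᶠ n in atTop, IsGoodDensity ω G (A n) (k n) n ∧ Q n = cubeSum (cubeSize D n) (A n))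
    (hQ' : ∀ n, (IsGoodDensity ω G (A n) (k n) n ∧ Q n = cubeSum (cubeSize D n) (A n)) ∨ Q n = 0)
    {L : O.Obs → ℂ} (hL : ∀ B, Tendsto (fun n => susc ω (A n) B) atTop (𝓝 (L B))) :
    IsPseudolocalSeq ω Q where
  supported n := by
    rcases hQ' n with ⟨hg, hn⟩ | hn
    · rw [hn]
      exact hg.supported
    · rw [hn]
      exact SupportedIn.zero _
  volume_growth := by
    refine ⟨(G + 1) * 3 ^ D, by positivity, fun n hn0 => ?_⟩
    rcases hQ' n with ⟨hg, hn⟩ | hn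
    · rw [hn]
      refine hg.variance.trans ?_
      rw [mul_assoc, ← mul_pow]
      have h1 : cubeSize D n ≤ n := Nat.div_le_self _ _
      have h2 : (cubeSize D n : ℝ) ≤ n := by exact_mod_cast h1
      have h3 : (1 : ℝ) ≤ n := by exact_mod_cast hn0
      gcongr
      linarith
    · have h1 : center ω (0 : O.Obs) = 0 := by
        rw [center, ω.ev_eq, map_zero, zero_smul, sub_zero]
      rw [hn, h1, mul_zero, ω.ev_eq, map_zero, Complex.zero_re]
      positivity
  limit_action := ⟨L, hasLimitAction_of_isGoodDensity hinv hk hQ hL⟩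
  homogeneity := by
    have hD' : (1 : ℝ) ≤ D := by exact_mod_cast hD
    refine ⟨1 / (8 * D), by positivity, ?_, fun B ε hε => ?_⟩
    · rw [div_lt_one (by positivity)]
      linarith
    obtain ⟨Y, hY⟩ := O.isLocal B B.2
    obtain ⟨j, hj⟩ := exists_subset_ball Y
    have h2 : Tendsto (fun n => ‖B‖ / ((k n : ℝ) + 1)) atTop (𝓝 0) := by
      refine Tendsto.const_div_atTop ?_ _
      exact tendsto_atTop_add_const_right _ _ (tendsto_natCast_atTop_atTop.comp hk)
    filter_upwards [hQ, hk.eventually_ge_atTop j, h2.eventually (gt_mem_nhds (half_pos hε)),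
      eventually_ball_subset_bulk hD] with n ⟨hg, hn⟩ hkn hsmall hbulk x y hx hy
    have hB : SupportedIn (ball D (k n)) (B : Op D d) := hY.mono (hj.trans fun x hx => by
      rw [mem_ball] at hx ⊢
      omega)
    have h3 := norm_ev_cubeSum_sub_susc_le hinv hg hB (hbulk x hx)
    have h4 := norm_ev_cubeSum_sub_susc_le hinv hg hB (hbulk y hy)
    rw [← hn] at h3 h4
    have h5 := norm_sub_le_norm_sub_add_norm_sub
      (ω.ev (star (center ω (Q n)) * shift x B)) (susc ω (A n) B)
      (ω.ev (star (center ω (Q n)) * shift y B))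
    rw [norm_sub_rev (susc ω (A n) B)] at h5
    linarith

end Sequence

section Clustering

variable [NeZero d] {ω : State O} (hω : IsClustering ω)

include hω

theorem IsClustering.susc_sub_left (A A' B : O.Obs) :
    susc ω (A - A') B = susc ω A B - susc ω A' B := by
  have h1 : A - A' = A + (-1 : ℂ) • A' := by rw [neg_one_smul, sub_eq_add_neg]
  rw [h1, hω.susc_add_left, susc_smul_left]
  simp [sub_eq_add_neg]

theorem IsClustering.susc_self_le (A : O.Obs) :
    (susc ω A A).re ≤ 2 * (symSusc ω A A).re := by
  rw [symSusc_self_re]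
  linarith [hω.susc_self_nonneg (star A)]

/-- If the densities form a Cauchy sequence for the susceptibility, then their charges converge. -/
theorem IsClustering.exists_tendsto_susc {a : ℕ → O.Obs}
    (ha : ∀ ε > 0, ∃ N, ∀ j ≥ N, ∀ k ≥ N, (susc ω (a j - a k) (a j - a k)).re ≤ ε) (B : O.Obs) :
    ∃ z : ℂ, Tendsto (fun k => susc ω (a k) B) atTop (𝓝 z) := by
  refine cauchySeq_tendsto_of_complete (Metric.cauchySeq_iff.2 fun ε hε => ?_)
  have hB := hω.susc_self_nonneg B
  obtain ⟨N, hN⟩ := ha (ε ^ 2 / (2 * ((susc ω B B).re + 1))) (by positivity)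
  refine ⟨N, fun j hj k hk => ?_⟩
  rw [dist_eq_norm, ← hω.susc_sub_left]
  refine lt_of_pow_lt_pow_left₀ 2 hε.le ?_
  calc ‖susc ω (a j - a k) B‖ ^ 2 ≤ (susc ω (a j - a k) (a j - a k)).re * (susc ω B B).re :=
        hω.norm_susc_sq_le _ _
    _ ≤ ε ^ 2 / (2 * ((susc ω B B).re + 1)) * (susc ω B B).re := by
        gcongr
        exact hN j hj k hk
    _ < ε ^ 2 := by
        rw [div_mul_eq_mul_div, div_lt_iff₀ (by positivity)]
        have : 0 < ε ^ 2 := by positivity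
        nlinarith

/-- Every linear functional on local observables that is bounded for the symmetrised susceptibility
is a pseudolocal charge: by the Riesz representation it is a limit of susceptibilities
`⟨⟨A_k, ·⟩⟩`, and the sums `∑ ι_x(A_k)` over large cubes, with `k` growing sufficiently slowly with
the cube, form a pseudolocal sequence for it. -/
theorem IsClustering.isPseudolocalCharge (hD : 1 ≤ D) (q : O.Obs →ₗ[ℂ] ℂ) {K : ℝ}
    (hK : ∀ A, ‖q A‖ ≤ K * symNorm ω A) : IsPseudolocalCharge ω q := by
  classical
  obtain ⟨a, hlim, ⟨G, hG⟩, hcauchy⟩ := exists_seq_tendsto_inner hω.symCore q K hK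
  change ∀ B, Tendsto (fun k => symSusc ω (a k) B) atTop (𝓝 (q B)) at hlim
  change ∀ k, (symSusc ω (a k) (a k)).re ≤ G at hG
  change ∀ ε > 0, ∃ N, ∀ j ≥ N, ∀ k ≥ N, (symSusc ω (a j - a k) (a j - a k)).re ≤ ε at hcauchy
  have hsym : ∀ A : O.Obs, symSusc ω (star A) (star A) = symSusc ω A A := by
    intro A
    rw [symSusc, symSusc, star_star, add_comm]
  have hc1 : ∀ ε > 0, ∃ N, ∀ j ≥ N, ∀ k ≥ N, (susc ω (a j - a k) (a j - a k)).re ≤ ε := by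
    intro ε hε
    obtain ⟨N, hN⟩ := hcauchy (ε / 2) (half_pos hε)
    exact ⟨N, fun j hj k hk => (hω.susc_self_le _).trans (by linarith [hN j hj k hk])⟩
  have hc2 : ∀ ε > 0, ∃ N, ∀ j ≥ N, ∀ k ≥ N,
      (susc ω (star (a j) - star (a k)) (star (a j) - star (a k))).re ≤ ε := by
    intro ε hε
    obtain ⟨N, hN⟩ := hcauchy (ε / 2) (half_pos hε)
    refine ⟨N, fun j hj k hk => ?_⟩
    rw [← star_sub]
    refine (hω.susc_self_le _).trans ?_
    rw [hsym]
    linarith [hN j hj k hk]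
  choose L hL using hω.exists_tendsto_susc hc1
  choose L' hL' using hω.exists_tendsto_susc (a := fun k => star (a k)) hc2
  have hq : ∀ B, q B = (L B + starRingEnd ℂ (L' (star B))) / 2 := by
    intro B
    refine tendsto_nhds_unique (hlim B) ?_
    have h1 := (Complex.continuous_conj.tendsto _).comp (hL' (star B))
    refine (((hL B).add h1).div_const 2).congr fun k => ?_
    rw [symSusc, Function.comp_apply, susc_conj hω.1]
  have hG1 : ∀ k, (susc ω (a k) (a k)).re ≤ 2 * G := fun k =>
    (hω.susc_self_le _).trans (by linarith [hG k])
  have hG2 : ∀ k, (susc ω (star (a k)) (star (a k))).re ≤ 2 * G := fun k =>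
    (hω.susc_self_le _).trans (by rw [hsym]; linarith [hG k])
  have hG0 : 0 ≤ 2 * G := (hω.susc_self_nonneg (a 0)).trans (hG1 0)
  let P : ℕ → ℕ → Prop := fun j n =>
    IsGoodDensity ω (2 * G) (a j) j n ∧ IsGoodDensity ω (2 * G) (star (a j)) j n
  obtain ⟨k, hk, hP⟩ := exists_diagonal (P := P) fun j =>
    (hω.eventually_isGoodDensity hD (hG1 j) j).and (hω.eventually_isGoodDensity hD (hG2 j) j)
  let Q : ℕ → O.Obs := fun n => if P (k n) n then cubeSum (cubeSize D n) (a (k n)) else 0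
  have hQpos : ∀ n, P (k n) n → Q n = cubeSum (cubeSize D n) (a (k n)) := fun n h => if_pos h
  have hQneg : ∀ n, ¬ P (k n) n → Q n = 0 := fun n h => if_neg h
  have hQ1 : ∀ᶠ n in atTop, IsGoodDensity ω (2 * G) (a (k n)) (k n) n ∧
      Q n = cubeSum (cubeSize D n) (a (k n)) := hP.mono fun n h => ⟨h.1, hQpos n h⟩
  have hQ2 : ∀ᶠ n in atTop, IsGoodDensity ω (2 * G) (star (a (k n))) (k n) n ∧
      star (Q n) = cubeSum (cubeSize D n) (star (a (k n))) := hP.mono fun n h =>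
    ⟨h.2, by rw [hQpos n h, star_cubeSum]⟩
  have hL1 : ∀ B, Tendsto (fun n => susc ω (a (k n)) B) atTop (𝓝 (L B)) := fun B => (hL B).comp hk
  have hL2 : ∀ B, Tendsto (fun n => susc ω (star (a (k n))) B) atTop (𝓝 (L' B)) :=
    fun B => (hL' B).comp hk
  refine ⟨Q, ?_, ?_, L, L', ?_, ?_, hq⟩
  · refine isPseudolocalSeq_of_isGoodDensity hD hω.1 hG0 hk hQ1 (fun n => ?_) hL1
    by_cases h : P (k n) n
    · exact Or.inl ⟨h.1, hQpos n h⟩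
    · exact Or.inr (hQneg n h)
  · refine isPseudolocalSeq_of_isGoodDensity hD hω.1 hG0 hk hQ2 (fun n => ?_) hL2
    by_cases h : P (k n) n
    · exact Or.inl ⟨h.2, by rw [hQpos n h, star_cubeSum]⟩
    · exact Or.inr (by rw [hQneg n h, star_zero])
  · exact hasLimitAction_of_isGoodDensity hω.1 hk hQ1 hL1
  · exact hasLimitAction_of_isGoodDensity hω.1 hk hQ2 hL2

end Clustering

/-- A pseudolocal charge is a linear functional. -/
theorem IsPseudolocalCharge.exists_linear {ω : State O} {q : O.Obs → ℂ}
    (hq : IsPseudolocalCharge ω q) : ∃ q' : O.Obs →ₗ[ℂ] ℂ, ∀ A, q' A = q A := by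
  obtain ⟨Q, -, -, L, L', hL, hL', hLL⟩ := hq
  have hadd : ∀ (Q : ℕ → O.Obs) (L : O.Obs → ℂ), HasLimitAction ω Q L →
      (∀ A B, L (A + B) = L A + L B) ∧ ∀ (c : ℂ) A, L (c • A) = c * L A := by
    intro Q L hL
    refine ⟨fun A B => ?_, fun c A => ?_⟩
    · refine tendsto_nhds_unique (hL (A + B)) (((hL A).add (hL B)).congr fun n => ?_)
      rw [mul_add, ω.ev_add]
    · refine tendsto_nhds_unique (hL (c • A)) (((hL A).const_mul c).congr fun n => ?_)
      rw [mul_smul_comm, ω.ev_smul]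
  obtain ⟨h1, h2⟩ := hadd Q L hL
  obtain ⟨h3, h4⟩ := hadd _ L' hL'
  refine ⟨{ toFun := q, map_add' := fun A B => ?_, map_smul' := fun c A => ?_ }, fun _ => rfl⟩
  · rw [hLL, hLL, hLL, star_add, h1, h3, map_add]
    ring
  · rw [hLL, hLL, star_smul, h2, h4, map_mul, RCLike.star_def, Complex.conj_conj, RingHom.id_apply,
      smul_eq_mul]
    ring

/-! ### Clustering of the evolved states -/

/-- The endomorphism `φ` of the quasi-local algebra is given on local observables by the evolution
series at time `t`. -/
def IsEvolution (h : O.Obs) (t : ℝ) (φ : O.Quasi →⋆ₐ[ℂ] O.Quasi) : Prop :=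
  ∀ A : O.Obs, φ (incl A) = evo h t A

section Evolved

variable {h : O.Obs} {t : ℝ} {φ : O.Quasi →⋆ₐ[ℂ] O.Quasi}

theorem State.ev_comp (ω : State O) (φ : O.Quasi →⋆ₐ[ℂ] O.Quasi) (A : O.Obs) :
    (ω.comp φ).ev A = ω.toLinearMap (φ (incl A)) := rfl

theorem IsEvolution.tendsto_ev [NeZero d] (hφ : IsEvolution h t φ) (ht : SmallTime h t)
    (ω : State O) (A : O.Obs) :
    Tendsto (fun N => ω.ev (evoPartial h t N A)) atTop (𝓝 ((ω.comp φ).ev A)) := by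
  rw [State.ev_comp, hφ]
  exact (ω.continuous.tendsto _).comp (ht.tendsto_evoPartial A)

theorem evoPartial_shift (h : O.Obs) (t : ℝ) (N : ℕ) (y : Site D) (A : O.Obs) :
    evoPartial h t N (shift y A) = shift y (evoPartial h t N A) := by
  rw [evoPartial_apply, evoPartial_apply, shift_sum]
  exact Finset.sum_congr rfl fun n _ => evoTerm_shift h t n y A

theorem evoPartial_star {h : O.Obs} (hh : star h = h) (t : ℝ) (N : ℕ) (A : O.Obs) :
    star (evoPartial h t N A) = evoPartial h t N (star A) := by
  rw [evoPartial_apply, evoPartial_apply, star_sum]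
  exact Finset.sum_congr rfl fun n _ => evoTerm_star hh t n A

theorem IsEvolution.isTranslationInvariant [NeZero d] (hφ : IsEvolution h t φ)
    (ht : SmallTime h t) {ω : State O} (hω : IsTranslationInvariant ω) :
    IsTranslationInvariant (ω.comp φ) := by
  intro x A
  refine tendsto_nhds_unique (hφ.tendsto_ev ht ω (shift x A))
    ((hφ.tendsto_ev ht ω A).congr fun N => ?_)
  rw [evoPartial_shift, hω]

/-- Approximation of a connected correlation in the evolved state. -/
theorem IsEvolution.norm_cov_comp_sub_le (hφ : IsEvolution h t φ) (ω : State O)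
    {A B A' B' : O.Obs} {e : ℝ} (he0 : 0 ≤ e) (he : e ≤ 2)
    (hA : ‖evo h t A - incl A'‖ ≤ e * ‖A‖) (hB : ‖evo h t B - incl B'‖ ≤ e * ‖B‖) :
    ‖cov (ω.comp φ) A B‖ ≤ ‖cov ω A' B'‖ + 8 * e * ‖A‖ * ‖B‖ := by
  rw [← hφ] at hA hB
  have hφA : ‖φ (incl A)‖ ≤ ‖A‖ := NonUnitalStarAlgHom.norm_apply_le φ (incl A)
  have hB' : ‖incl B'‖ ≤ 3 * ‖B‖ := by
    have h1 : ‖φ (incl B)‖ ≤ ‖B‖ := NonUnitalStarAlgHom.norm_apply_le φ (incl B)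
    have h2 : ‖incl B'‖ ≤ ‖φ (incl B)‖ + ‖φ (incl B) - incl B'‖ := by
      rw [← norm_neg (φ (incl B) - incl B'), neg_sub]
      exact norm_le_insert' _ _
    have h3 : e * ‖B‖ ≤ 2 * ‖B‖ := by gcongr
    linarith
  have hev : ∀ C : O.Obs, ‖ω.ev C‖ ≤ ‖incl C‖ := fun C => ω.norm_ev_le C
  have h1 : ‖(ω.comp φ).ev A - ω.ev A'‖ ≤ e * ‖A‖ := by
    rw [State.ev_comp, State.ev, ← map_sub]
    exact (ω.norm_apply_le _).trans hA
  have h2 : ‖(ω.comp φ).ev B - ω.ev B'‖ ≤ e * ‖B‖ := by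
    rw [State.ev_comp, State.ev, ← map_sub]
    exact (ω.norm_apply_le _).trans hB
  have h3 : ‖(ω.comp φ).ev (A * B) - ω.ev (A' * B')‖ ≤ 4 * e * ‖A‖ * ‖B‖ := by
    have h4 : (ω.comp φ).ev (A * B) - ω.ev (A' * B') =
        ω.toLinearMap (φ (incl A) * (φ (incl B) - incl B') +
          (φ (incl A) - incl A') * incl B') := by
      have h5 : φ (incl A) * (φ (incl B) - incl B') + (φ (incl A) - incl A') * incl B' =
          φ (incl (A * B)) - incl (A' * B') := by
        have h6 : φ (incl (A * B)) = φ (incl A) * φ (incl B) := by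
          rw [incl_eq, map_mul, map_mul]
          rfl
        have h7 : incl (A' * B') = incl A' * incl B' := rfl
        rw [h6, h7]
        noncomm_ring
      rw [h5, map_sub, State.ev_comp, State.ev]
    rw [h4]
    refine (ω.norm_apply_le _).trans ?_
    calc _ ≤ ‖φ (incl A)‖ * ‖φ (incl B) - incl B'‖ + ‖φ (incl A) - incl A'‖ * ‖incl B'‖ :=
          (norm_add_le _ _).trans (add_le_add (norm_mul_le _ _) (norm_mul_le _ _))
      _ ≤ ‖A‖ * (e * ‖B‖) + e * ‖A‖ * (3 * ‖B‖) := by gcongr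
      _ = 4 * e * ‖A‖ * ‖B‖ := by ring
  have h8 : ‖(ω.comp φ).ev A * (ω.comp φ).ev B - ω.ev A' * ω.ev B'‖ ≤ 4 * e * ‖A‖ * ‖B‖ := by
    have h9 : (ω.comp φ).ev A * (ω.comp φ).ev B - ω.ev A' * ω.ev B' =
        (ω.comp φ).ev A * ((ω.comp φ).ev B - ω.ev B') +
          ((ω.comp φ).ev A - ω.ev A') * ω.ev B' := by ring
    rw [h9]
    calc _ ≤ ‖(ω.comp φ).ev A‖ * ‖(ω.comp φ).ev B - ω.ev B'‖ +
          ‖(ω.comp φ).ev A - ω.ev A'‖ * ‖ω.ev B'‖ := by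
          refine (norm_add_le _ _).trans (le_of_eq ?_)
          rw [norm_mul, norm_mul]
      _ ≤ ‖A‖ * (e * ‖B‖) + e * ‖A‖ * (3 * ‖B‖) := by
          have h10 := (ω.comp φ).norm_ev_le A
          have h11 := (hev B').trans hB'
          gcongr
      _ = 4 * e * ‖A‖ * ‖B‖ := by ring
  have h12 : cov (ω.comp φ) A B = cov ω A' B' + (((ω.comp φ).ev (A * B) - ω.ev (A' * B')) -
      ((ω.comp φ).ev A * (ω.comp φ).ev B - ω.ev A' * ω.ev B')) := by
    rw [cov, cov]
    ring
  rw [h12]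
  refine (norm_add_le _ _).trans ?_
  have h13 := norm_sub_le ((ω.comp φ).ev (A * B) - ω.ev (A' * B'))
    ((ω.comp φ).ev A * (ω.comp φ).ev B - ω.ev A' * ω.ev B')
  linarith

end Evolved

theorem supportedIn_evoPartial {h : O.Obs} {R : ℕ}
    (hR : ∀ (n : ℕ) (X : Finset (Site D)) (A : O.Obs), SupportedIn X (A : Op D d) →
      SupportedIn (thicken X (n * R)) ((lieₗ h ^ n) A : Op D d))
    (t : ℝ) (N : ℕ) {X : Finset (Site D)} {A : O.Obs} (hA : SupportedIn X (A : Op D d)) :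
    SupportedIn (thicken X (N * R)) (evoPartial h t N A : Op D d) := by
  rw [evoPartial_apply]
  refine SupportedIn.sum fun n hn => ?_
  rw [evoTerm_apply]
  have h1 : SupportedIn (thicken X (N * R)) ((lieₗ h ^ n) A : Op D d) :=
    (hR n X A hA).mono (thicken_mono (Nat.mul_le_mul_right _ (Finset.mem_range.1 hn).le))
  exact h1.smul _

/-- Clustering for observables supported in neighbourhoods of the supports of `A` and `B` that are
small compared with the distance of these supports. -/
theorem norm_cov_thicken_le [NeZero d] {ω : State O} {p ν a : ℝ} {f : ℕ → ℝ} (hp : 0 ≤ p)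
    (hν : 0 ≤ ν) (hf : AlgebraicDecay p f) (hb : ClusteringBound ω (fun l => ν * (l : ℝ) ^ a) f)
    {X Y : Finset (Site D)} {A' B' : O.Obs} {l n M : ℕ} (hX : X.card < l) (hY : Y.card < l)
    (hn : 0 < n) (hnM : 4 * M ≤ n) (hdist : ∀ u ∈ X, ∀ v ∈ Y, n ≤ latticeDist u v)
    (hA : SupportedIn (thicken X M) (A' : Op D d)) (hB : SupportedIn (thicken Y M) (B' : Op D d)) :
    ‖cov ω A' B'‖ ≤ ν * ((l * (2 * M + 1) ^ D + 1 : ℕ) : ℝ) ^ a * ‖A'‖ * ‖B'‖ *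
      (2 ^ p * (n : ℝ) ^ (-p)) := by
  have hnonneg : 0 ≤ ν * ((l * (2 * M + 1) ^ D + 1 : ℕ) : ℝ) ^ a * ‖A'‖ * ‖B'‖ *
      (2 ^ p * (n : ℝ) ^ (-p)) := by positivity
  rcases obsDist_cases A' B' with ⟨c, hc⟩ | ⟨c, hc⟩ | ⟨u, hu, v, hv, huv, -⟩
  · rw [hc, cov_one_left, norm_zero, ← hc]
    exact hnonneg
  · rw [hc, cov_one_right, norm_zero, ← hc]
    exact hnonneg
  obtain ⟨u₀, hu₀, hu'⟩ := mem_thicken.1 (suppF_subset hA hu)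
  obtain ⟨v₀, hv₀, hv'⟩ := mem_thicken.1 (suppF_subset hB hv)
  have h1 := hdist u₀ hu₀ v₀ hv₀
  have h2 := latticeDist_triangle u₀ u v₀
  have h3 := latticeDist_triangle u v v₀
  rw [latticeDist_comm u₀ u] at h2
  have hm : n ≤ 2 * latticeDist u v := by omega
  have hm0 : 0 < latticeDist u v := by omega
  have hsize : ∀ {Z : Finset (Site D)} {C : O.Obs}, Z.card < l →
      SupportedIn (thicken Z M) (C : Op D d) → size C < l * (2 * M + 1) ^ D + 1 := by
    intro Z C hZ hC
    rw [size_eq]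
    have h4 := Finset.card_le_card (suppF_subset hC)
    have h5 := card_thicken_le Z M
    have h6 : Z.card * (2 * M + 1) ^ D ≤ l * (2 * M + 1) ^ D := Nat.mul_le_mul_right _ hZ.le
    omega
  have h7 := hb _ A' B' (hsize hX hA) (hsize hY hB) _ huv
  refine h7.trans ?_
  have hf0 := (hf.1 (latticeDist u v)).le
  gcongr
  refine (hf.2 _ hm0).trans ?_
  have h8 : (2 : ℝ) ^ p * (n : ℝ) ^ (-p) = ((n : ℝ) / 2) ^ (-p) := by
    rw [Real.div_rpow (by positivity) (by norm_num), Real.rpow_neg (by norm_num : (0 : ℝ) ≤ 2),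
      div_inv_eq_mul, mul_comm]
  rw [h8]
  have hn' : (0 : ℝ) < n := by exact_mod_cast hn
  have hm' : (n : ℝ) ≤ 2 * latticeDist u v := by exact_mod_cast hm
  exact Real.rpow_le_rpow_of_nonpos (by positivity) (by linarith) (by linarith)

/-- The order at which the evolution series is truncated: it compensates the factor exponential in
the size `l` of the observables, and is otherwise only logarithmic in their distance `n`. -/
def truncationOrder (K l n : ℕ) : ℕ := l + K * (Nat.log 2 n + 1)

theorem two_pow_mul_le {p : ℝ} {K l n : ℕ} (hK : p ≤ K) (hn : 0 < n) :
    (2 : ℝ) ^ l * (1 / 8) ^ truncationOrder K l n ≤ (n : ℝ) ^ (-p) := by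
  have hn1 : (1 : ℝ) ≤ n := by exact_mod_cast hn
  have h1 : (n : ℝ) ≤ 2 ^ (Nat.log 2 n + 1) := by
    exact_mod_cast (Nat.lt_pow_succ_log_self (by norm_num) n).le
  calc (2 : ℝ) ^ l * (1 / 8) ^ truncationOrder K l n
      ≤ 2 ^ l * (1 / 2) ^ truncationOrder K l n := by
        gcongr
        norm_num
    _ = ((2 ^ (Nat.log 2 n + 1)) ^ K)⁻¹ := by
        rw [truncationOrder, pow_add, ← mul_assoc, ← mul_pow, mul_comm K, pow_mul,
          mul_one_div_cancel (by norm_num), one_pow, one_mul, one_div, inv_pow, inv_pow]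
    _ ≤ ((n : ℝ) ^ K)⁻¹ := by gcongr
    _ = (n : ℝ) ^ (-(K : ℝ)) := by
        rw [Real.rpow_neg (by positivity), Real.rpow_natCast]
    _ ≤ (n : ℝ) ^ (-p) := Real.rpow_le_rpow_of_exponent_le hn1 (by linarith)

theorem exists_truncationOrder_le (K R : ℕ) {δ : ℝ} (hδ : 0 < δ) : ∃ C : ℝ, 1 ≤ C ∧
    ∀ l n : ℕ, 0 < l → 0 < n →
      2 * ((truncationOrder K l n * R : ℕ) : ℝ) + 1 ≤ C * l * (n : ℝ) ^ δ := by
  refine ⟨2 * R * (1 + K * (2 / δ + 1)) + 1, ?_, fun l n hl hn => ?_⟩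
  · have : 0 ≤ 2 * R * (1 + K * (2 / δ + 1)) := by positivity
    linarith
  have hl1 : (1 : ℝ) ≤ l := by exact_mod_cast hl
  have hn1 : (1 : ℝ) ≤ n := by exact_mod_cast hn
  have hnδ : (1 : ℝ) ≤ (n : ℝ) ^ δ := Real.one_le_rpow hn1 hδ.le
  have hlog : (Nat.log 2 n : ℝ) ≤ 2 / δ * (n : ℝ) ^ δ := by
    have h1 : ((2 : ℝ) ^ Nat.log 2 n) ≤ n := by exact_mod_cast Nat.pow_log_le_self 2 hn.ne'
    have h2 := Real.log_le_log (by positivity) h1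
    rw [Real.log_pow] at h2
    have h3 : Real.log n ≤ (n : ℝ) ^ δ / δ := Real.log_le_rpow_div (by positivity) hδ
    have h4 : (1 / 2 : ℝ) ≤ Real.log 2 := by
      have := Real.log_two_gt_d9
      linarith
    have h5 : (Nat.log 2 n : ℝ) * (1 / 2) ≤ Nat.log 2 n * Real.log 2 := by gcongr
    calc (Nat.log 2 n : ℝ) = 2 * (Nat.log 2 n * (1 / 2)) := by ring
      _ ≤ 2 * ((n : ℝ) ^ δ / δ) := by linarith
      _ = 2 / δ * (n : ℝ) ^ δ := by ring
  have hln : (1 : ℝ) ≤ l * (n : ℝ) ^ δ := one_le_mul_of_one_le_of_one_le hl1 hnδ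
  have h6 : (truncationOrder K l n : ℝ) ≤ (1 + K * (2 / δ + 1)) * (l * (n : ℝ) ^ δ) := by
    rw [truncationOrder]
    push_cast
    have h7 : (l : ℝ) ≤ l * (n : ℝ) ^ δ := le_mul_of_one_le_right (by positivity) hnδ
    have h8 : (Nat.log 2 n : ℝ) + 1 ≤ (2 / δ + 1) * (l * (n : ℝ) ^ δ) := by
      have h9 : 2 / δ * (n : ℝ) ^ δ ≤ 2 / δ * (l * (n : ℝ) ^ δ) := by
        gcongr
        exact le_mul_of_one_le_left (by positivity) hl1
      rw [add_mul, one_mul]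
      linarith
    have h10 : (K : ℝ) * (Nat.log 2 n + 1) ≤ K * ((2 / δ + 1) * (l * (n : ℝ) ^ δ)) := by gcongr
    linarith
  push_cast
  have h11 : 2 * ((truncationOrder K l n : ℝ) * R) ≤
      2 * R * ((1 + K * (2 / δ + 1)) * (l * (n : ℝ) ^ δ)) := by
    calc 2 * ((truncationOrder K l n : ℝ) * R) = 2 * R * truncationOrder K l n := by ring
      _ ≤ _ := by gcongr
  linarith

/-- Far apart observables: growth of the supports under truncation at logarithmic order costs an
arbitrarily small power of the distance. -/
theorem far_estimate {p p' a δ C2 : ℝ} (ha : 0 < a) (hδ0 : 0 < δ) (hC2 : 1 ≤ C2)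
    (hδ : δ * D * a ≤ p - p') {l n M : ℕ} (hl : 0 < l) (hn : 0 < n)
    (hM : 2 * (M : ℝ) + 1 ≤ C2 * l * (n : ℝ) ^ δ) :
    ((l * (2 * M + 1) ^ D + 1 : ℕ) : ℝ) ^ a * (n : ℝ) ^ (-p) ≤
      (C2 ^ D + 1) ^ a * (l : ℝ) ^ ((D + 1) * a) * (n : ℝ) ^ (-p') := by
  have hl1 : (1 : ℝ) ≤ l := by exact_mod_cast hl
  have hn1 : (1 : ℝ) ≤ n := by exact_mod_cast hn
  have hn0 : (0 : ℝ) < n := by linarith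
  have hnδ : (1 : ℝ) ≤ (n : ℝ) ^ δ := Real.one_le_rpow hn1 hδ0.le
  have hbase : ((l * (2 * M + 1) ^ D + 1 : ℕ) : ℝ) ≤
      (C2 ^ D + 1) * (l : ℝ) ^ (D + 1) * ((n : ℝ) ^ δ) ^ D := by
    push_cast
    have h1 : (l : ℝ) * (2 * (M : ℝ) + 1) ^ D ≤ l * (C2 * l * (n : ℝ) ^ δ) ^ D := by gcongr
    have h2 : (1 : ℝ) ≤ (l : ℝ) ^ (D + 1) * ((n : ℝ) ^ δ) ^ D :=
      one_le_mul_of_one_le_of_one_le (one_le_pow₀ hl1) (one_le_pow₀ hnδ)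
    have h3 : (l : ℝ) * (C2 * l * (n : ℝ) ^ δ) ^ D =
        C2 ^ D * ((l : ℝ) ^ (D + 1) * ((n : ℝ) ^ δ) ^ D) := by
      rw [mul_pow, mul_pow, pow_succ]
      ring
    rw [mul_assoc (C2 ^ D + 1), add_mul, one_mul]
    linarith
  have h4 := Real.rpow_le_rpow (by positivity) hbase ha.le
  have h5 : ((C2 ^ D + 1) * (l : ℝ) ^ (D + 1) * ((n : ℝ) ^ δ) ^ D) ^ a =
      (C2 ^ D + 1) ^ a * (l : ℝ) ^ ((D + 1) * a) * (n : ℝ) ^ (δ * D * a) := by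
    rw [Real.mul_rpow (by positivity) (by positivity), Real.mul_rpow (by positivity) (by positivity),
      ← Real.rpow_natCast (l : ℝ), ← Real.rpow_mul (by positivity),
      ← Real.rpow_natCast ((n : ℝ) ^ δ), ← Real.rpow_mul (by positivity),
      ← Real.rpow_mul (by positivity)]
    push_cast
    ring_nf
  rw [h5] at h4
  calc _ ≤ (C2 ^ D + 1) ^ a * (l : ℝ) ^ ((D + 1) * a) * (n : ℝ) ^ (δ * D * a) * (n : ℝ) ^ (-p) := by
        gcongr
    _ = (C2 ^ D + 1) ^ a * (l : ℝ) ^ ((D + 1) * a) * (n : ℝ) ^ (δ * D * a + -p) := by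
        rw [Real.rpow_add hn0]
        ring
    _ ≤ _ := by
        gcongr
        linarith

/-- Observables whose distance is comparable with the range of the truncated evolution are at a
distance bounded by a power of their size. -/
theorem near_estimate {p' δ C2 : ℝ} (hp' : 0 < p') (hδ2 : δ ≤ 1 / 2) (hC2 : 1 ≤ C2)
    {l n M : ℕ} (hl : 0 < l) (hn : 0 < n) (hM : 2 * (M : ℝ) + 1 ≤ C2 * l * (n : ℝ) ^ δ)
    (hnM : n < 4 * M) :
    1 ≤ (2 * C2) ^ (2 * p') * (l : ℝ) ^ (2 * p') * (n : ℝ) ^ (-p') := by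
  have hl1 : (1 : ℝ) ≤ l := by exact_mod_cast hl
  have hn1 : (1 : ℝ) ≤ n := by exact_mod_cast hn
  have hn0 : (0 : ℝ) < n := by linarith
  have h1 : (n : ℝ) ≤ 2 * C2 * l * (n : ℝ) ^ (1 / 2 : ℝ) := by
    have h2 : (n : ℝ) ≤ 4 * M := by exact_mod_cast hnM.le
    have h3 : (n : ℝ) ^ δ ≤ (n : ℝ) ^ (1 / 2 : ℝ) := Real.rpow_le_rpow_of_exponent_le hn1 hδ2
    have h4 : C2 * l * (n : ℝ) ^ δ ≤ C2 * l * (n : ℝ) ^ (1 / 2 : ℝ) := by gcongr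
    linarith
  have h5 : (n : ℝ) = (n : ℝ) ^ (1 / 2 : ℝ) * (n : ℝ) ^ (1 / 2 : ℝ) := by
    rw [← Real.rpow_add hn0]
    norm_num
  have h6 : (n : ℝ) ^ (1 / 2 : ℝ) ≤ 2 * C2 * l := by
    have h7 : 0 < (n : ℝ) ^ (1 / 2 : ℝ) := Real.rpow_pos_of_pos hn0 _
    refine le_of_mul_le_mul_right ?_ h7
    rwa [← h5]
  have h8 : (n : ℝ) ^ p' ≤ (2 * C2 * l) ^ (2 * p') := by
    calc (n : ℝ) ^ p' = ((n : ℝ) ^ (1 / 2 : ℝ)) ^ (2 * p') := by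
          rw [← Real.rpow_mul hn0.le]
          congr 1
          ring
      _ ≤ _ := Real.rpow_le_rpow (by positivity) h6 (by positivity)
  rw [Real.rpow_neg hn0.le, ← Real.mul_rpow (by positivity) (by positivity), ← div_eq_mul_inv,
    one_le_div (Real.rpow_pos_of_pos hn0 _)]
  exact h8

/-- The small-time evolution of uniformly sizably clustering states is uniformly sizably clustering,
with a decay exponent that is smaller by an arbitrarily small amount. -/
theorem exists_isSizablyClusteringWith_comp [NeZero d] (hD : 1 ≤ D) (h : O.Obs) {t : ℝ}
    (ht : |t| ≤ evoRadius h) {p p' ν a : ℝ} (hp' : (D : ℝ) < p') (hpp : p' < p) (hν : 0 < ν)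
    (ha : 0 < a) : ∃ ν' a' : ℝ, 0 < ν' ∧ 0 < a' ∧ ∀ (ω : State O) (φ : O.Quasi →⋆ₐ[ℂ] O.Quasi),
      IsEvolution h t φ → IsSizablyClusteringWith p ν a ω →
        IsSizablyClusteringWith p' ν' a' (ω.comp φ) := by
  have hD' : (1 : ℝ) ≤ D := by exact_mod_cast hD
  have hp'0 : 0 < p' := by linarith
  have hp0 : 0 < p := by linarith
  obtain ⟨R, hR⟩ := exists_range h
  let K := ⌈p'⌉₊
  have hK : p' ≤ K := Nat.le_ceil p'
  let δ := min (1 / 2) ((p - p') / (D * a))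
  have hδ0 : 0 < δ := lt_min (by norm_num) (div_pos (by linarith) (by positivity))
  have hδ2 : δ ≤ 1 / 2 := min_le_left _ _
  have hδ : δ * D * a ≤ p - p' := by
    have h1 : δ ≤ (p - p') / (D * a) := min_le_right _ _
    rw [le_div_iff₀ (by positivity)] at h1
    linarith
  obtain ⟨C2, hC2, htrunc⟩ := exists_truncationOrder_le K R hδ0
  let c1 := 9 * ν * (2 : ℝ) ^ p * (C2 ^ D + 1) ^ a
  let c2 := 2 * (2 * C2) ^ (2 * p')
  have hc1 : 0 < c1 := by positivity
  have hc2 : 0 < c2 := by positivity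
  refine ⟨18 + c1 + c2, (D + 1) * a + 2 * p', by positivity, by positivity, ?_⟩
  rintro ω φ hφ ⟨hinv, f, hf, hb⟩
  refine ⟨hφ.isTranslationInvariant (smallTime_of_le ht) hinv, decay p',
    ⟨decay_pos p', fun n hn => (decay_of_pos p' hn).le⟩, ?_⟩
  intro l A B hsA hsB n hdist
  change ‖cov (ω.comp φ) A B‖ ≤ _
  have hl : 0 < l := (Nat.zero_le _).trans_lt hsA
  have hl1 : (1 : ℝ) ≤ l := by exact_mod_cast hl
  have hla : (1 : ℝ) ≤ (l : ℝ) ^ ((D + 1) * a + 2 * p') := Real.one_le_rpow hl1 (by positivity)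
  have hnormAB : 0 ≤ ‖A‖ * ‖B‖ := by positivity
  -- it suffices to bound the correlation by a multiple of `‖A‖ * ‖B‖`
  suffices hmain : ‖cov (ω.comp φ) A B‖ ≤
      ((18 + c1 + c2) * (l : ℝ) ^ ((D + 1) * a + 2 * p') * decay p' n) * (‖A‖ * ‖B‖) by
    refine hmain.trans (le_of_eq ?_)
    ring
  have htriv : ‖cov (ω.comp φ) A B‖ ≤ 2 * (‖A‖ * ‖B‖) := by
    rw [← mul_assoc]
    exact norm_cov_le _ A B
  rcases Nat.eq_zero_or_pos n with rfl | hn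
  · refine htriv.trans (mul_le_mul_of_nonneg_right ?_ hnormAB)
    rw [decay_zero, mul_one]
    calc (2 : ℝ) ≤ (18 + c1 + c2) * 1 := by linarith
      _ ≤ _ := by gcongr
  rw [decay_of_pos p' hn]
  have hn1 : (1 : ℝ) ≤ n := by exact_mod_cast hn
  have hn0 : (0 : ℝ) < n := by linarith
  have hnp : 0 < (n : ℝ) ^ (-p') := Real.rpow_pos_of_pos hn0 _
  set N := truncationOrder K l n with hN
  have hM := htrunc l n hl hn
  rw [← hN] at hM
  have hl2 : (l : ℝ) ^ (2 * p') ≤ (l : ℝ) ^ ((D + 1) * a + 2 * p') :=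
    Real.rpow_le_rpow_of_exponent_le hl1 (by nlinarith)
  have hl3 : (l : ℝ) ^ ((D + 1) * a) ≤ (l : ℝ) ^ ((D + 1) * a + 2 * p') :=
    Real.rpow_le_rpow_of_exponent_le hl1 (by linarith)
  rcases lt_or_ge n (4 * (N * R)) with hnM | hnM
  · refine htriv.trans (mul_le_mul_of_nonneg_right ?_ hnormAB)
    have h1 := near_estimate hp'0 hδ2 hC2 hl hn hM hnM
    calc (2 : ℝ) ≤ 2 * ((2 * C2) ^ (2 * p') * (l : ℝ) ^ (2 * p') * (n : ℝ) ^ (-p')) := by linarith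
      _ = c2 * (l : ℝ) ^ (2 * p') * (n : ℝ) ^ (-p') := by
          simp only [c2]
          ring
      _ ≤ _ := by
          gcongr
          linarith
  · have hXA := supportedIn_suppF A
    have hXB := supportedIn_suppF B
    rw [size_eq] at hsA hsB
    have herr : ∀ C : O.Obs, (suppF C).card < l →
        ‖evo h t C - incl (evoPartial h t N C)‖ ≤ 2 * (n : ℝ) ^ (-p') * ‖C‖ := by
      intro C hC
      refine ((smallTime_of_le ht).norm_evo_sub_evoPartial_le N (supportedIn_suppF C)).trans ?_
      have h1 : (|t| * lieRate h) ^ N ≤ (1 / 8) ^ N :=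
        pow_le_pow_left₀ (mul_nonneg (abs_nonneg t) (lieRate_pos h).le) (mul_lieRate_le ht) N
      have h0 : 0 ≤ (|t| * lieRate h) ^ N :=
        pow_nonneg (mul_nonneg (abs_nonneg t) (lieRate_pos h).le) N
      calc 2 ^ (suppF C).card * 2 * ‖C‖ * (|t| * lieRate h) ^ N
          ≤ 2 ^ l * 2 * ‖C‖ * (1 / 8) ^ N := by
            gcongr
            norm_num
        _ = 2 * (2 ^ l * (1 / 8) ^ N) * ‖C‖ := by ring
        _ ≤ 2 * (n : ℝ) ^ (-p') * ‖C‖ := by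
            gcongr
            exact two_pow_mul_le hK hn
    have hnp1 : (n : ℝ) ^ (-p') ≤ 1 := Real.rpow_le_one_of_one_le_of_nonpos hn1 (by linarith)
    have happrox := hφ.norm_cov_comp_sub_le ω (by positivity) (by linarith)
      (herr A hsA) (herr B hsB)
    have hnorm : ∀ C : O.Obs, (suppF C).card < l → ‖evoPartial h t N C‖ ≤ 3 * ‖C‖ := by
      intro C hC
      have h1 : ‖evo h t C‖ ≤ ‖C‖ := by
        rw [← hφ]
        exact NonUnitalStarAlgHom.norm_apply_le φ (incl C)
      have h2 : ‖incl (evoPartial h t N C)‖ ≤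
          ‖evo h t C‖ + ‖evo h t C - incl (evoPartial h t N C)‖ := by
        rw [← norm_neg (evo h t C - incl (evoPartial h t N C)), neg_sub]
        exact norm_le_insert' _ _
      have h3 : 2 * (n : ℝ) ^ (-p') * ‖C‖ ≤ 2 * 1 * ‖C‖ := by gcongr
      rw [norm_incl] at h2
      linarith [herr C hC]
    have hd : ∀ u ∈ suppF A, ∀ v ∈ suppF B, n ≤ latticeDist u v := by
      intro u hu v hv
      have h1 : obsDist A B ≤ latticeDist u v :=
        (iInf₂_le u (mem_suppF.1 hu)).trans (iInf₂_le v (mem_suppF.1 hv))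
      rw [hdist] at h1
      exact_mod_cast h1
    have hfar := norm_cov_thicken_le hp0.le hν.le hf hb hsA hsB hn hnM hd
      (supportedIn_evoPartial hR t N hXA) (supportedIn_evoPartial hR t N hXB)
    have hest := far_estimate ha hδ0 hC2 hδ hl hn hM
    refine happrox.trans ?_
    have h9 : ‖cov ω (evoPartial h t N A) (evoPartial h t N B)‖ ≤
        c1 * (l : ℝ) ^ ((D + 1) * a) * (n : ℝ) ^ (-p') * (‖A‖ * ‖B‖) := by
      refine hfar.trans ?_
      calc _ ≤ ν * ((l * (2 * (N * R) + 1) ^ D + 1 : ℕ) : ℝ) ^ a * (3 * ‖A‖) * (3 * ‖B‖) *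
            (2 ^ p * (n : ℝ) ^ (-p)) := by
            gcongr
            · exact hnorm A hsA
            · exact hnorm B hsB
        _ = 9 * ν * 2 ^ p * (((l * (2 * (N * R) + 1) ^ D + 1 : ℕ) : ℝ) ^ a * (n : ℝ) ^ (-p)) *
            (‖A‖ * ‖B‖) := by ring
        _ ≤ 9 * ν * 2 ^ p * ((C2 ^ D + 1) ^ a * (l : ℝ) ^ ((D + 1) * a) * (n : ℝ) ^ (-p')) *
            (‖A‖ * ‖B‖) := by gcongr
        _ = _ := by
            simp only [c1]
            ring
    calc _ ≤ c1 * (l : ℝ) ^ ((D + 1) * a) * (n : ℝ) ^ (-p') * (‖A‖ * ‖B‖) +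
          8 * (2 * (n : ℝ) ^ (-p')) * ‖A‖ * ‖B‖ := by gcongr
      _ = (c1 * (l : ℝ) ^ ((D + 1) * a) + 16 * 1) * (n : ℝ) ^ (-p') * (‖A‖ * ‖B‖) := by ring
      _ ≤ (c1 * (l : ℝ) ^ ((D + 1) * a + 2 * p') + 16 * (l : ℝ) ^ ((D + 1) * a + 2 * p')) *
          (n : ℝ) ^ (-p') * (‖A‖ * ‖B‖) := by gcongr
      _ = (16 + c1) * (l : ℝ) ^ ((D + 1) * a + 2 * p') * (n : ℝ) ^ (-p') * (‖A‖ * ‖B‖) := by ring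
      _ ≤ (18 + c1 + c2) * (l : ℝ) ^ ((D + 1) * a + 2 * p') * (n : ℝ) ^ (-p') * (‖A‖ * ‖B‖) := by
          have h10 : 16 + c1 ≤ 18 + c1 + c2 := by linarith
          gcongr ?_ * _ * _ * _
      _ = _ := by ring

theorem IsSizablyClusteringWith.isClustering {p ν a : ℝ} (hp : (D : ℝ) < p) (hν : 0 < ν)
    {ω : State O} (h : IsSizablyClusteringWith p ν a ω) : IsClustering ω := by
  obtain ⟨hinv, f, hf, hb⟩ := h
  refine ⟨hinv, p, hp, fun l => ν * (l : ℝ) ^ a + 1, f, fun l => by positivity, hf, ?_⟩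
  intro l A B hA hB n hn
  refine (hb l A B hA hB n hn).trans ?_
  have := (hf.1 n).le
  gcongr
  linarith

/-! ### Invariance of the trace state -/

theorem IsTraceState.ev_mul_comm {ω : State O} (hω : IsTraceState ω) (A B : O.Obs) :
    ω.ev (A * B) = ω.ev (B * A) := by
  classical
  obtain ⟨X, hX⟩ := O.isLocal A A.2
  obtain ⟨Y, hY⟩ := O.isLocal B B.2
  obtain ⟨M, hM⟩ := hX.mono (Finset.subset_union_left (s₂ := Y))
  obtain ⟨N, hN⟩ := hY.mono (Finset.subset_union_right (s₁ := X))
  rw [hω _ _ (A * B) (hM.mul hN), hω _ _ (B * A) (hN.mul hM), Matrix.trace_mul_comm]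

theorem IsTraceState.ev_lieAction {ω : State O} (hω : IsTraceState ω) (h A : O.Obs) :
    ω.ev (lieAction h A) = 0 := by
  obtain ⟨S, hS⟩ := O.isLocal h h.2
  obtain ⟨X, hX⟩ := O.isLocal A A.2
  rw [lieAction_eq_sum hS hX subset_rfl, ω.ev_sum]
  refine Finset.sum_eq_zero fun x _ => ?_
  rw [ω.ev_sub, hω.ev_mul_comm, sub_self]

theorem IsTraceState.ev_evoPartial_succ {ω : State O} (hω : IsTraceState ω) (h : O.Obs) (t : ℝ)
    (N : ℕ) (A : O.Obs) : ω.ev (evoPartial h t (N + 1) A) = ω.ev A := by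
  rw [evoPartial_apply, ω.ev_sum, Finset.sum_range_succ', evoTerm_zero,
    Finset.sum_eq_zero fun n _ => ?_, zero_add]
  have h1 : (lieₗ h ^ (n + 1)) A = lieAction h ((lieₗ h ^ n) A) := by
    rw [pow_succ']
    rfl
  rw [evoTerm_apply, ω.ev_smul, h1, hω.ev_lieAction, mul_zero]

theorem IsTraceState.comp [NeZero d] {h : O.Obs} {t : ℝ} {φ : O.Quasi →⋆ₐ[ℂ] O.Quasi}
    (hφ : IsEvolution h t φ) (ht : SmallTime h t) {ω : State O} (hω : IsTraceState ω) :
    IsTraceState (ω.comp φ) := by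
  intro X M A hA
  rw [← hω X M A hA]
  refine tendsto_nhds_unique ((tendsto_add_atTop_iff_nat 1).2 (hφ.tendsto_ev ht ω A)) ?_
  simp only [hω.ev_evoPartial_succ]
  exact tendsto_const_nhds

/-! ### Susceptibilities of the evolved states -/

theorem summable_card_thicken_pow (X : Finset (Site D)) (R k : ℕ) :
    Summable fun N : ℕ => (((thicken X ((N + 1) * R)).card : ℝ) + 1) ^ k * (1 / 4) ^ N := by
  have h1 : Summable fun N : ℕ => ((N : ℝ) ^ (D * k)) * (1 / 4 : ℝ) ^ N :=
    summable_pow_mul_geometric_of_norm_lt_one (D * k) (by norm_num)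
  have h2 := ((summable_nat_add_iff 1).2 h1).mul_left
    ((((X.card : ℝ) + 1) * (2 * R + 1) ^ D) ^ k * 4)
  refine Summable.of_nonneg_of_le (fun N => by positivity) (fun N => ?_) h2
  have h3 : ((thicken X ((N + 1) * R)).card : ℝ) + 1 ≤
      ((X.card : ℝ) + 1) * (2 * R + 1) ^ D * ((N + 1 : ℕ) : ℝ) ^ D := by
    have h4 : ((thicken X ((N + 1) * R)).card : ℝ) ≤
        X.card * (2 * (((N : ℝ) + 1) * R) + 1) ^ D := by
      exact_mod_cast card_thicken_le X ((N + 1) * R)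
    have h5 : (2 * (((N : ℝ) + 1) * R) + 1) ^ D ≤ ((2 * (R : ℝ) + 1) * (N + 1)) ^ D := by
      have : (0 : ℝ) ≤ N := Nat.cast_nonneg N
      gcongr
      linarith
    have h6 : 1 ≤ (2 * (((N : ℝ) + 1) * R) + 1) ^ D := by
      refine one_le_pow₀ ?_
      have : 0 ≤ ((N : ℝ) + 1) * R := by positivity
      linarith
    calc ((thicken X ((N + 1) * R)).card : ℝ) + 1
        ≤ (X.card + 1) * (2 * (((N : ℝ) + 1) * R) + 1) ^ D := by linarith
      _ ≤ (X.card + 1) * ((2 * (R : ℝ) + 1) * (N + 1)) ^ D := by gcongr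
      _ = _ := by
        rw [mul_pow, ← mul_assoc]
        push_cast
        rfl
  calc (((thicken X ((N + 1) * R)).card : ℝ) + 1) ^ k * (1 / 4) ^ N
      ≤ (((X.card : ℝ) + 1) * (2 * R + 1) ^ D * ((N + 1 : ℕ) : ℝ) ^ D) ^ k * (1 / 4) ^ N := by
        gcongr
    _ = _ := by
        rw [mul_pow _ (((N + 1 : ℕ) : ℝ) ^ D), ← pow_mul, pow_succ]
        ring

/-- Sizable clustering with constants `ν`, `a` bounds correlations with a size dependence that is
the same for all states with these constants. -/
theorem IsSizablyClusteringWith.covBound [NeZero d] {p ν a : ℝ} (hν : 0 < ν)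
    {ω : State O} (h : IsSizablyClusteringWith p ν a ω) :
    CovBound ω p fun l => (ν + 2) * ((l : ℝ) + 1) ^ ⌈a⌉₊ := by
  obtain ⟨-, f, hf, hb⟩ := h
  intro l X Y A B hX hY hA hB
  refine (hb.covBound hf (fun l => by positivity) l X Y A B hX hY hA hB).trans ?_
  have h0 : 0 ≤ ∑ u ∈ X, ∑ v ∈ Y, decay p (latticeDist u v) :=
    Finset.sum_nonneg fun u _ => Finset.sum_nonneg fun v _ => (decay_pos _ _).le
  have h1 : (1 : ℝ) ≤ (l : ℝ) + 1 := by
    have : (0 : ℝ) ≤ l := Nat.cast_nonneg l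
    linarith
  have h2 : ((l : ℝ) + 1) ^ a ≤ ((l : ℝ) + 1) ^ ⌈a⌉₊ := by
    rw [← Real.rpow_natCast]
    exact Real.rpow_le_rpow_of_exponent_le h1 (Nat.le_ceil a)
  have h3 : (1 : ℝ) ≤ ((l : ℝ) + 1) ^ ⌈a⌉₊ := one_le_pow₀ h1
  have h4 : ν * ((l + 1 : ℕ) : ℝ) ^ a + 2 ≤ (ν + 2) * ((l : ℝ) + 1) ^ ⌈a⌉₊ := by
    push_cast
    nlinarith
  gcongr

theorem symNorm_le_of_covBound {ω : State O} (hinv : IsTranslationInvariant ω) {p c : ℝ} {k : ℕ}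
    (hp : (D : ℝ) < p) (hc : 0 ≤ c) (hC : CovBound ω p fun l => c * ((l : ℝ) + 1) ^ k)
    {X : Finset (Site D)} {A : O.Obs} (hA : SupportedIn X (A : Op D d)) :
    symNorm ω A ≤ (1 + c * ∑' z : Site D, decay p (latticeDist z 0)) *
      ((X.card : ℝ) + 1) ^ (k + 2) * ‖A‖ := by
  set Φ := ∑' z : Site D, decay p (latticeDist z 0)
  have hΦ : 0 ≤ Φ := tsum_nonneg fun z => (decay_pos _ _).le
  set G := (X.card : ℝ) + 1 with hG
  have hG1 : 1 ≤ G := by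
    have : (0 : ℝ) ≤ X.card := Nat.cast_nonneg _
    linarith
  have hGk : 1 ≤ G ^ (k + 2) := one_le_pow₀ hG1
  have key : ∀ B : O.Obs, SupportedIn X (B : Op D d) → ‖B‖ = ‖A‖ →
      (susc ω B B).re ≤ c * Φ * G ^ (k + 2) * ‖A‖ ^ 2 := by
    intro B hB hBA
    have h1 := norm_susc_le hinv hp hC le_rfl le_rfl hB hB
    rw [hBA] at h1
    refine (Complex.re_le_norm _).trans (h1.trans ?_)
    calc c * G ^ k * ‖A‖ * ‖A‖ * (X.card * (X.card * Φ))
        ≤ c * G ^ k * ‖A‖ * ‖A‖ * (G * (G * Φ)) := by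
          have : (X.card : ℝ) ≤ G := by linarith
          gcongr
      _ = _ := by ring
  have hcΦ : 0 ≤ c * Φ := mul_nonneg hc hΦ
  rw [symNorm]
  refine Real.sqrt_le_iff.2 ⟨by positivity, ?_⟩
  have h2 := key A hA rfl
  have h3 := key (star A) hA.star (norm_star (A : Op D d))
  rw [symSusc_self_re]
  calc _ ≤ c * Φ * G ^ (k + 2) * ‖A‖ ^ 2 := by linarith
    _ ≤ (1 + c * Φ) ^ 2 * (G ^ (k + 2)) ^ 2 * ‖A‖ ^ 2 := by
      have h4 : c * Φ ≤ (1 + c * Φ) ^ 2 := by nlinarith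
      have h5 : G ^ (k + 2) ≤ (G ^ (k + 2)) ^ 2 := by nlinarith
      gcongr
    _ = _ := by ring

theorem SmallTime.norm_evoPartial_le [NeZero d] {h : O.Obs} {t : ℝ} (ht : SmallTime h t) (N : ℕ)
    {X : Finset (Site D)} {A : O.Obs} (hA : SupportedIn X (A : Op D d)) :
    ‖evoPartial h t N A‖ ≤ 2 ^ X.card * ‖A‖ * 2 := by
  rw [evoPartial_apply]
  refine (norm_sum_le_of_le _ fun n _ => ht.norm_evoTerm_le n hA).trans ?_
  rw [← Finset.mul_sum]
  have h1 : ∑ n ∈ Finset.range N, (1 / 4 : ℝ) ^ n ≤ 2 := by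
    refine ((summable_geometric_of_lt_one (by norm_num) (by norm_num)).sum_le_tsum _
      fun n _ => by positivity).trans ?_
    rw [tsum_geometric_of_lt_one (by norm_num) (by norm_num)]
    norm_num
  gcongr

/-- Convergence of sums whose terms have absolutely summable increments. -/
theorem tendsto_tsum_of_summable_increments {ι : Type*} {F : ℕ → ι → ℂ} {F' : ι → ℂ}
    {w : ℕ → ι → ℝ} {S : ℕ → ℝ} (h0 : ∀ x, F 0 x = 0) (hw0 : ∀ n x, 0 ≤ w n x)
    (hw : ∀ n, HasSum (w n) (S n)) (hS : Summable S) (hF : ∀ n x, ‖F (n + 1) x - F n x‖ ≤ w n x)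
    (hlim : ∀ x, Tendsto (fun n => F n x) atTop (𝓝 (F' x))) :
    Tendsto (fun n => ∑' x, F n x) atTop (𝓝 (∑' x, F' x)) := by
  have h1 : Summable fun q : ℕ × ι => w q.1 q.2 := by
    refine (summable_prod_of_nonneg fun q => hw0 q.1 q.2).2 ⟨fun n => (hw n).summable, ?_⟩
    exact hS.congr fun n => (hw n).tsum_eq.symm
  have h2 : Summable fun q : ι × ℕ => w q.2 q.1 := h1.prod_symm
  have h3 := (summable_prod_of_nonneg fun q : ι × ℕ => hw0 q.2 q.1).1 h2
  refine tendsto_tsum_of_dominated_convergence h3.2 hlim (Eventually.of_forall fun n x => ?_)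
  have h4 : F n x = ∑ i ∈ Finset.range n, (F (i + 1) x - F i x) := by
    rw [Finset.sum_range_sub (fun i => F i x), h0, sub_zero]
  rw [h4]
  exact (norm_sum_le_of_le _ fun i _ => hF i x).trans
    ((h3.1 x).sum_le_tsum _ fun i _ => hw0 i x)

theorem IsEvolution.tendsto_ev_mul [NeZero d] {h : O.Obs} {t : ℝ} {φ : O.Quasi →⋆ₐ[ℂ] O.Quasi}
    (hφ : IsEvolution h t φ) (ht : SmallTime h t) (ω : State O) (A B : O.Obs) :
    Tendsto (fun N => ω.ev (evoPartial h t N A * evoPartial h t N B)) atTop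
      (𝓝 ((ω.comp φ).ev (A * B))) := by
  have h1 : (ω.comp φ).ev (A * B) = ω.toLinearMap (evo h t A * evo h t B) := by
    rw [State.ev_comp, incl_eq, map_mul, map_mul, ← incl_eq, ← incl_eq, hφ, hφ]
  have h2 : ∀ N, incl (evoPartial h t N A * evoPartial h t N B) =
      incl (evoPartial h t N A) * incl (evoPartial h t N B) := fun N => by
    rw [incl_eq, map_mul]
    rfl
  rw [h1]
  simp only [State.ev, h2]
  have h3 : Tendsto (fun N => incl (evoPartial h t N A) * incl (evoPartial h t N B)) atTop
      (𝓝 (evo h t A * evo h t B)) := (ht.tendsto_evoPartial A).mul (ht.tendsto_evoPartial B)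
  exact (ω.continuous.tendsto _).comp h3

theorem IsEvolution.tendsto_suscTerm [NeZero d] {h : O.Obs} (hh : star h = h) {t : ℝ}
    {φ : O.Quasi →⋆ₐ[ℂ] O.Quasi} (hφ : IsEvolution h t φ) (ht : SmallTime h t) (ω : State O)
    (A B : O.Obs) (x : Site D) :
    Tendsto (fun N => suscTerm ω (evoPartial h t N A) (evoPartial h t N B) x) atTop
      (𝓝 (suscTerm (ω.comp φ) A B x)) := by
  have h1 := (hφ.tendsto_ev_mul ht ω (star (shift x A)) B).sub
    ((hφ.tendsto_ev ht ω (star A)).mul (hφ.tendsto_ev ht ω B))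
  refine h1.congr fun N => ?_
  rw [suscTerm, ← evoPartial_shift, evoPartial_star hh, evoPartial_star hh]

/-- The susceptibilities of the evolved state are the limits of those of the truncated evolution
series. -/
theorem IsEvolution.tendsto_susc [NeZero d] {h : O.Obs} (hh : star h = h) {t : ℝ}
    {φ : O.Quasi →⋆ₐ[ℂ] O.Quasi} (hφ : IsEvolution h t φ) (ht : SmallTime h t) {ω : State O}
    (hinv : IsTranslationInvariant ω) {p c : ℝ} {k : ℕ} (hp : (D : ℝ) < p) (hc : 0 ≤ c)
    (hC : CovBound ω p fun l => c * ((l : ℝ) + 1) ^ k) (A B : O.Obs) :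
    Tendsto (fun N => susc ω (evoPartial h t N A) (evoPartial h t N B)) atTop
      (𝓝 (susc (ω.comp φ) A B)) := by
  classical
  obtain ⟨X₁, hX₁⟩ := O.isLocal A A.2
  obtain ⟨X₂, hX₂⟩ := O.isLocal B B.2
  set X := X₁ ∪ X₂
  have hA : SupportedIn X (A : Op D d) := hX₁.mono Finset.subset_union_left
  have hB : SupportedIn X (B : Op D d) := hX₂.mono Finset.subset_union_right
  obtain ⟨R, hR⟩ := exists_range h
  set Φ := ∑' z : Site D, decay p (latticeDist z 0)
  have hΦ : 0 ≤ Φ := tsum_nonneg fun z => (decay_pos _ _).le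
  set E := c * (4 * (2 ^ X.card * ‖A‖) * (2 ^ X.card * ‖B‖)) with hE
  have hE0 : 0 ≤ E := by positivity
  let Y : ℕ → Finset (Site D) := fun N => thicken X ((N + 1) * R)
  have hP : ∀ (N : ℕ) (C : O.Obs), SupportedIn X (C : Op D d) →
      SupportedIn (Y N) (evoPartial h t N C : Op D d) := fun N C hC' =>
    (supportedIn_evoPartial hR t N hC').mono
      (thicken_mono (Nat.mul_le_mul_right _ (Nat.le_succ N)))
  have hP' : ∀ (N : ℕ) (C : O.Obs), SupportedIn X (C : Op D d) →
      SupportedIn (Y N) (evoPartial h t (N + 1) C : Op D d) := fun N C hC' =>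
    supportedIn_evoPartial hR t (N + 1) hC'
  have hT : ∀ (N : ℕ) (C : O.Obs), SupportedIn X (C : Op D d) →
      SupportedIn (Y N) (evoTerm h t N C : Op D d) := fun N C hC' =>
    ((hR N X C hC').mono (thicken_mono (Nat.mul_le_mul_right _ (Nat.le_succ N)))).smul _
  have hsucc : ∀ (N : ℕ) (C : O.Obs),
      evoPartial h t (N + 1) C = evoPartial h t N C + evoTerm h t N C := fun N C => by
    rw [evoPartial_apply, evoPartial_apply, Finset.sum_range_succ]
  refine tendsto_tsum_of_summable_increments
    (F := fun N x => suscTerm ω (evoPartial h t N A) (evoPartial h t N B) x)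
    (w := fun N x => E * (((Y N).card : ℝ) + 1) ^ k * (1 / 4) ^ N * pairWeight p (Y N) (Y N) x)
    (S := fun N => E * (((Y N).card : ℝ) + 1) ^ k * (1 / 4) ^ N * ((Y N).card * ((Y N).card * Φ)))
    ?_ ?_ ?_ ?_ ?_ (hφ.tendsto_suscTerm hh ht ω A B)
  · intro x
    have h1 : evoPartial h t 0 B = (0 : ℂ) • B := by
      rw [evoPartial_apply, Finset.sum_range_zero, zero_smul]
    change suscTerm ω (evoPartial h t 0 A) (evoPartial h t 0 B) x = 0
    rw [h1, suscTerm_smul_right, zero_mul]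
  · intro N x
    have := pairWeight_nonneg p (Y N) (Y N) x
    positivity
  · intro N
    exact (hasSum_pairWeight hp (Y N) (Y N)).mul_left _
  · refine Summable.of_nonneg_of_le (fun N => by positivity) (fun N => ?_)
      ((summable_card_thicken_pow X R (k + 2)).mul_left (E * Φ))
    calc E * (((Y N).card : ℝ) + 1) ^ k * (1 / 4) ^ N * ((Y N).card * ((Y N).card * Φ))
        ≤ E * (((Y N).card : ℝ) + 1) ^ k * (1 / 4) ^ N *
          ((((Y N).card : ℝ) + 1) * ((((Y N).card : ℝ) + 1) * Φ)) := by
          have : ((Y N).card : ℝ) ≤ (Y N).card + 1 := by linarith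
          gcongr
      _ = E * Φ * ((((Y N).card : ℝ) + 1) ^ (k + 2) * (1 / 4) ^ N) := by ring
  · intro N x
    have h1 : suscTerm ω (evoPartial h t (N + 1) A) (evoPartial h t (N + 1) B) x -
        suscTerm ω (evoPartial h t N A) (evoPartial h t N B) x =
        suscTerm ω (evoTerm h t N A) (evoPartial h t (N + 1) B) x +
          suscTerm ω (evoPartial h t N A) (evoTerm h t N B) x := by
      rw [hsucc N A, suscTerm_add_left, hsucc N B, suscTerm_add_right, suscTerm_add_right]
      ring
    have hw := pairWeight_nonneg p (Y N) (Y N) x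
    have h2 := norm_suscTerm_le hinv hC le_rfl le_rfl (hT N A hA) (hP' N B hB) x
    have h3 := norm_suscTerm_le hinv hC le_rfl le_rfl (hP N A hA) (hT N B hB) x
    have h4 := ht.norm_evoTerm_le N hA
    have h5 := ht.norm_evoTerm_le N hB
    have h6 := ht.norm_evoPartial_le N hA
    have h7 := ht.norm_evoPartial_le (N + 1) hB
    change ‖suscTerm ω (evoPartial h t (N + 1) A) (evoPartial h t (N + 1) B) x -
        suscTerm ω (evoPartial h t N A) (evoPartial h t N B) x‖ ≤ _
    rw [h1]
    refine (norm_add_le _ _).trans ((add_le_add h2 h3).trans ?_)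
    calc _ ≤ c * (((Y N).card : ℝ) + 1) ^ k * (2 ^ X.card * ‖A‖ * (1 / 4) ^ N) *
          (2 ^ X.card * ‖B‖ * 2) * pairWeight p (Y N) (Y N) x +
          c * (((Y N).card : ℝ) + 1) ^ k * (2 ^ X.card * ‖A‖ * 2) *
          (2 ^ X.card * ‖B‖ * (1 / 4) ^ N) * pairWeight p (Y N) (Y N) x := by gcongr
      _ = _ := by
        rw [hE]
        ring

theorem IsEvolution.tendsto_symNorm [NeZero d] {h : O.Obs} (hh : star h = h) {t : ℝ}
    {φ : O.Quasi →⋆ₐ[ℂ] O.Quasi} (hφ : IsEvolution h t φ) (ht : SmallTime h t) {ω : State O}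
    (hinv : IsTranslationInvariant ω) {p c : ℝ} {k : ℕ} (hp : (D : ℝ) < p) (hc : 0 ≤ c)
    (hC : CovBound ω p fun l => c * ((l : ℝ) + 1) ^ k) (A : O.Obs) :
    Tendsto (fun N => symNorm ω (evoPartial h t N A)) atTop (𝓝 (symNorm (ω.comp φ) A)) := by
  have h1 := (hφ.tendsto_susc hh ht hinv hp hc hC A A).add
    (hφ.tendsto_susc hh ht hinv hp hc hC (star A) (star A))
  have h2 := (Complex.continuous_re.tendsto _).comp (h1.div_const 2)
  refine ((Real.continuous_sqrt.tendsto _).comp h2).congr fun N => ?_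
  simp only [Function.comp_apply, symNorm, symSusc, evoPartial_star hh]

/-! ### Evolution of pseudolocal flows -/

theorem symNorm_nonneg (ω : State O) (A : O.Obs) : 0 ≤ symNorm ω A := Real.sqrt_nonneg _

/-- The charges of a pseudolocal flow act on the terms of the evolution series of a local
observable with a summable bound that is uniform along the flow. -/
theorem exists_summable_charge_bound [NeZero d] {h : O.Obs} {t : ℝ} (ht : SmallTime h t)
    {p K : ℝ} (hp : (D : ℝ) < p) (hK : 0 ≤ K) {Ω : ℝ → State O} {q : ℝ → O.Obs → ℂ}
    (hΩ : UniformlySizablyClustering p Ω)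
    (hq : ∀ s ∈ Set.Icc (0 : ℝ) 1, ∀ A : O.Obs, ‖q s A‖ ≤ K * symNorm (Ω s) A) (A : O.Obs) :
    ∃ b : ℕ → ℝ, Summable b ∧ ∀ s ∈ Set.Icc (0 : ℝ) 1, ∀ n, ‖q s (evoTerm h t n A)‖ ≤ b n := by
  obtain ⟨X, hA⟩ := O.isLocal A A.2
  obtain ⟨R, hR⟩ := exists_range h
  obtain ⟨ν, a, hν, -, hcl⟩ := hΩ
  set Φ := ∑' z : Site D, decay p (latticeDist z 0)
  have hΦ : 0 ≤ Φ := tsum_nonneg fun z => (decay_pos _ _).le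
  refine ⟨_, (summable_card_thicken_pow X R (⌈a⌉₊ + 2)).mul_left
    (K * ((1 + (ν + 2) * Φ) * (2 ^ X.card * ‖A‖))), fun s hs n => (hq s hs _).trans ?_⟩
  have hT : SupportedIn (thicken X ((n + 1) * R)) (evoTerm h t n A : Op D d) :=
    ((hR n X A hA).mono (thicken_mono (Nat.mul_le_mul_right _ (Nat.le_succ n)))).smul _
  have h1 := symNorm_le_of_covBound (hcl s hs).1 hp (by positivity) ((hcl s hs).covBound hν) hT
  have h2 := ht.norm_evoTerm_le n hA
  calc K * symNorm (Ω s) (evoTerm h t n A)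
      ≤ K * ((1 + (ν + 2) * Φ) * (((thicken X ((n + 1) * R)).card : ℝ) + 1) ^ (⌈a⌉₊ + 2) *
        (2 ^ X.card * ‖A‖ * (1 / 4) ^ n)) := by
        refine mul_le_mul_of_nonneg_left (h1.trans ?_) hK
        gcongr
    _ = _ := by ring

/-- The charges `A ↦ lim_N q_s(∑_{n < N} (it)ⁿ/n! (ℒH)ⁿ(A))` of the evolved flow. -/
def evolvedCharge (h : O.Obs) (t : ℝ) (q : ℝ → O.Obs → ℂ) (s : ℝ) (A : O.Obs) : ℂ :=
  limUnder atTop fun N => q s (evoPartial h t N A)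

/-- The limits in the definition of the evolved charges exist, and the values of which they are
limits are bounded uniformly along the flow. -/
theorem tendsto_evolvedCharge [NeZero d] {h : O.Obs} {t : ℝ} (ht : SmallTime h t)
    {p : ℝ} (hp : (D : ℝ) < p) {Ω : ℝ → State O} {q : ℝ → O.Obs → ℂ}
    (hΩ : UniformlySizablyClustering p Ω) (hq : IsPseudolocalFlow Ω q) (A : O.Obs) :
    ∃ M : ℝ, ∀ s ∈ Set.Icc (0 : ℝ) 1, (∀ N, ‖q s (evoPartial h t N A)‖ ≤ M) ∧
      Tendsto (fun N => q s (evoPartial h t N A)) atTop (𝓝 (evolvedCharge h t q s A)) := by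
  obtain ⟨K, hK⟩ := hq.bounded
  have hK' : ∀ s ∈ Set.Icc (0 : ℝ) 1, ∀ A : O.Obs, ‖q s A‖ ≤ |K| * symNorm (Ω s) A :=
    fun s hs A => (hK s hs A).trans
      (mul_le_mul_of_nonneg_right (le_abs_self K) (symNorm_nonneg _ _))
  obtain ⟨b, hb, hqb⟩ := exists_summable_charge_bound ht hp (abs_nonneg K) hΩ hK' A
  refine ⟨∑' n, b n, fun s hs => ?_⟩
  obtain ⟨q', hq'⟩ := (hq.charge s hs).exists_linear
  have hsum : ∀ N, q s (evoPartial h t N A) = ∑ n ∈ Finset.range N, q s (evoTerm h t n A) := by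
    intro N
    simp only [← hq', evoPartial_apply, map_sum]
  constructor
  · intro N
    rw [hsum]
    exact (norm_sum_le_of_le _ fun n _ => hqb s hs n).trans
      (hb.sum_le_tsum _ fun n _ => (norm_nonneg _).trans (hqb s hs n))
  · refine tendsto_nhds_limUnder ⟨∑' n, q s (evoTerm h t n A), ?_⟩
    simp only [hsum]
    exact (Summable.of_norm_bounded hb (hqb s hs)).hasSum.tendsto_sum_nat

/-- The evolved charges are bounded for the susceptibilities of the evolved states, hence they are
pseudolocal charges, and the evolved states flow along them. -/
theorem IsPseudolocalFlow.comp [NeZero d] (hD : 1 ≤ D) {h : O.Obs} (hh : star h = h) {t : ℝ}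
    (ht : SmallTime h t) {φ : O.Quasi →⋆ₐ[ℂ] O.Quasi} (hφ : IsEvolution h t φ) {p : ℝ}
    (hp : (D : ℝ) < p) {Ω : ℝ → State O} {q : ℝ → O.Obs → ℂ} (hq : IsPseudolocalFlow Ω q)
    (hΩ : UniformlySizablyClustering p Ω)
    (hcl : ∀ s ∈ Set.Icc (0 : ℝ) 1, IsClustering ((Ω s).comp φ)) :
    IsPseudolocalFlow (fun s => (Ω s).comp φ) (evolvedCharge h t q) := by
  have hlim : ∀ s ∈ Set.Icc (0 : ℝ) 1, ∀ A : O.Obs,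
      Tendsto (fun N => q s (evoPartial h t N A)) atTop (𝓝 (evolvedCharge h t q s A)) :=
    fun s hs A => (tendsto_evolvedCharge ht hp hΩ hq A).choose_spec s hs |>.2
  obtain ⟨K, hK⟩ := hq.bounded
  have hbound : ∀ s ∈ Set.Icc (0 : ℝ) 1, ∀ A : O.Obs,
      ‖evolvedCharge h t q s A‖ ≤ K * symNorm ((Ω s).comp φ) A := by
    intro s hs A
    obtain ⟨ν, a, hν, -, hsc⟩ := hΩ
    exact le_of_tendsto_of_tendsto' (hlim s hs A).norm
      ((hφ.tendsto_symNorm hh ht (hsc s hs).1 hp (by positivity)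
        ((hsc s hs).covBound hν) A).const_mul K) fun N => hK s hs _
  have hmeas : ∀ A : O.Obs,
      Measurable fun s : Set.Icc (0 : ℝ) 1 => evolvedCharge h t q s A := fun A =>
    measurable_of_tendsto_metrizable (fun N => hq.measurable (evoPartial h t N A))
      (tendsto_pi_nhds.2 fun s => hlim s s.2 A)
  refine ⟨hcl, fun s hs => ?_, ⟨K, hbound⟩, hmeas, fun A => ?_, fun A s₁ s₂ h1 h12 h2 => ?_⟩
  · obtain ⟨q', hq'⟩ := (hq.charge s hs).exists_linear
    let L : O.Obs →ₗ[ℂ] ℂ := linearMapOfTendsto (evolvedCharge h t q s)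
      (fun N => q' ∘ₗ evoPartial h t N) (tendsto_pi_nhds.2 fun A => by
        simpa only [LinearMap.comp_apply, hq'] using hlim s hs A)
    exact (hcl s hs).isPseudolocalCharge hD L (hbound s hs)
  · obtain ⟨M, hM⟩ := tendsto_evolvedCharge ht hp hΩ hq A
    refine Integrable.of_bound (μ := volume.restrict (Set.Icc (0 : ℝ) 1)) ?_ M ?_
    · exact ((aemeasurable_restrict_iff_comap_subtype measurableSet_Icc
        (f := fun s => evolvedCharge h t q s A)).2 (hmeas A).aemeasurable).aestronglyMeasurable
    · refine (ae_restrict_iff' measurableSet_Icc).2 (Eventually.of_forall fun s hs => ?_)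
      exact le_of_tendsto' (hlim s hs A).norm (hM s hs).1
  · obtain ⟨M, hM⟩ := tendsto_evolvedCharge ht hp hΩ hq A
    have hsub : Set.uIoc s₁ s₂ ⊆ Set.Icc (0 : ℝ) 1 := by
      rw [Set.uIoc_of_le h12.le]
      exact fun s hs => ⟨h1.trans hs.1.le, hs.2.trans h2⟩
    have h3 : Tendsto (fun N => ∫ s in s₁..s₂, q s (evoPartial h t N A)) atTop
        (𝓝 (∫ s in s₁..s₂, evolvedCharge h t q s A)) := by
      refine intervalIntegral.tendsto_integral_filter_of_dominated_convergence (fun _ => M) ?_ ?_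
        intervalIntegrable_const ?_
      · exact Eventually.of_forall fun N =>
          ((hq.integrable (evoPartial h t N A)).mono_set hsub).aestronglyMeasurable
      · exact Eventually.of_forall fun N => Eventually.of_forall fun s hs =>
          (hM s (hsub hs)).1 N
      · exact Eventually.of_forall fun s hs => hlim s (hsub hs) A
    refine tendsto_nhds_unique ((hφ.tendsto_ev ht (Ω s₂) A).sub (hφ.tendsto_ev ht (Ω s₁) A))
      (h3.congr fun N => ?_)
    exact (hq.flow (evoPartial h t N A) s₁ s₂ h1 h12 h2).symm

theorem State.ext_toLinearMap {ω ω' : State O} (h : ω.toLinearMap = ω'.toLinearMap) : ω = ω' := by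
  cases ω
  cases ω'
  congr

/-- Stability of pseudolocal states under the evolution over a small time. -/
theorem IsPseudolocalState.comp_of_small [NeZero d] (hD : 1 ≤ D) {h : O.Obs} (hh : star h = h)
    {t : ℝ} (ht : |t| ≤ evoRadius h) {φ : O.Quasi →⋆ₐ[ℂ] O.Quasi} (hφ : IsEvolution h t φ)
    {ω : State O} (hω : IsPseudolocalState ω) : IsPseudolocalState (ω.comp φ) := by
  obtain ⟨p, hp, Ω, q, hq, hΩ, htr, hω⟩ := hω
  have hst := smallTime_of_le ht
  obtain ⟨ν, a, hν, ha, hcl⟩ := id hΩ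
  -- any power strictly between `D` and `p` will do
  obtain ⟨p', hp', hpp⟩ := exists_between hp
  obtain ⟨ν', a', hν', ha', hcl'⟩ :=
    exists_isSizablyClusteringWith_comp (O := O) hD h ht hp' hpp hν ha
  have hclφ : ∀ s ∈ Set.Icc (0 : ℝ) 1, IsSizablyClusteringWith p' ν' a' ((Ω s).comp φ) :=
    fun s hs => hcl' _ _ hφ (hcl s hs)
  refine ⟨p', hp', fun s => (Ω s).comp φ, evolvedCharge h t q,
    hq.comp hD hh hst hφ hp hΩ fun s hs => (hclφ s hs).isClustering hp' hν',
    ⟨ν', a', hν', ha', hclφ⟩, htr.comp hφ hst, ?_⟩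
  exact congrArg (fun ω' : State O => ω'.comp φ) hω

theorem IsPseudolocalState.comp_pow {ω : State O} {φ : O.Quasi →⋆ₐ[ℂ] O.Quasi}
    (hφ : ∀ ω : State O, IsPseudolocalState ω → IsPseudolocalState (ω.comp φ))
    (hω : IsPseudolocalState ω) (n : ℕ) : IsPseudolocalState (ω.comp (φ ^ n)) := by
  induction n with
  | zero =>
    have h1 : ω.comp (φ ^ 0) = ω := State.ext_toLinearMap (LinearMap.ext fun A => rfl)
    rwa [h1]
  | succ n ih =>
    have h1 : ω.comp (φ ^ (n + 1)) = (ω.comp (φ ^ n)).comp φ :=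
      State.ext_toLinearMap (LinearMap.ext fun A => by
        rw [pow_succ]
        rfl)
    rw [h1]
    exact hφ _ ih

end QuantumLattice

end

open QuantumLattice

theorem mainTheorem4 {D d : ℕ} (hD : 1 ≤ D) (hd : 1 ≤ d) (O : LocalAlgebra D d)
    (h : O.Obs) (hh : star h = h) (ω : State O) (hω : IsPseudolocalState ω) :
    (∃! τ : ℝ → (O.Quasi →⋆ₐ[ℂ] O.Quasi), IsTimeEvolution h τ) ∧
      ∀ τ : ℝ → (O.Quasi →⋆ₐ[ℂ] O.Quasi), IsTimeEvolution h τ →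
        ∀ t : ℝ, IsPseudolocalState (ω.comp (τ t)) := by
  have : NeZero d := ⟨by omega⟩
  constructor
  · obtain ⟨τ, hτ, -⟩ := exists_isTimeEvolution hh
    exact ⟨τ, hτ, fun τ' hτ' => hτ'.unique hτ⟩
  · intro τ hτ t
    obtain ⟨n, u, hu, rfl⟩ := exists_eq_nat_mul (evoRadius_pos h) t
    rw [hτ.mul_eq_pow]
    exact hω.comp_pow (fun ω' hω' => hω'.comp_of_small hD hh hu (hτ.apply_incl hh hu)) n
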